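/- **Setting.** Let $\Omega\subset\mathbb R^2$ be a polygon, $f\in L_2(\Omega)$, and let $u\in H^1_0(\Omega)$ be the weak solution of $-\Delta u=f$ in $\Omega$, $u=0$ on $\partial\Omega$. Let $\mathcal T$ be a conforming partition of $\Omega$ into finitely many triangles (so $\Omega$ is the interior of their union) which is shape regular with constant $\kappa$: the diameter of each triangle is at most $\kappa$ times the radius of some disc contained in it. Let $U_{\mathcal T}\subset H^1_0(\Omega)$ be a linear space of continuous piecewise polynomials with respect to $\mathcal T$, whose degree may vary from triangle to triangle, that contains all continuous piecewise affine functions in $H^1_0(\Omega)$. Let $u_{\mathcal T}\in U_{\mathcal T}$ be the Galerkin solution: $\int_\Omega\nabla u_{\mathcal T}\cdot\nabla v=\int_\Omega fv$ for all $v\in U_{\mathcal T}$. For a vertex $a$ in the set $\mathcal V_{\mathcal T}$ of all vertices of $\mathcal T$, let $\psi_a$ be the continuous piecewise affine function with value $1$ at $a$ and $0$ at all other vertices, and let $\omega_a$ be the interior of the union of the triangles that share the vertex $a$. Let $$H^1_*(\omega_a)=\begin{cases}\{v\in H^1(\omega_a):\int_{\omega_a}v=0\}& \text{if } a\in\Omega,\\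 \{v\in H^1(\omega_a): v=0\text{ on }\partial\omega_a\cap\partial\Omega\}&\text{if }a\in\partial\Omega,\end{cases}$$ equipped with the norm $\|\nabla v\|_{\omega_a}$, where $\|\cdot\|_\omega$ is the $L_2(\omega)$-norm, and let $$r_a(v)=\int_\Omega f\,\psi_a v-\int_\Omega\nabla u_{\mathcal T}\cdot\nabla(\psi_a v),$$ with $\psi_a v$ extended by zero outside $\omega_a$, and $\|r_a\|_{H^1_*(\omega_a)'}=\sup_{0\ne v\in H^1_*(\omega_a)}|r_a(v)|/\|\nabla v\|_{\omega_a}$. **Proposition (reliability and efficiency).** For every $\kappa$ there is a constant $C_1>0$, depending only on $\kappa$ (and so not on $\Omega$, $f$, $\mathcal T$, $U_{\mathcal T}$ or the polynomial degrees), such that in the above setting $$\|\nabla(u-u_{\mathcal T})\|_\Omega^2\le 3\sum_{a\in\mathcal V_{\mathcal T}}\|r_a\|^2_{H^1_*(\omega_a)'},\qquad \|r_a\|_{H^1_*(\omega_a)'}\le C_1\,\|\nabla(u-u_{\mathcal T})\|_{\omega_a}\quad(a\in\mathcal V_{\mathcal T}).$$ -/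

import Mathlib

open MeasureTheory Filter Topology Set
open scoped ENNReal

noncomputable section

namespace HatResidual

/-- The Euclidean plane. -/
abbrev Plane : Type := EuclideanSpace ℝ (Fin 2)

/-! ### Sobolev spaces on open subsets of the plane

Elements of `L²(ω)` and `H¹(ω)` are represented by functions on the whole plane; only their values
almost everywhere in `ω` matter. -/

/-- The `L²(ω)` norm of a scalar or vector valued function, with values in `[0, ∞]`. -/
def normL2 {F : Type*} [NormedAddCommGroup F] (ω : Set Plane) (g : Plane → F) : ℝ≥0∞ :=
  eLpNorm g 2 (volume.restrict ω)

/-- `g` belongs to `L²(ω)`. -/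
def MemL2 {F : Type*} [NormedAddCommGroup F] (ω : Set Plane) (g : Plane → F) : Prop :=
  MemLp g 2 (volume.restrict ω)

/-- `φ ∈ C_c^∞(ω)`. -/
def IsTestFunction (ω : Set Plane) (φ : Plane → ℝ) : Prop :=
  ContDiff ℝ (⊤ : ℕ∞) φ ∧ HasCompactSupport φ ∧ tsupport φ ⊆ ω

/-- `g ∈ L²(ω)²` is a weak gradient of `v ∈ L²(ω)` on the open set `ω`. -/
structure HasWeakGrad (ω : Set Plane) (v : Plane → ℝ) (g : Plane → Plane) : Prop where
  memL2 : MemL2 ω v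
  memL2_grad : MemL2 ω g
  integral_eq : ∀ φ, IsTestFunction ω φ →
    ∫ x in ω, v x • gradient φ x = -∫ x in ω, φ x • g x

/-- `v ∈ H¹(ω)`. -/
def MemH1 (ω : Set Plane) (v : Plane → ℝ) : Prop :=
  ∃ g, HasWeakGrad ω v g

open Classical in
/-- The weak gradient on `ω` of `v ∈ H¹(ω)`, which is unique almost everywhere in `ω`
(the value `0` is taken if `v ∉ H¹(ω)`). -/
def weakGrad (ω : Set Plane) (v : Plane → ℝ) : Plane → Plane :=
  if h : MemH1 ω v then h.choose else 0

/-- `v` lies in the closure in `H¹(ω)` of a class `D` of smooth functions. -/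
def MemH1Closure (ω : Set Plane) (D : Set (Plane → ℝ)) (v : Plane → ℝ) : Prop :=
  MemH1 ω v ∧ ∃ φ : ℕ → Plane → ℝ, (∀ n, φ n ∈ D) ∧
    Tendsto (fun n => normL2 ω (fun x => v x - φ n x)) atTop (𝓝 0) ∧
    Tendsto (fun n => normL2 ω (fun x => weakGrad ω v x - gradient (φ n) x)) atTop (𝓝 0)

/-- `v ∈ H¹₀(ω)`: the closure of `C_c^∞(ω)` in `H¹(ω)`. -/
def MemH10 (ω : Set Plane) (v : Plane → ℝ) : Prop :=
  MemH1Closure ω {φ | IsTestFunction ω φ} v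

/-- `v ∈ H¹(ω)` and `v = 0` on the closed part `Γ` of the boundary of `ω`: the closure in `H¹(ω)` of
the restrictions to `ω` of the functions in `C_c^∞(ℝ²)` that vanish near `Γ`. -/
def MemH1VanishingOn (ω Γ : Set Plane) (v : Plane → ℝ) : Prop :=
  MemH1Closure ω {φ | IsTestFunction Γᶜ φ} v

/-- The norm of a functional `r` in the dual of a space `V` of functions in `H¹(ω)` that is equipped
with `‖∇ ·‖_ω`, i.e. the supremum of `|r(v)| / ‖∇ v‖_ω` (with `0 / 0 = 0`). It is `∞` if `r` is
unbounded. -/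
def dualNorm (ω : Set Plane) (V : Set (Plane → ℝ)) (r : (Plane → ℝ) → ℝ) : ℝ≥0∞ :=
  ⨆ v ∈ V, ‖r v‖ₑ / normL2 ω (weakGrad ω v)

/-! ### Triangulations

A conforming triangulation is a finite simplicial complex in the plane (the intersection of two
triangles is empty, a common vertex or a common edge), each face of which is a triangle or a vertex
or an edge of a triangle. -/

/-- The triangles of `K`, given by their sets of vertices. -/
def triangles (K : Geometry.SimplicialComplex ℝ Plane) : Set (Finset Plane) :=
  {T | T ∈ K.faces ∧ T.card = 3}

/-- `K` is a conforming partition of the polygon `Ω` into triangles. In particular `Ω` is the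
interior of a finite union of triangles. -/
structure IsTriangulation (K : Geometry.SimplicialComplex ℝ Plane) (Ω : Set Plane) : Prop where
  finite : K.faces.Finite
  pure : ∀ s ∈ K.faces, ∃ T ∈ triangles K, s ⊆ T
  domain_eq : Ω = interior K.space

/-- Shape regularity with constant `κ`: the diameter of each triangle is at most `κ` times the radius
of some disc contained in it. -/
def IsShapeRegular (K : Geometry.SimplicialComplex ℝ Plane) (κ : ℝ) : Prop :=
  ∀ T ∈ triangles K, ∃ (c : Plane) (ρ : ℝ), 0 < ρ ∧
    Metric.closedBall c ρ ⊆ convexHull ℝ (T : Set Plane) ∧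
    Metric.diam (convexHull ℝ (T : Set Plane)) ≤ κ * ρ

/-- `w` is the family of barycentric coordinates of the point `x` with respect to the vertices of
`K`. (It exists and is unique for each `x ∈ K.space`.) -/
def IsBarycentric (K : Geometry.SimplicialComplex ℝ Plane) (x : Plane) (w : Plane → ℝ) : Prop :=
  ∃ s ∈ K.faces, (∀ y ∈ s, 0 ≤ w y) ∧ (∀ y, y ∉ s → w y = 0) ∧
    ∑ y ∈ s, w y = 1 ∧ ∑ y ∈ s, w y • y = x

open Classical in
/-- The hat function `ψ_a`, i.e. the function that is affine on each triangle, equal to `1` at the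
vertex `a` and to `0` at all other vertices: its value at `x` is the barycentric coordinate of `x`
with respect to `a`. It is extended by zero outside the triangulated polygon. -/
def hat (K : Geometry.SimplicialComplex ℝ Plane) (a x : Plane) : ℝ :=
  if h : ∃ w, IsBarycentric K x w then h.choose a else 0

/-- The star `ω_a`: the interior of the union of the triangles that share the vertex `a`. -/
def starDomain (K : Geometry.SimplicialComplex ℝ Plane) (a : Plane) : Set Plane :=
  interior (⋃ T ∈ {T | T ∈ triangles K ∧ a ∈ T}, convexHull ℝ (T : Set Plane))

/-- The space `H¹_*(ω_a)`: vanishing mean for a vertex `a` in the interior of `Ω`, and vanishing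
values on `∂ω_a ∩ ∂Ω` for a vertex `a` on the boundary. -/
def starSpace (K : Geometry.SimplicialComplex ℝ Plane) (Ω : Set Plane) (a : Plane) :
    Set (Plane → ℝ) :=
  {v | (a ∈ Ω ∧ MemH1 (starDomain K a) v ∧ ∫ x in starDomain K a, v x = 0) ∨
    (a ∈ frontier Ω ∧ MemH1VanishingOn (starDomain K a) (frontier (starDomain K a) ∩ frontier Ω) v)}

/-! ### Finite elements -/

/-- The continuous functions in `H¹₀(Ω)` (represented by their continuous extension by zero) whose
restriction to each triangle `T` is a polynomial of total degree at most `p T`. -/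
def piecewisePoly (K : Geometry.SimplicialComplex ℝ Plane) (Ω : Set Plane) (p : Finset Plane → ℕ) :
    Set (Plane → ℝ) :=
  {v | Continuous v ∧ (∀ x, x ∉ Ω → v x = 0) ∧ MemH10 Ω v ∧
    ∀ T ∈ triangles K, ∃ P : MvPolynomial (Fin 2) ℝ, P.totalDegree ≤ p T ∧
      ∀ x ∈ convexHull ℝ (T : Set Plane), v x = MvPolynomial.eval (fun i => x i) P}

/-- `U` is a finite element space: a linear space of continuous piecewise polynomials in `H¹₀(Ω)`, of
some variable degree `p`, that contains the continuous piecewise affine functions in `H¹₀(Ω)`. -/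
structure IsFESpace (K : Geometry.SimplicialComplex ℝ Plane) (Ω : Set Plane)
    (U : Submodule ℝ (Plane → ℝ)) : Prop where
  piecewise_poly : ∃ p : Finset Plane → ℕ, (U : Set (Plane → ℝ)) ⊆ piecewisePoly K Ω p
  affine_subset : piecewisePoly K Ω (fun _ => 1) ⊆ (U : Set (Plane → ℝ))

/-- The residual `⟨f, v⟩_Ω - ⟨∇w, ∇v⟩_Ω` of `w`. -/
def residual (Ω : Set Plane) (f w v : Plane → ℝ) : ℝ :=
  (∫ x in Ω, f x * v x) - ∫ x in Ω, inner ℝ (weakGrad Ω w x) (weakGrad Ω v x)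

/-- The localized residual `r_a(v)`: the residual of `w` at `ψ_a v`. For `v` defined on `ω_a` only,
`ψ_a v` is the extension by zero, as `ψ_a` vanishes outside the closure of `ω_a`. -/
def localResidual (K : Geometry.SimplicialComplex ℝ Plane) (Ω : Set Plane) (f w : Plane → ℝ)
    (a : Plane) (v : Plane → ℝ) : ℝ :=
  residual Ω f w (fun x => hat K a x * v x)

/-- `u ∈ H¹₀(Ω)` is the weak solution of `-Δu = f` in `Ω`, `u = 0` on `∂Ω`. -/
def IsWeakSolution (Ω : Set Plane) (f u : Plane → ℝ) : Prop :=
  MemH10 Ω u ∧ ∀ v, MemH10 Ω v → residual Ω f u v = 0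

/-- `uT` is the Galerkin approximation from `U` of the weak solution. -/
def IsGalerkinSolution (Ω : Set Plane) (f : Plane → ℝ) (U : Submodule ℝ (Plane → ℝ))
    (uT : Plane → ℝ) : Prop :=
  uT ∈ U ∧ ∀ v ∈ U, residual Ω f uT v = 0

end HatResidual

end

open HatResidual

/-!
The functional `v ↦ r_a(v)` is the pairing of the gradient of the error `e = u - u_T` with
`∇(ψ_a v)`, because `ψ_a v` is an admissible test function, i.e. in `H¹₀(Ω)`
(`hat_mul_of_mem_starSpace`, `residual_eq`). Everything rests on the fact that the multiplication by
`ψ_a` is bounded from `H¹_*(ω_a)`, with the norm `‖∇ v‖`, to `H¹₀(Ω)`, with a constant that depends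
only on the shape regularity `κ`.

*Efficiency* is then the Cauchy–Schwarz inequality (`dualNorm_localResidual_le`).

*Reliability.* As the hat functions are a partition of unity, `‖∇ e‖²` is the sum over the vertices of
the pairings of `∇ e` with `∇(ψ_a e)`. If `a` is an interior vertex, then `ψ_a` is in the finite
element space, and by Galerkin orthogonality `e` may be replaced by `e` minus its mean over `ω_a`; if
`a` is on the boundary, then `e` itself vanishes on `∂ω_a ∩ ∂Ω`. In both cases the pairing is the
local residual at an element of `H¹_*(ω_a)` with gradient `∇ e`, and it is at most
`‖r_a‖ ‖∇ e‖_{ω_a}` (`exists_hasWeakGrad_hat_mul_error`). Almost every point is in three stars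
(`ae_card_starDomain_le`), so that the Cauchy–Schwarz inequality for sums gives the constant `3`
(`reliability`).

*The bound of the multiplication.* The term `ψ_a ∇ v` is harmless, and `v ∇ψ_a` requires an inequality
of Poincaré type without any information on the size or the number of the triangles in the star.
Scale invariance provides it. The *level* `1 - ψ_a`, continued to the cone that is spanned by the star,
is positively homogeneous with respect to `a`, and shape regularity says that it is Lipschitz
continuous in the sense that the distance to `a` times the slope is at most `κ / 2` times the level
(`eventually_level_sub_le`, `norm_gradient_hat_le`). In particular `‖x - a‖ ‖∇ψ_a(x)‖ ≤ κ / 2`.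

* At a boundary vertex the estimate follows from Hardy's inequality `‖v / |x - a|‖ ≤ C ‖∇ v‖`
  (`hardy_closedStar`). In coordinates (level, angle), each curve of constant level that starts in the
  star can be followed, within the star, to an end of the cone, where the ray is part of
  `∂ω_a ∩ ∂Ω` and `v` vanishes. The curve turns by an angle of at most `2π`, and its speed is at most
  `1 + κ / 2` times the distance to `a`, so that integrating `∇ v` along it bounds `v / |x - a|`.
* At an interior vertex the cone is the whole plane. The logarithm of the level has slope at most
  `κ / 2` along the unit circle around `a`, so that the ratio of the maximum to the minimum of the
  level on this circle is at most `exp (π κ)` (`exists_level_bounds`). The star is star shaped with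
  respect to a disc whose radius is comparable to the diameter of the star, and Poincaré's inequality
  for such domains (`poincare_starShaped`) applies.

These inequalities are shown for smooth functions and extended by density. At a boundary vertex, the
approximating functions are those in the definition of `H¹_*(ω_a)`. At an interior vertex, mollification
(`HasWeakGrad.exists_approx`) provides approximations on compact subsets of the star, the sublevel sets
of the level, which exhaust it.
-/

namespace HatResidual

/-! ### Square integrable functions -/

theorem eLpNorm_two_sq {α F : Type*} [MeasurableSpace α] [NormedAddCommGroup F] (μ : Measure α)
    (f : α → F) : eLpNorm f 2 μ ^ 2 = ∫⁻ x, ‖f x‖ₑ ^ 2 ∂μ := by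
  have h := eLpNorm_nnreal_pow_eq_lintegral (μ := μ) (f := f) (p := 2) two_ne_zero
  norm_cast at h
  simpa only [ENNReal.rpow_ofNat] using h

/-- The Cauchy–Schwarz inequality for `lintegral`, in squared form. -/
theorem sq_lintegral_mul_le {α : Type*} [MeasurableSpace α] (μ : Measure α) {f g : α → ℝ≥0∞}
    (hf : AEMeasurable f μ) (hg : AEMeasurable g μ) :
    (∫⁻ x, f x * g x ∂μ) ^ 2 ≤ (∫⁻ x, f x ^ 2 ∂μ) * ∫⁻ x, g x ^ 2 ∂μ := by
  have h := ENNReal.lintegral_mul_le_Lp_mul_Lq μ Real.HolderConjugate.two_two hf hg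
  calc (∫⁻ x, f x * g x ∂μ) ^ 2
      ≤ ((∫⁻ x, f x ^ (2 : ℝ) ∂μ) ^ (1 / 2 : ℝ) * (∫⁻ x, g x ^ (2 : ℝ) ∂μ) ^ (1 / 2 : ℝ)) ^ 2 := by
        gcongr
        exact h
    _ = _ := by
        rw [mul_pow, ← ENNReal.rpow_natCast, ← ENNReal.rpow_natCast, ← ENNReal.rpow_mul,
          ← ENNReal.rpow_mul]
        norm_num

theorem sq_lintegral_le {α : Type*} [MeasurableSpace α] (μ : Measure α) {f : α → ℝ≥0∞}
    (hf : AEMeasurable f μ) :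
    (∫⁻ x, f x ∂μ) ^ 2 ≤ μ univ * ∫⁻ x, f x ^ 2 ∂μ := by
  simpa using sq_lintegral_mul_le μ (f := fun _ => 1) aemeasurable_const hf

theorem integrable_smul_of_memLp_two {α F : Type*} [MeasurableSpace α] {μ : Measure α}
    [NormedAddCommGroup F] [NormedSpace ℝ F] {v : α → ℝ} {g : α → F} (hv : MemLp v 2 μ)
    (hg : MemLp g 2 μ) : Integrable (fun x => v x • g x) μ :=
  memLp_one_iff_integrable.1 (MemLp.smul (r := 1) hg hv)

theorem integrable_inner_of_memLp_two {α F : Type*} [MeasurableSpace α] {μ : Measure α}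
    [NormedAddCommGroup F] [InnerProductSpace ℝ F] {v g : α → F} (hv : MemLp v 2 μ)
    (hg : MemLp g 2 μ) : Integrable (fun x => inner ℝ (v x) (g x)) μ := by
  refine ((integrable_smul_of_memLp_two hv.norm hg.norm)).mono'
    (hv.1.inner hg.1) (Eventually.of_forall fun x => ?_)
  exact norm_inner_le_norm _ _

/-- `L²` convergence from pointwise convergence and domination. -/
theorem tendsto_eLpNorm_two_of_dominated {α F : Type*} [MeasurableSpace α] {μ : Measure α}
    [NormedAddCommGroup F] {h : ℕ → α → F} {b : α → ℝ} (hm : ∀ n, AEStronglyMeasurable (h n) μ)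
    (hb : MemLp b 2 μ) (hle : ∀ n, ∀ᵐ x ∂μ, ‖h n x‖ ≤ b x)
    (hlim : ∀ᵐ x ∂μ, Tendsto (fun n => h n x) atTop (𝓝 0)) :
    Tendsto (fun n => eLpNorm (h n) 2 μ) atTop (𝓝 0) := by
  have key : Tendsto (fun n => ∫⁻ x, ‖h n x‖ₑ ^ 2 ∂μ) atTop (𝓝 (∫⁻ _, 0 ∂μ)) := by
    refine tendsto_lintegral_of_dominated_convergence' (fun x => ‖b x‖ₑ ^ 2)
      (fun n => (hm n).enorm.pow_const 2) (fun n => ?_) ?_ ?_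
    · filter_upwards [hle n] with x hx
      gcongr
      exact enorm_le_iff_norm_le.2 (hx.trans (le_abs_self _))
    · rw [← eLpNorm_two_sq]
      exact ENNReal.pow_ne_top hb.2.ne
    · filter_upwards [hlim] with x hx
      have := (ENNReal.continuous_pow 2).tendsto _ |>.comp (hx.enorm)
      rwa [enorm_zero, zero_pow two_ne_zero] at this
  simp only [← eLpNorm_two_sq, lintegral_zero] at key
  have h2 := (ENNReal.continuous_rpow_const (y := 1 / 2)).tendsto _ |>.comp key
  simp only [Function.comp_def, ← ENNReal.rpow_natCast, ← ENNReal.rpow_mul] at h2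
  simpa using h2

/-! ### Test functions -/

theorem IsTestFunction.continuous {ω : Set Plane} {φ : Plane → ℝ} (h : IsTestFunction ω φ) :
    Continuous φ := h.1.continuous

theorem continuous_gradient {φ : Plane → ℝ} (h : ContDiff ℝ 1 φ) : Continuous (gradient φ) :=
  (InnerProductSpace.toDual ℝ Plane).symm.continuous.comp (h.continuous_fderiv one_ne_zero)

theorem norm_gradient (φ : Plane → ℝ) (x : Plane) : ‖gradient φ x‖ = ‖fderiv ℝ φ x‖ := by
  simp [gradient]

theorem measurable_gradient (φ : Plane → ℝ) : Measurable (gradient φ) :=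
  (InnerProductSpace.toDual ℝ Plane).symm.continuous.measurable.comp (measurable_fderiv ℝ φ)

theorem support_gradient_subset (φ : Plane → ℝ) : Function.support (gradient φ) ⊆ tsupport φ := by
  intro x hx
  by_contra h
  apply hx
  have : φ =ᶠ[𝓝 x] fun _ => 0 := notMem_tsupport_iff_eventuallyEq.1 h
  rw [this.gradient_eq, gradient_fun_const]

theorem hasCompactSupport_gradient {φ : Plane → ℝ} (h : HasCompactSupport φ) :
    HasCompactSupport (gradient φ) :=
  h.mono' (support_gradient_subset φ)

theorem gradient_eq_zero_of_notMem {φ : Plane → ℝ} {x : Plane} (h : x ∉ tsupport φ) :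
    gradient φ x = 0 := by
  by_contra hx
  exact h (support_gradient_subset φ hx)

theorem IsTestFunction.contDiff_one {ω : Set Plane} {φ : Plane → ℝ} (h : IsTestFunction ω φ) :
    ContDiff ℝ 1 φ := h.1.of_le (by exact_mod_cast le_top)

theorem IsTestFunction.memLp {ω : Set Plane} {φ : Plane → ℝ} (h : IsTestFunction ω φ)
    (s : Set Plane) : MemL2 s φ :=
  (h.continuous.memLp_of_hasCompactSupport h.2.1).restrict s

theorem IsTestFunction.memLp_gradient {ω : Set Plane} {φ : Plane → ℝ} (h : IsTestFunction ω φ)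
    (s : Set Plane) : MemL2 s (gradient φ) :=
  ((continuous_gradient h.contDiff_one).memLp_of_hasCompactSupport
    (hasCompactSupport_gradient h.2.1)).restrict s

theorem IsTestFunction.mono {ω ω' : Set Plane} {φ : Plane → ℝ} (h : IsTestFunction ω φ)
    (hs : ω ⊆ ω') : IsTestFunction ω' φ := ⟨h.1, h.2.1, h.2.2.trans hs⟩

theorem IsTestFunction.lipschitz {ω : Set Plane} {φ : Plane → ℝ} (h : IsTestFunction ω φ) :
    ∃ C, LipschitzWith C φ :=
  h.contDiff_one.lipschitzWith_of_hasCompactSupport h.2.1 one_ne_zero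

/-! ### Weak gradients -/

theorem HasWeakGrad.ae_eq {ω : Set Plane} (hω : IsOpen ω) {v : Plane → ℝ} {g g' : Plane → Plane}
    (h : HasWeakGrad ω v g) (h' : HasWeakGrad ω v g') : g =ᵐ[volume.restrict ω] g' := by
  have hint : LocallyIntegrableOn (fun x => g x - g' x) ω volume := by
    have := (h.memL2_grad.sub h'.memL2_grad).locallyIntegrable (by norm_num)
    exact locallyIntegrableOn_of_locallyIntegrable_restrict this
  have key := hω.ae_eq_zero_of_integral_contDiff_smul_eq_zero hint fun φ h1 h2 h3 => by
    have ht : IsTestFunction ω φ := ⟨h1, h2, h3⟩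
    have e : ∫ x in ω, φ x • (g x - g' x) = 0 := by
      simp only [smul_sub]
      rw [integral_sub (integrable_smul_of_memLp_two (ht.memLp ω) h.memL2_grad)
        (integrable_smul_of_memLp_two (ht.memLp ω) h'.memL2_grad), sub_eq_zero, ← neg_inj,
        ← h.integral_eq φ ht, ← h'.integral_eq φ ht]
    rw [← e]
    refine (setIntegral_eq_integral_of_forall_compl_eq_zero fun x hx => ?_).symm
    rw [image_eq_zero_of_notMem_tsupport fun hx' => hx (h3 hx'), zero_smul]
  rw [Filter.EventuallyEq, ae_restrict_iff' hω.measurableSet]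
  filter_upwards [key] with x hx hxω
  exact sub_eq_zero.1 (hx hxω)

theorem HasWeakGrad.memH1 {ω : Set Plane} {v : Plane → ℝ} {g : Plane → Plane}
    (h : HasWeakGrad ω v g) : MemH1 ω v := ⟨g, h⟩

theorem MemH1.hasWeakGrad {ω : Set Plane} {v : Plane → ℝ} (h : MemH1 ω v) :
    HasWeakGrad ω v (weakGrad ω v) := by
  rw [weakGrad, dif_pos h]
  exact h.choose_spec

theorem HasWeakGrad.weakGrad_ae_eq {ω : Set Plane} (hω : IsOpen ω) {v : Plane → ℝ}
    {g : Plane → Plane} (h : HasWeakGrad ω v g) : weakGrad ω v =ᵐ[volume.restrict ω] g :=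
  h.memH1.hasWeakGrad.ae_eq hω h

theorem HasWeakGrad.congr {ω : Set Plane} {v v' : Plane → ℝ} {g g' : Plane → Plane}
    (h : HasWeakGrad ω v g) (hv : v =ᵐ[volume.restrict ω] v')
    (hg : g =ᵐ[volume.restrict ω] g') : HasWeakGrad ω v' g' := by
  refine ⟨h.memL2.ae_eq hv, h.memL2_grad.ae_eq hg, fun φ hφ => ?_⟩
  have e1 : ∫ x in ω, v' x • gradient φ x = ∫ x in ω, v x • gradient φ x :=
    integral_congr_ae (by filter_upwards [hv] with x hx; rw [hx])
  have e2 : ∫ x in ω, φ x • g' x = ∫ x in ω, φ x • g x :=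
    integral_congr_ae (by filter_upwards [hg] with x hx; rw [hx])
  rw [e1, e2, h.integral_eq φ hφ]

theorem HasWeakGrad.add {ω : Set Plane} {v v' : Plane → ℝ} {g g' : Plane → Plane}
    (h : HasWeakGrad ω v g) (h' : HasWeakGrad ω v' g') :
    HasWeakGrad ω (fun x => v x + v' x) (fun x => g x + g' x) := by
  refine ⟨h.memL2.add h'.memL2, h.memL2_grad.add h'.memL2_grad, fun φ hφ => ?_⟩
  simp only [add_smul, smul_add]
  rw [integral_add (integrable_smul_of_memLp_two h.memL2 (hφ.memLp_gradient ω))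
      (integrable_smul_of_memLp_two h'.memL2 (hφ.memLp_gradient ω)),
    integral_add (integrable_smul_of_memLp_two (hφ.memLp ω) h.memL2_grad)
      (integrable_smul_of_memLp_two (hφ.memLp ω) h'.memL2_grad),
    h.integral_eq φ hφ, h'.integral_eq φ hφ, neg_add]

theorem HasWeakGrad.const_mul {ω : Set Plane} {v : Plane → ℝ} {g : Plane → Plane}
    (h : HasWeakGrad ω v g) (c : ℝ) :
    HasWeakGrad ω (fun x => c * v x) (fun x => c • g x) := by
  refine ⟨h.memL2.const_mul c, h.memL2_grad.const_smul c, fun φ hφ => ?_⟩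
  have := h.integral_eq φ hφ
  simp only [mul_smul, smul_comm _ c]
  rw [integral_smul, integral_smul, this, smul_neg]

theorem HasWeakGrad.sub {ω : Set Plane} {v v' : Plane → ℝ} {g g' : Plane → Plane}
    (h : HasWeakGrad ω v g) (h' : HasWeakGrad ω v' g') :
    HasWeakGrad ω (fun x => v x - v' x) (fun x => g x - g' x) := by
  have := h.add (h'.const_mul (-1))
  simpa [sub_eq_add_neg] using this

theorem HasWeakGrad.zero (ω : Set Plane) : HasWeakGrad ω (fun _ => 0) (fun _ => 0) :=
  ⟨MemLp.zero', MemLp.zero', fun φ _ => by simp⟩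

theorem HasWeakGrad.sum {ι : Type*} {ω : Set Plane} (s : Finset ι) {v : ι → Plane → ℝ}
    {g : ι → Plane → Plane} (h : ∀ i ∈ s, HasWeakGrad ω (v i) (g i)) :
    HasWeakGrad ω (fun x => ∑ i ∈ s, v i x) (fun x => ∑ i ∈ s, g i x) := by
  classical
  induction s using Finset.induction_on with
  | empty => simpa using HasWeakGrad.zero ω
  | insert i s hi ih =>
    simp only [Finset.sum_insert hi]
    exact (h i (Finset.mem_insert_self _ _)).add
      (ih fun j hj => h j (Finset.mem_insert_of_mem hj))

theorem HasWeakGrad.mono {ω ω' : Set Plane} {v : Plane → ℝ}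
    {g : Plane → Plane} (h : HasWeakGrad ω v g) (hs : ω' ⊆ ω) : HasWeakGrad ω' v g := by
  have hr : volume.restrict ω' ≤ volume.restrict ω := Measure.restrict_mono hs le_rfl
  refine ⟨h.memL2.mono_measure hr, h.memL2_grad.mono_measure hr, fun φ hφ => ?_⟩
  have hz : ∀ x, x ∉ ω' → φ x = 0 := fun x hx =>
    image_eq_zero_of_notMem_tsupport fun hx' => hx (hφ.2.2 hx')
  have hz' : ∀ x, x ∉ ω' → gradient φ x = 0 := fun x hx =>
    gradient_eq_zero_of_notMem fun hx' => hx (hφ.2.2 hx')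
  have := h.integral_eq φ (hφ.mono hs)
  rw [setIntegral_eq_integral_of_forall_compl_eq_zero fun x hx => by rw [hz' x hx, smul_zero],
    setIntegral_eq_integral_of_forall_compl_eq_zero fun x hx => by rw [hz x hx, zero_smul]]
  rw [setIntegral_eq_integral_of_forall_compl_eq_zero fun x hx => by
      rw [hz' x fun h => hx (hs h), smul_zero],
    setIntegral_eq_integral_of_forall_compl_eq_zero fun x hx => by
      rw [hz x fun h => hx (hs h), zero_smul]] at this
  exact this

/-- Integration by parts: `∇w` is the weak gradient of a Lipschitz function. -/
theorem integral_mul_gradient_of_lipschitz {C : NNReal} {w : Plane → ℝ} (hw : LipschitzWith C w)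
    {φ : Plane → ℝ} (hφ : IsTestFunction univ φ) :
    ∫ x, w x • gradient φ x = -∫ x, φ x • gradient w x := by
  obtain ⟨D, hD⟩ := hφ.lipschitz
  have i1 : Integrable (fun x => w x • gradient φ x) :=
    (hw.continuous.smul (continuous_gradient hφ.contDiff_one)).integrable_of_hasCompactSupport
      (hasCompactSupport_gradient hφ.2.1).smul_left
  have i2 : Integrable (fun x => φ x • gradient w x) := by
    have : Integrable φ := hφ.continuous.integrable_of_hasCompactSupport hφ.2.1
    refine (this.norm.mul_const (C : ℝ)).mono' (hφ.continuous.aestronglyMeasurable.smul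
      (measurable_gradient w).aestronglyMeasurable) (Eventually.of_forall fun x => ?_)
    rw [norm_smul, norm_gradient]
    gcongr
    exact norm_fderiv_le_of_lipschitz ℝ hw
  refine ext_inner_left ℝ fun u => ?_
  rw [inner_neg_right, ← integral_inner i1, ← integral_inner i2]
  have key := LipschitzWith.integral_lineDeriv_mul_eq (μ := volume) hw hD hφ.2.1 u
  have e1 : ∫ x, lineDeriv ℝ φ x (-u) * w x = -∫ x, inner ℝ u (w x • gradient φ x) := by
    rw [← integral_neg]
    refine integral_congr_ae (Eventually.of_forall fun x => ?_)
    have hd : DifferentiableAt ℝ φ x := (hφ.contDiff_one.differentiable one_ne_zero) x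
    simp only [hd.lineDeriv_eq_fderiv, inner_smul_right]
    rw [real_inner_comm, inner_gradient_left, map_neg]
    ring
  have e2 : ∫ x, lineDeriv ℝ w x u * φ x = ∫ x, inner ℝ u (φ x • gradient w x) := by
    refine integral_congr_ae ?_
    filter_upwards [hw.ae_differentiableAt (μ := volume)] with x hx
    simp only [hx.lineDeriv_eq_fderiv, inner_smul_right]
    rw [real_inner_comm, inner_gradient_left]
    ring
  rw [e1, e2] at key
  rw [key, neg_neg]

theorem memLp_gradient_of_lipschitz {C : NNReal} {w : Plane → ℝ} (hw : LipschitzWith C w)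
    (hc : HasCompactSupport w) : MemLp (gradient w) 2 (volume : Measure Plane) := by
  have h1 : MemLp (indicator (tsupport w) fun _ => (C : ℝ)) 2 (volume : Measure Plane) :=
    memLp_indicator_const 2 (isClosed_tsupport w).measurableSet _
      (Or.inr hc.isCompact.measure_lt_top.ne)
  refine h1.mono (measurable_gradient w).aestronglyMeasurable (Eventually.of_forall fun x => ?_)
  by_cases hx : x ∈ tsupport w
  · rw [norm_gradient, indicator_of_mem hx, Real.norm_of_nonneg C.coe_nonneg]
    exact norm_fderiv_le_of_lipschitz ℝ hw
  · rw [gradient_eq_zero_of_notMem hx, norm_zero]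
    positivity

theorem hasWeakGrad_of_lipschitz {C : NNReal} {w : Plane → ℝ} (hw : LipschitzWith C w)
    (hc : HasCompactSupport w) : HasWeakGrad univ w (gradient w) := by
  refine ⟨?_, ?_, fun φ hφ => ?_⟩
  · rw [MemL2, Measure.restrict_univ]
    exact hw.continuous.memLp_of_hasCompactSupport hc
  · rw [MemL2, Measure.restrict_univ]
    exact memLp_gradient_of_lipschitz hw hc
  · rw [Measure.restrict_univ]
    exact integral_mul_gradient_of_lipschitz hw hφ

theorem HasWeakGrad.const {ω : Set Plane} (hfin : volume ω ≠ ⊤) (c : ℝ) :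
    HasWeakGrad ω (fun _ => c) (fun _ => 0) := by
  have : IsFiniteMeasure (volume.restrict ω) := ⟨by simpa using hfin.lt_top⟩
  refine ⟨memLp_const c, MemLp.zero', fun φ hφ => ?_⟩
  have h := integral_mul_gradient_of_lipschitz (LipschitzWith.const c)
    (hφ.mono (subset_univ ω))
  rw [setIntegral_eq_integral_of_forall_compl_eq_zero fun x hx => by
    rw [gradient_eq_zero_of_notMem fun hx' => hx (hφ.2.2 hx'), smul_zero]]
  rw [h]
  simp

/-! ### Mollification -/

/-- A sequence of bump functions at the origin, the `n`th of which is supported in the closed ball of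
radius `1 / (n + 1)`. -/
noncomputable def bumpSeq (n : ℕ) : ContDiffBump (0 : Plane) where
  rIn := 1 / (n + 1) / 2
  rOut := 1 / (n + 1)
  rIn_pos := by positivity
  rIn_lt_rOut := half_lt_self (by positivity)

/-- The mollifier: the convolution of `V` with the `n`th bump function, normalized. -/
noncomputable def mollify {F : Type*} [NormedAddCommGroup F] [NormedSpace ℝ F] (n : ℕ)
    (V : Plane → F) : Plane → F :=
  convolution ((bumpSeq n).normed volume) V (ContinuousLinearMap.lsmul ℝ ℝ) volume

section

variable {F : Type*} [NormedAddCommGroup F] [NormedSpace ℝ F]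

theorem tendsto_bumpSeq_rOut : Tendsto (fun n => (bumpSeq n).rOut) atTop (𝓝 0) :=
  tendsto_one_div_add_atTop_nhds_zero_nat

theorem bumpSeq_rOut_le_one (n : ℕ) : (bumpSeq n).rOut ≤ 1 := by
  simp only [bumpSeq]
  rw [div_le_one (by positivity)]
  linarith [(Nat.cast_nonneg n : (0 : ℝ) ≤ n)]

theorem mollify_apply (n : ℕ) (V : Plane → F) (x : Plane) :
    mollify n V x = ∫ t, (bumpSeq n).normed volume t • V (x - t) := by
  simp [mollify, convolution_lsmul]

theorem mollify_apply' (n : ℕ) (V : Plane → F) (x : Plane) :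
    mollify n V x = ∫ t, (bumpSeq n).normed volume (x - t) • V t := by
  simp [mollify, convolution_lsmul_swap]

theorem contDiff_mollify (n : ℕ) {V : Plane → F} (hV : LocallyIntegrable V volume) :
    ContDiff ℝ (⊤ : ℕ∞) (mollify n V) :=
  ((bumpSeq n).hasCompactSupport_normed (μ := volume)).contDiff_convolution_left
    (μ := volume) _ ((bumpSeq n).contDiff_normed (μ := volume)) hV

theorem mollify_sub (n : ℕ) {V W : Plane → F} (hV : LocallyIntegrable V volume)
    (hW : LocallyIntegrable W volume) (x : Plane) :
    mollify n (fun x => V x - W x) x = mollify n V x - mollify n W x := by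
  have h1 := ((bumpSeq n).hasCompactSupport_normed (μ := volume)).convolutionExists_left
    (ContinuousLinearMap.lsmul ℝ ℝ) (bumpSeq n).continuous_normed hV (μ := volume) x
  have h2 := ((bumpSeq n).hasCompactSupport_normed (μ := volume)).convolutionExists_left
    (ContinuousLinearMap.lsmul ℝ ℝ) (bumpSeq n).continuous_normed hW (μ := volume) x
  simp only [mollify_apply, smul_sub]
  exact integral_sub h1 h2

theorem lintegral_bumpSeq (n : ℕ) : ∫⁻ t, ‖(bumpSeq n).normed volume t‖ₑ = 1 := by
  have h := ofReal_integral_eq_lintegral_ofReal (bumpSeq n).integrable_normed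
    (Eventually.of_forall fun x => (bumpSeq n).nonneg_normed (μ := volume) x)
  rw [(bumpSeq n).integral_normed, ENNReal.ofReal_one] at h
  rw [h]
  exact lintegral_congr fun x => Real.enorm_of_nonneg ((bumpSeq n).nonneg_normed x)

theorem eLpNorm_mollify_le (n : ℕ) {V : Plane → F} (hV : AEStronglyMeasurable V volume) :
    eLpNorm (mollify n V) 2 volume ≤ eLpNorm V 2 volume := by
  set ρ : Plane → ℝ := (bumpSeq n).normed volume with hρ
  have hρ0 : ∀ x, 0 ≤ ρ x := (bumpSeq n).nonneg_normed
  have hc : Continuous ρ := (bumpSeq n).continuous_normed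
  set s : Plane → ℝ := fun t => √(ρ t) with hs
  have hsc : Continuous s := hc.sqrt
  have hss : ∀ t, ‖s t‖ₑ ^ 2 = ‖ρ t‖ₑ := fun t => by
    rw [← enorm_pow, Real.sq_sqrt (hρ0 t)]
  have hm : AEStronglyMeasurable (fun p : Plane × Plane => s p.2 • V (p.1 - p.2))
      (volume.prod volume) :=
    AEStronglyMeasurable.convolution_integrand (ContinuousLinearMap.lsmul ℝ ℝ)
      hsc.aestronglyMeasurable hV
  have hpt : ∀ᵐ x, ‖mollify n V x‖ₑ ^ 2 ≤ ∫⁻ t, ‖s t • V (x - t)‖ₑ ^ 2 := by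
    filter_upwards [hm.prodMk_left] with x hx
    calc ‖mollify n V x‖ₑ ^ 2 ≤ (∫⁻ t, ‖s t‖ₑ * ‖s t • V (x - t)‖ₑ) ^ 2 := by
          gcongr
          rw [mollify_apply]
          refine (enorm_integral_le_lintegral_enorm _).trans (lintegral_mono fun t => ?_)
          rw [enorm_smul, enorm_smul, ← mul_assoc, ← sq, hss]
      _ ≤ (∫⁻ t, ‖s t‖ₑ ^ 2) * ∫⁻ t, ‖s t • V (x - t)‖ₑ ^ 2 :=
          sq_lintegral_mul_le _ hsc.enorm.measurable.aemeasurable hx.enorm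
      _ = ∫⁻ t, ‖s t • V (x - t)‖ₑ ^ 2 := by
          simp only [hss]
          rw [lintegral_bumpSeq, one_mul]
  have hsq : eLpNorm (mollify n V) 2 volume ^ 2 ≤ eLpNorm V 2 volume ^ 2 := by
    rw [eLpNorm_two_sq, eLpNorm_two_sq]
    calc ∫⁻ x, ‖mollify n V x‖ₑ ^ 2 ≤ ∫⁻ x, ∫⁻ t, ‖s t • V (x - t)‖ₑ ^ 2 :=
          lintegral_mono_ae hpt
      _ = ∫⁻ t, ∫⁻ x, ‖s t • V (x - t)‖ₑ ^ 2 :=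
          lintegral_lintegral_swap (hm.enorm.pow_const 2)
      _ = ∫⁻ t, ‖ρ t‖ₑ * ∫⁻ x, ‖V x‖ₑ ^ 2 := by
          refine lintegral_congr fun t => ?_
          simp only [enorm_smul, mul_pow, hss]
          rw [lintegral_const_mul' _ _ enorm_ne_top]
          congr 1
          exact lintegral_sub_right_eq_self (fun x => ‖V x‖ₑ ^ 2) t
      _ = ∫⁻ x, ‖V x‖ₑ ^ 2 := by
          rw [lintegral_mul_const _ hc.enorm.measurable, lintegral_bumpSeq, one_mul]
  exact (ENNReal.pow_le_pow_left_iff two_ne_zero).1 hsq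

variable [CompleteSpace F]

theorem mollify_eq_zero {n : ℕ} {V : Plane → F} {x : Plane}
    (h : ∀ y ∈ Metric.ball x (bumpSeq n).rOut, V y = 0) : mollify n V x = 0 := by
  have hx : V x = 0 := h x (Metric.mem_ball_self (bumpSeq n).rOut_pos)
  rw [mollify, (bumpSeq n).normed_convolution_eq_right fun y hy => by rw [h y hy, hx], hx]

theorem tendsto_mollify_of_continuous {W : Plane → F} (hW : Continuous W)
    (hc : HasCompactSupport W) :
    Tendsto (fun n => eLpNorm (fun x => mollify n W x - W x) 2 volume) atTop (𝓝 0) := by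
  obtain ⟨M, hM⟩ := hW.bounded_above_of_compact_support hc
  have hM0 : 0 ≤ M := (norm_nonneg _).trans (hM 0)
  set S := Metric.cthickening 1 (tsupport W) with hS
  have hSc : IsCompact S := hc.isCompact.cthickening
  refine tendsto_eLpNorm_two_of_dominated (b := S.indicator fun _ => 2 * M) (fun n => ?_) ?_
    (fun n => Eventually.of_forall fun x => ?_) (Eventually.of_forall fun x => ?_)
  · exact ((contDiff_mollify n hW.locallyIntegrable).continuous.sub hW).aestronglyMeasurable
  · exact memLp_indicator_const 2 hSc.isClosed.measurableSet _ (Or.inr hSc.measure_lt_top.ne)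
  · by_cases hx : x ∈ S
    · rw [indicator_of_mem hx, ← dist_eq_norm]
      refine ContDiffBump.dist_normed_convolution_le hW.aestronglyMeasurable fun y _ => ?_
      calc dist (W y) (W x) ≤ ‖W y‖ + ‖W x‖ := dist_le_norm_add_norm _ _
        _ ≤ 2 * M := by linarith [hM y, hM x]
    · have hz : ∀ y ∈ Metric.ball x (bumpSeq n).rOut, W y = 0 := by
        intro y hy
        by_contra hne
        refine hx (Metric.mem_cthickening_of_dist_le x y 1 _ (subset_tsupport W hne) ?_)
        rw [dist_comm]
        exact (Metric.mem_ball.1 hy).le.trans (bumpSeq_rOut_le_one n)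
      rw [indicator_of_notMem hx, mollify_eq_zero hz,
        hz x (Metric.mem_ball_self (bumpSeq n).rOut_pos), sub_zero, norm_zero]
  · have := ContDiffBump.convolution_tendsto_right_of_continuous (μ := volume)
      tendsto_bumpSeq_rOut hW x
    have h := this.sub_const (W x)
    rwa [sub_self] at h

theorem tendsto_mollify {V : Plane → F} (hV : MemLp V 2 volume) :
    Tendsto (fun n => eLpNorm (fun x => mollify n V x - V x) 2 volume) atTop (𝓝 0) := by
  refine ENNReal.tendsto_nhds_zero.2 fun ε hε => ?_
  have hε3 : ε / 3 ≠ 0 := by simpa using hε.ne'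
  obtain ⟨W, hWc, hVW, hW, hWL⟩ := hV.exists_hasCompactSupport_eLpNorm_sub_le ENNReal.ofNat_ne_top hε3
  have hVl := hV.locallyIntegrable (by norm_num)
  have hWl := hWL.locallyIntegrable (by norm_num)
  filter_upwards [ENNReal.tendsto_nhds_zero.1 (tendsto_mollify_of_continuous hW hWc) _
    (pos_iff_ne_zero.2 hε3)] with n hn
  have hm1 := (contDiff_mollify n (hVl.sub hWl)).continuous.aestronglyMeasurable (μ := volume)
  have hm2 := ((contDiff_mollify n hWl).continuous.sub hW).aestronglyMeasurable (μ := volume)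
  have e : (fun x => mollify n V x - V x) = mollify n (V - W) +
      ((fun x => mollify n W x - W x) + (W - V)) := by
    ext x
    have := mollify_sub n hVl hWl x
    simp only [Pi.add_apply, Pi.sub_apply]
    rw [show V - W = fun x => V x - W x from rfl, this]
    abel
  rw [e]
  refine (eLpNorm_add_le hm1 (hm2.add (hWL.1.sub hV.1)) (by norm_num)).trans ?_
  refine (add_le_add_right (eLpNorm_add_le hm2 (hWL.1.sub hV.1) (by norm_num)) _).trans ?_
  calc _ ≤ ε / 3 + (ε / 3 + ε / 3) := by
        gcongr
        · exact (eLpNorm_mollify_le n (hV.1.sub hWL.1)).trans hVW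
        · exact hn
        · rwa [eLpNorm_sub_comm W V]
    _ = ε := by rw [← add_assoc, ENNReal.add_thirds]

end

theorem gradient_mollify_eq_integral (n : ℕ) {V : Plane → ℝ} (hV : LocallyIntegrable V volume)
    (x : Plane) : gradient (mollify n V) x =
      ∫ t, V t • gradient ((bumpSeq n).normed volume) (x - t) := by
  set ρ : Plane → ℝ := (bumpSeq n).normed volume with hρ
  have hρc : ContDiff ℝ 1 ρ := (bumpSeq n).contDiff_normed
  have hs : HasCompactSupport ρ := (bumpSeq n).hasCompactSupport_normed
  have hd := hs.hasFDerivAt_convolution_left (μ := volume) (ContinuousLinearMap.lsmul ℝ ℝ) hρc hV x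
  have hex := ((hs.fderiv ℝ).convolutionExists_left (μ := volume)
    ((ContinuousLinearMap.lsmul ℝ ℝ).precompL Plane) (hρc.continuous_fderiv one_ne_zero) hV x)
  have hex' := hex.integrable_swap
  have hi : Integrable fun t => V t • gradient ρ (x - t) := by
    refine hV.integrable_smul_right_of_hasCompactSupport (g := fun t => gradient ρ (x - t))
      ((continuous_gradient hρc).comp (continuous_const.sub continuous_id)) ?_
    exact (hasCompactSupport_gradient hs).comp_homeomorph (Homeomorph.subLeft x)
  refine ext_inner_right ℝ fun u => ?_
  rw [inner_gradient_left, mollify, hd.fderiv, real_inner_comm, ← integral_inner hi,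
    convolution_eq_swap, ContinuousLinearMap.integral_apply hex']
  refine integral_congr_ae (Eventually.of_forall fun t => ?_)
  simp only [ContinuousLinearMap.precompL_apply, inner_smul_right]
  rw [real_inner_comm, inner_gradient_left]
  simp [mul_comm]

/-- At points away from the boundary, mollification commutes with the weak gradient. -/
theorem HasWeakGrad.gradient_mollify {ω : Set Plane} (hω : MeasurableSet ω) {v : Plane → ℝ}
    {g : Plane → Plane} (h : HasWeakGrad ω v g) {n : ℕ} {x : Plane}
    (hx : Metric.closedBall x (bumpSeq n).rOut ⊆ ω) :
    gradient (mollify n (ω.indicator v)) x = mollify n (ω.indicator g) x := by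
  set ρ : Plane → ℝ := (bumpSeq n).normed volume with hρ
  have hV : LocallyIntegrable (ω.indicator v) volume :=
    ((memLp_indicator_iff_restrict hω).2 h.memL2).locallyIntegrable (by norm_num)
  set φ : Plane → ℝ := fun y => ρ (x - y) with hφ
  have hρc : ContDiff ℝ (⊤ : ℕ∞) ρ := (bumpSeq n).contDiff_normed
  have hsub : tsupport φ ⊆ Metric.closedBall x (bumpSeq n).rOut := by
    refine closure_minimal (fun y hy => ?_) Metric.isClosed_closedBall
    have : x - y ∈ tsupport ρ := subset_tsupport _ hy
    rw [(bumpSeq n).tsupport_normed_eq, Metric.mem_closedBall, dist_zero_right] at this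
    rwa [Metric.mem_closedBall, dist_comm, dist_eq_norm]
  have ht : IsTestFunction ω φ :=
    ⟨hρc.comp (contDiff_const.sub contDiff_id), HasCompactSupport.of_support_subset_isCompact
      (isCompact_closedBall _ _) ((subset_tsupport _).trans hsub), hsub.trans hx⟩
  have hg : ∀ y, gradient φ y = - gradient ρ (x - y) := by
    intro y
    have hd : HasFDerivAt φ ((fderiv ℝ ρ (x - y)).comp (-ContinuousLinearMap.id ℝ Plane)) y :=
      (((hρc.differentiable (by simp)) (x - y)).hasFDerivAt).comp y
        ((hasFDerivAt_id y).const_sub x)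
    refine ext_inner_right ℝ fun u => ?_
    rw [inner_neg_left, inner_gradient_left, inner_gradient_left, hd.fderiv]
    simp
  rw [gradient_mollify_eq_integral n hV, mollify_apply']
  have e1 : ∀ t, (bumpSeq n).normed volume (x - t) • ω.indicator g t =
      ω.indicator (fun t => φ t • g t) t := fun t => by
    by_cases h : t ∈ ω <;> simp [h, hφ, hρ]
  have e2 : ∀ t, ω.indicator v t • gradient ρ (x - t) =
      - ω.indicator (fun t => v t • gradient φ t) t := fun t => by
    by_cases h : t ∈ ω <;> simp [h, hg]
  rw [integral_congr_ae (Eventually.of_forall e1), integral_congr_ae (Eventually.of_forall e2),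
    integral_neg, integral_indicator hω, integral_indicator hω, h.integral_eq φ ht, neg_neg]

/-- A function in `H¹(ω)` and its weak gradient are limits, on each set `P` with positive distance
to the complement of `ω`, of smooth functions and their gradients. -/
theorem HasWeakGrad.exists_approx {ω : Set Plane} (hω : MeasurableSet ω) {v : Plane → ℝ}
    {g : Plane → Plane} (h : HasWeakGrad ω v g) {P : Set Plane} (hP : MeasurableSet P) {r : ℝ}
    (hr : 0 < r) (hPω : ∀ x ∈ P, Metric.closedBall x r ⊆ ω) :
    ∃ φ : ℕ → Plane → ℝ, (∀ n, ContDiff ℝ (⊤ : ℕ∞) (φ n)) ∧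
      Tendsto (fun n => normL2 P (fun x => v x - φ n x)) atTop (𝓝 0) ∧
      Tendsto (fun n => normL2 P (fun x => g x - gradient (φ n) x)) atTop (𝓝 0) := by
  have hV : MemLp (ω.indicator v) 2 volume := (memLp_indicator_iff_restrict hω).2 h.memL2
  have hG : MemLp (ω.indicator g) 2 volume := (memLp_indicator_iff_restrict hω).2 h.memL2_grad
  have hPs : P ⊆ ω := fun x hx => hPω x hx (Metric.mem_closedBall_self hr.le)
  obtain ⟨N, hN⟩ := eventually_atTop.1
    ((tendsto_order.1 tendsto_bumpSeq_rOut).2 r hr)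
  refine ⟨fun n => mollify (n + N) (ω.indicator v),
    fun n => contDiff_mollify _ (hV.locallyIntegrable (by norm_num)), ?_, ?_⟩
  · refine tendsto_of_tendsto_of_tendsto_of_le_of_le tendsto_const_nhds
      ((tendsto_add_atTop_iff_nat N).2 (tendsto_mollify hV)) (fun _ => zero_le) fun n => ?_
    refine le_trans (le_of_eq ?_)
      (eLpNorm_mono_measure _ (Measure.restrict_le_self (μ := volume) (s := P)))
    rw [normL2]
    refine eLpNorm_congr_norm_ae ?_
    filter_upwards [ae_restrict_mem hP] with x hx
    rw [indicator_of_mem (hPs hx), norm_sub_rev]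
  · refine tendsto_of_tendsto_of_tendsto_of_le_of_le tendsto_const_nhds
      ((tendsto_add_atTop_iff_nat N).2 (tendsto_mollify hG)) (fun _ => zero_le) fun n => ?_
    refine le_trans (le_of_eq ?_)
      (eLpNorm_mono_measure _ (Measure.restrict_le_self (μ := volume) (s := P)))
    rw [normL2]
    refine eLpNorm_congr_norm_ae ?_
    filter_upwards [ae_restrict_mem hP] with x hx
    rw [indicator_of_mem (hPs hx), norm_sub_rev, h.gradient_mollify hω]
    exact (Metric.closedBall_subset_closedBall (hN _ (Nat.le_add_left _ _)).le).trans (hPω x hx)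

/-! ### Limits in `H¹₀` -/

theorem enorm_integral_smul_le {α F : Type*} [MeasurableSpace α] {μ : Measure α}
    [NormedAddCommGroup F] [NormedSpace ℝ F] {v : α → ℝ} {g : α → F}
    (hv : AEStronglyMeasurable v μ) (hg : AEStronglyMeasurable g μ) :
    ‖∫ x, v x • g x ∂μ‖ₑ ≤ eLpNorm v 2 μ * eLpNorm g 2 μ := by
  refine (enorm_integral_le_lintegral_enorm _).trans ?_
  rw [← eLpNorm_one_eq_lintegral_enorm]
  exact eLpNorm_smul_le_mul_eLpNorm (r := 1) hg hv

theorem enorm_integral_inner_le {α F : Type*} [MeasurableSpace α] {μ : Measure α}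
    [NormedAddCommGroup F] [InnerProductSpace ℝ F] {v g : α → F}
    (hv : AEStronglyMeasurable v μ) (hg : AEStronglyMeasurable g μ) :
    ‖∫ x, inner ℝ (v x) (g x) ∂μ‖ₑ ≤ eLpNorm v 2 μ * eLpNorm g 2 μ := by
  refine (enorm_integral_le_lintegral_enorm _).trans ?_
  rw [← eLpNorm_norm v, ← eLpNorm_norm g]
  refine le_trans ?_ (eLpNorm_smul_le_mul_eLpNorm (p := 2) (q := 2) (r := 1) hg.norm hv.norm)
  rw [eLpNorm_one_eq_lintegral_enorm]
  refine lintegral_mono fun x => ?_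
  rw [enorm_le_iff_norm_le]
  simpa [abs_mul] using norm_inner_le_norm (𝕜 := ℝ) (v x) (g x)

/-- The pairing of `L²` functions is continuous in each argument. -/
theorem tendsto_integral_smul {α F : Type*} [MeasurableSpace α] {μ : Measure α}
    [NormedAddCommGroup F] [NormedSpace ℝ F] {v : α → ℝ} {g : α → F} {vn : ℕ → α → ℝ}
    {gn : ℕ → α → F} (hv : MemLp v 2 μ) (hg : MemLp g 2 μ) (hvn : ∀ n, MemLp (vn n) 2 μ)
    (hgn : ∀ n, MemLp (gn n) 2 μ)
    (h1 : Tendsto (fun n => eLpNorm (fun x => v x - vn n x) 2 μ) atTop (𝓝 0))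
    (h2 : Tendsto (fun n => eLpNorm (fun x => g x - gn n x) 2 μ) atTop (𝓝 0))
    (h3 : (∀ n, vn n = v) ∨ ∀ n, gn n = g) :
    Tendsto (fun n => ∫ x, vn n x • gn n x ∂μ) atTop (𝓝 (∫ x, v x • g x ∂μ)) := by
  rw [tendsto_iff_edist_tendsto_0]
  rcases h3 with h3 | h3
  · have hlim : Tendsto (fun n => eLpNorm v 2 μ * eLpNorm (fun x => g x - gn n x) 2 μ) atTop
        (𝓝 0) := by
      simpa using ENNReal.Tendsto.const_mul h2 (Or.inr hv.2.ne)
    refine tendsto_of_tendsto_of_tendsto_of_le_of_le tendsto_const_nhds hlim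
      (fun _ => zero_le) fun n => ?_
    rw [edist_comm, edist_eq_enorm_sub, h3 n,
      ← integral_sub (integrable_smul_of_memLp_two hv hg) (integrable_smul_of_memLp_two hv (hgn n))]
    simp only [← smul_sub]
    exact enorm_integral_smul_le hv.1 (hg.1.sub (hgn n).1)
  · have hlim : Tendsto (fun n => eLpNorm (fun x => v x - vn n x) 2 μ * eLpNorm g 2 μ) atTop
        (𝓝 0) := by
      simpa using ENNReal.Tendsto.mul_const h1 (Or.inr hg.2.ne)
    refine tendsto_of_tendsto_of_tendsto_of_le_of_le tendsto_const_nhds hlim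
      (fun _ => zero_le) fun n => ?_
    rw [edist_comm, edist_eq_enorm_sub, h3 n,
      ← integral_sub (integrable_smul_of_memLp_two hv hg) (integrable_smul_of_memLp_two (hvn n) hg)]
    simp only [← sub_smul]
    exact enorm_integral_smul_le (hv.1.sub (hvn n).1) hg.1

/-- The weak gradient is a closed operator. -/
theorem HasWeakGrad.of_tendsto {ω : Set Plane} {w : Plane → ℝ} {g : Plane → Plane}
    {wn : ℕ → Plane → ℝ} {gn : ℕ → Plane → Plane} (h : ∀ n, HasWeakGrad ω (wn n) (gn n))
    (hw : MemL2 ω w) (hg : MemL2 ω g)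
    (h1 : Tendsto (fun n => normL2 ω (fun x => w x - wn n x)) atTop (𝓝 0))
    (h2 : Tendsto (fun n => normL2 ω (fun x => g x - gn n x)) atTop (𝓝 0)) :
    HasWeakGrad ω w g := by
  refine ⟨hw, hg, fun φ hφ => ?_⟩
  have hz : ∀ {F : Type} [NormedAddCommGroup F] (f : Plane → F), Tendsto (fun _ : ℕ =>
      eLpNorm (fun x => f x - f x) 2 (volume.restrict ω)) atTop (𝓝 0) := fun f => by simp
  have l1 := tendsto_integral_smul hw (hφ.memLp_gradient ω) (fun n => (h n).memL2)
    (fun _ => hφ.memLp_gradient ω) h1 (hz (gradient φ)) (Or.inr fun _ => rfl)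
  have l2 := tendsto_integral_smul (hφ.memLp ω) hg (fun _ => hφ.memLp ω)
    (fun n => (h n).memL2_grad) (hz φ) h2 (Or.inl fun _ => rfl)
  simp only [(h _).integral_eq φ hφ] at l1
  exact tendsto_nhds_unique l1 l2.neg

theorem normL2_sub_le {F : Type*} [NormedAddCommGroup F] {ω : Set Plane} {f g h : Plane → F}
    (hf : MemL2 ω f) (hg : MemL2 ω g) (hh : MemL2 ω h) :
    normL2 ω (fun x => f x - h x) ≤
      normL2 ω (fun x => f x - g x) + normL2 ω (fun x => g x - h x) := by
  have e : (fun x => f x - h x) = (fun x => f x - g x) + fun x => g x - h x := by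
    ext x
    simp
  rw [e]
  exact eLpNorm_add_le (hf.1.sub hg.1) (hg.1.sub hh.1) (by norm_num)

theorem normL2_congr_sub {F : Type*} [NormedAddCommGroup F] {ω : Set Plane} {f f' g : Plane → F}
    (h : f =ᵐ[volume.restrict ω] f') :
    normL2 ω (fun x => f x - g x) = normL2 ω (fun x => f' x - g x) :=
  eLpNorm_congr_ae (by filter_upwards [h] with x hx; rw [hx])

/-- `H¹₀` is closed under limits in `H¹`. -/
theorem memH10_of_tendsto {Ω : Set Plane} (hΩ : IsOpen Ω) {w : Plane → ℝ} {g : Plane → Plane}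
    {wn : ℕ → Plane → ℝ} {gn : ℕ → Plane → Plane} (h : ∀ n, HasWeakGrad Ω (wn n) (gn n))
    (h0 : ∀ n, MemH10 Ω (wn n)) (hw : MemL2 Ω w) (hg : MemL2 Ω g)
    (h1 : Tendsto (fun n => normL2 Ω (fun x => w x - wn n x)) atTop (𝓝 0))
    (h2 : Tendsto (fun n => normL2 Ω (fun x => g x - gn n x)) atTop (𝓝 0)) :
    HasWeakGrad Ω w g ∧ MemH10 Ω w := by
  have hwg := HasWeakGrad.of_tendsto h hw hg h1 h2
  refine ⟨hwg, hwg.memH1, ?_⟩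
  have hk : ∀ n : ℕ, ∃ φ, IsTestFunction Ω φ ∧ normL2 Ω (fun x => wn n x - φ x) ≤ 1 / (n + 1) ∧
      normL2 Ω (fun x => gn n x - gradient φ x) ≤ 1 / (n + 1) := by
    intro n
    obtain ⟨_, φ, hφ, l1, l2⟩ := h0 n
    have hpos : (0 : ℝ≥0∞) < 1 / (n + 1) := by simp
    obtain ⟨k, hk1, hk2⟩ := ((ENNReal.tendsto_nhds_zero.1 l1 _ hpos).and
      (ENNReal.tendsto_nhds_zero.1 l2 _ hpos)).exists
    refine ⟨φ k, hφ k, hk1, ?_⟩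
    rwa [normL2_congr_sub ((h n).weakGrad_ae_eq hΩ)] at hk2
  choose φ hφ a1 a2 using hk
  have hlim : Tendsto (fun n : ℕ => (1 : ℝ≥0∞) / (n + 1)) atTop (𝓝 0) := by
    have := (tendsto_add_atTop_iff_nat 1).2 ENNReal.tendsto_inv_nat_nhds_zero
    simpa using this
  refine ⟨φ, hφ, ?_, ?_⟩
  · have := h1.add hlim
    rw [add_zero] at this
    refine tendsto_of_tendsto_of_tendsto_of_le_of_le tendsto_const_nhds this
      (fun _ => zero_le) fun n => ?_
    exact (normL2_sub_le hw (h n).memL2 ((hφ n).memLp Ω)).trans (add_le_add_right (a1 n) _)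
  · have := h2.add hlim
    rw [add_zero] at this
    refine tendsto_of_tendsto_of_tendsto_of_le_of_le tendsto_const_nhds this
      (fun _ => zero_le) fun n => ?_
    rw [normL2_congr_sub (hwg.weakGrad_ae_eq hΩ)]
    exact (normL2_sub_le hg (h n).memL2_grad ((hφ n).memLp_gradient Ω)).trans
      (add_le_add_right (a2 n) _)

theorem gradient_sub_apply {φ ψ : Plane → ℝ} {x : Plane} (hφ : DifferentiableAt ℝ φ x)
    (hψ : DifferentiableAt ℝ ψ x) :
    gradient (fun y => φ y - ψ y) x = gradient φ x - gradient ψ x := by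
  simp only [gradient, fderiv_fun_sub hφ hψ, map_sub]

theorem gradient_mul_apply {φ ψ : Plane → ℝ} {x : Plane} (hφ : DifferentiableAt ℝ φ x)
    (hψ : DifferentiableAt ℝ ψ x) :
    gradient (fun y => φ y * ψ y) x = φ x • gradient ψ x + ψ x • gradient φ x := by
  simp only [gradient, fderiv_fun_mul hφ hψ, map_add]
  simp

theorem IsTestFunction.sub {Ω : Set Plane} {φ ψ : Plane → ℝ} (hφ : IsTestFunction Ω φ)
    (hψ : IsTestFunction Ω ψ) : IsTestFunction Ω (fun x => φ x - ψ x) :=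
  ⟨hφ.1.sub hψ.1, hφ.2.1.sub hψ.2.1, (tsupport_sub φ ψ).trans (union_subset hφ.2.2 hψ.2.2)⟩

theorem MemH10.sub {Ω : Set Plane} (hΩ : IsOpen Ω) {u v : Plane → ℝ} (hu : MemH10 Ω u)
    (hv : MemH10 Ω v) : MemH10 Ω (fun x => u x - v x) := by
  obtain ⟨hu1, φ, hφ, a1, a2⟩ := hu
  obtain ⟨hv1, ψ, hψ, b1, b2⟩ := hv
  have hw := hu1.hasWeakGrad.sub hv1.hasWeakGrad
  refine ⟨hw.memH1, fun n x => φ n x - ψ n x, fun n => (hφ n).sub (hψ n), ?_, ?_⟩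
  · have := a1.add b1
    rw [add_zero] at this
    refine tendsto_of_tendsto_of_tendsto_of_le_of_le tendsto_const_nhds this
      (fun _ => zero_le) fun n => ?_
    have e : (fun x => u x - v x - (φ n x - ψ n x)) =
        (fun x => u x - φ n x) - fun x => v x - ψ n x := by
      ext x
      simp only [Pi.sub_apply]
      ring
    rw [e]
    exact eLpNorm_sub_le (hu1.hasWeakGrad.memL2.sub ((hφ n).memLp Ω)).1
      (hv1.hasWeakGrad.memL2.sub ((hψ n).memLp Ω)).1 (by norm_num)
  · have := a2.add b2
    rw [add_zero] at this
    refine tendsto_of_tendsto_of_tendsto_of_le_of_le tendsto_const_nhds this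
      (fun _ => zero_le) fun n => ?_
    rw [normL2_congr_sub (hw.weakGrad_ae_eq hΩ)]
    have e : (fun x => weakGrad Ω u x - weakGrad Ω v x - gradient (fun x => φ n x - ψ n x) x) =
        (fun x => weakGrad Ω u x - gradient (φ n) x) -
          fun x => weakGrad Ω v x - gradient (ψ n) x := by
      ext1 x
      rw [gradient_sub_apply (((hφ n).contDiff_one.differentiable one_ne_zero) x)
        (((hψ n).contDiff_one.differentiable one_ne_zero) x)]
      simp only [Pi.sub_apply]
      abel
    rw [e]
    exact eLpNorm_sub_le (hu1.hasWeakGrad.memL2_grad.sub ((hφ n).memLp_gradient Ω)).1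
      (hv1.hasWeakGrad.memL2_grad.sub ((hψ n).memLp_gradient Ω)).1 (by norm_num)

/-- By mollification, a function in `H¹(ℝ²)` with compact support in `Ω` belongs to `H¹₀(Ω)`. -/
theorem memH10_of_tsupport_subset {Ω : Set Plane} (hΩ : IsOpen Ω) {w : Plane → ℝ}
    {g : Plane → Plane} (h : HasWeakGrad univ w g) (hc : HasCompactSupport w)
    (hs : tsupport w ⊆ Ω) : MemH10 Ω w := by
  have hΩg := h.mono (subset_univ Ω)
  refine ⟨hΩg.memH1, ?_⟩
  obtain ⟨r, hr, hrΩ⟩ := hc.isCompact.exists_cthickening_subset_open hΩ hs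
  obtain ⟨N, hN⟩ := eventually_atTop.1 ((tendsto_order.1 tendsto_bumpSeq_rOut).2 r hr)
  have hwL : MemLp w 2 volume := by simpa [MemL2] using h.memL2
  have hgL : MemLp g 2 volume := by simpa [MemL2] using h.memL2_grad
  have hgrad : ∀ n x, gradient (mollify n w) x = mollify n g x := fun n x => by
    simpa using h.gradient_mollify MeasurableSet.univ (n := n) (x := x) (subset_univ _)
  have hsub : ∀ n, tsupport (mollify (n + N) w) ⊆ Metric.cthickening r (tsupport w) := by
    intro n
    refine closure_minimal (fun x hx => ?_) Metric.isClosed_cthickening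
    by_contra hxr
    refine hx (mollify_eq_zero fun y hy => ?_)
    by_contra hne
    refine hxr (Metric.mem_cthickening_of_dist_le x y r _ (subset_tsupport w hne) ?_)
    rw [dist_comm]
    exact (Metric.mem_ball.1 hy).le.trans (hN _ (Nat.le_add_left _ _)).le
  refine ⟨fun n => mollify (n + N) w, fun n => ⟨contDiff_mollify _
    (hwL.locallyIntegrable (by norm_num)), ?_, (hsub n).trans hrΩ⟩, ?_, ?_⟩
  · exact HasCompactSupport.of_support_subset_isCompact hc.isCompact.cthickening
      ((subset_tsupport _).trans (hsub n))
  · refine tendsto_of_tendsto_of_tendsto_of_le_of_le tendsto_const_nhds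
      ((tendsto_add_atTop_iff_nat N).2 (tendsto_mollify hwL)) (fun _ => zero_le) fun n => ?_
    refine le_trans (le_of_eq ?_)
      (eLpNorm_mono_measure _ (Measure.restrict_le_self (μ := volume) (s := Ω)))
    exact eLpNorm_congr_norm_ae (Eventually.of_forall fun x => norm_sub_rev _ _)
  · refine tendsto_of_tendsto_of_tendsto_of_le_of_le tendsto_const_nhds
      ((tendsto_add_atTop_iff_nat N).2 (tendsto_mollify hgL)) (fun _ => zero_le) fun n => ?_
    rw [normL2_congr_sub (hΩg.weakGrad_ae_eq hΩ)]
    refine le_trans (le_of_eq ?_)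
      (eLpNorm_mono_measure _ (Measure.restrict_le_self (μ := volume) (s := Ω)))
    refine eLpNorm_congr_norm_ae (Eventually.of_forall fun x => ?_)
    simp only [hgrad]
    exact norm_sub_rev _ _

theorem memH10_of_lipschitz {Ω : Set Plane} (hΩ : IsOpen Ω) {C : NNReal} {w : Plane → ℝ}
    (hw : LipschitzWith C w) (hc : HasCompactSupport w) (hs : tsupport w ⊆ Ω) : MemH10 Ω w :=
  memH10_of_tsupport_subset hΩ (hasWeakGrad_of_lipschitz hw hc) hc hs

/-! ### Products with Lipschitz functions -/

theorem exists_lipschitzWith_mul {η φ : Plane → ℝ} {C D : NNReal} (hη : LipschitzWith C η)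
    (hφ : LipschitzWith D φ) {A B : NNReal} (hA : ∀ x, |η x| ≤ A) (hB : ∀ x, |φ x| ≤ B) :
    LipschitzWith (A * D + B * C) (fun x => η x * φ x) := by
  refine LipschitzWith.of_dist_le_mul fun x y => ?_
  have h1 := hη.dist_le_mul x y
  have h2 := hφ.dist_le_mul x y
  rw [Real.dist_eq] at *
  calc |η x * φ x - η y * φ y| = |η x * (φ x - φ y) + φ y * (η x - η y)| := by ring_nf
    _ ≤ |η x| * |φ x - φ y| + |φ y| * |η x - η y| := by
        rw [← abs_mul, ← abs_mul]
        exact abs_add_le _ _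
    _ ≤ A * (D * dist x y) + B * (C * dist x y) := by
        gcongr
        · exact hA x
        · exact hB y
    _ = _ := by
        push_cast
        ring

/-- A smooth function can be replaced, near a given compact set, by a test function. -/
theorem exists_testFunction_eqOn {K : Set Plane} (hK : IsCompact K) {φ : Plane → ℝ}
    (hφ : ContDiff ℝ (⊤ : ℕ∞) φ) :
    ∃ φ', IsTestFunction univ φ' ∧ ∀ x ∈ K, φ' =ᶠ[𝓝 x] φ := by
  obtain ⟨R, hR, hKR⟩ := hK.isBounded.subset_ball_lt 0 0
  let χ : ContDiffBump (0 : Plane) := ⟨R, R + 1, hR, by linarith⟩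
  refine ⟨fun x => χ x * φ x, ⟨χ.contDiff.mul hφ, χ.hasCompactSupport.mul_right,
    subset_univ _⟩, fun x hx => ?_⟩
  filter_upwards [Metric.isOpen_ball.mem_nhds (hKR hx)] with y hy
  rw [χ.one_of_mem_closedBall (Metric.ball_subset_closedBall hy), one_mul]

theorem exists_bound_of_hasCompactSupport {η : Plane → ℝ} (hη : Continuous η)
    (hc : HasCompactSupport η) : ∃ A : NNReal, ∀ x, |η x| ≤ A := by
  obtain ⟨M, hM⟩ := hη.bounded_above_of_compact_support hc
  exact ⟨⟨M, (norm_nonneg _).trans (hM 0)⟩, hM⟩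

theorem exists_lipschitzWith_mul_contDiff {η φ : Plane → ℝ} {C : NNReal} (hη : LipschitzWith C η)
    (hc : HasCompactSupport η) (hφ : ContDiff ℝ (⊤ : ℕ∞) φ) :
    ∃ D, LipschitzWith D (fun x => η x * φ x) := by
  obtain ⟨φ', h', he⟩ := exists_testFunction_eqOn hc.isCompact hφ
  have e : (fun x => η x * φ x) = fun x => η x * φ' x := by
    ext x
    by_cases hx : x ∈ tsupport η
    · rw [(he x hx).self_of_nhds]
    · rw [image_eq_zero_of_notMem_tsupport hx, zero_mul, zero_mul]
  obtain ⟨D, hD⟩ := h'.lipschitz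
  obtain ⟨A, hA⟩ := exists_bound_of_hasCompactSupport hη.continuous hc
  obtain ⟨B, hB⟩ := exists_bound_of_hasCompactSupport h'.continuous h'.2.1
  exact ⟨_, e ▸ exists_lipschitzWith_mul hη hD hA hB⟩

theorem normL2_le_of_eq_zero_off {F G : Type*} [NormedAddCommGroup F] [NormedAddCommGroup G]
    {ω K : Set Plane} (hK : MeasurableSet K) {f : Plane → F} {h : Plane → G} {c : ℝ}
    (h0 : ∀ᵐ x ∂volume.restrict ω, x ∉ K → f x = 0)
    (hle : ∀ᵐ x ∂volume.restrict K, ‖f x‖ ≤ c * ‖h x‖) :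
    normL2 ω f ≤ ENNReal.ofReal c * normL2 K h := by
  calc normL2 ω f = eLpNorm (K.indicator f) 2 (volume.restrict ω) := by
        refine eLpNorm_congr_ae ?_
        filter_upwards [h0] with x hx
        by_cases hxK : x ∈ K
        · rw [indicator_of_mem hxK]
        · rw [indicator_of_notMem hxK, hx hxK]
    _ ≤ eLpNorm (K.indicator f) 2 volume := eLpNorm_mono_measure _ Measure.restrict_le_self
    _ = eLpNorm f 2 (volume.restrict K) := eLpNorm_indicator_eq_eLpNorm_restrict hK
    _ ≤ ENNReal.ofReal c * eLpNorm h 2 (volume.restrict K) :=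
        eLpNorm_le_mul_eLpNorm_of_ae_le_mul hle 2

/-- The product of `v ∈ H¹(ω)` with a Lipschitz function `η` that has compact support in `ω` belongs
to `H¹₀`, and its gradient is given by the product rule. -/
theorem memH10_mul_of_lipschitz {Ω ω : Set Plane} (hΩ : IsOpen Ω) (hω : IsOpen ω) (hs : ω ⊆ Ω)
    {v : Plane → ℝ} {g : Plane → Plane} (h : HasWeakGrad ω v g) {η : Plane → ℝ} {C : NNReal}
    (hη : LipschitzWith C η) (hc : HasCompactSupport η) (hηω : tsupport η ⊆ ω) :
    HasWeakGrad Ω (fun x => η x * v x) (fun x => η x • g x + v x • gradient η x) ∧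
      MemH10 Ω (fun x => η x * v x) := by
  set K := tsupport η with hK
  have hKm : MeasurableSet K := (isClosed_tsupport η).measurableSet
  obtain ⟨r, hr, hrω⟩ := hc.isCompact.exists_cthickening_subset_open hω hηω
  obtain ⟨φ, hφ, l1, l2⟩ := h.exists_approx hω.measurableSet hKm hr
    fun x hx => (Metric.closedBall_subset_cthickening hx r).trans hrω
  obtain ⟨A, hA⟩ := exists_bound_of_hasCompactSupport hη.continuous hc
  have hη0 : ∀ x, x ∉ K → η x = 0 := fun x hx => image_eq_zero_of_notMem_tsupport hx
  have hg0 : ∀ x, x ∉ K → gradient η x = 0 := fun x hx => gradient_eq_zero_of_notMem hx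
  have hgC : ∀ x, ‖gradient η x‖ ≤ C := fun x => by
    rw [norm_gradient]
    exact norm_fderiv_le_of_lipschitz ℝ hη
  have hvK : MemLp v 2 (volume.restrict K) := h.memL2.mono_measure (Measure.restrict_mono hηω le_rfl)
  have hgK : MemLp g 2 (volume.restrict K) :=
    h.memL2_grad.mono_measure (Measure.restrict_mono hηω le_rfl)
  have hφd : ∀ n, Differentiable ℝ (φ n) := fun n => (hφ n).differentiable (by simp)
  have hw : ∀ n, HasWeakGrad univ (fun x => η x * φ n x)
      (fun x => η x • gradient (φ n) x + φ n x • gradient η x) := by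
    intro n
    obtain ⟨D, hD⟩ := exists_lipschitzWith_mul_contDiff hη hc (hφ n)
    refine (hasWeakGrad_of_lipschitz hD hc.mul_right).congr ae_eq_rfl ?_
    rw [Measure.restrict_univ]
    filter_upwards [hη.ae_differentiableAt (μ := volume)] with x hx
    exact gradient_mul_apply hx (hφd n x)
  have hm {F : Type} [NormedAddCommGroup F] {f : Plane → F} (h0 : ∀ x, x ∉ K → f x = 0)
      (hf : MemLp f 2 (volume.restrict K)) : MemLp f 2 (volume.restrict Ω) := by
    have e : K.indicator f = f := indicator_eq_self.2 fun x hx => by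
      by_contra hxK
      exact hx (h0 x hxK)
    have := ((memLp_indicator_iff_restrict hKm).2 hf).restrict Ω
    rwa [e] at this
  refine memH10_of_tendsto hΩ (fun n => (hw n).mono (subset_univ _))
    (fun n => memH10_of_tsupport_subset hΩ (hw n) hc.mul_right
      ((tsupport_mul_subset_left).trans (hηω.trans hs))) ?_ ?_ ?_ ?_
  · refine hm (fun x hx => by rw [hη0 x hx, zero_mul]) ?_
    exact hvK.of_le_mul (c := A) (hη.continuous.aestronglyMeasurable.mul hvK.1)
      (Eventually.of_forall fun x => by
        rw [norm_mul]
        exact mul_le_mul_of_nonneg_right (hA x) (norm_nonneg _))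
  · refine hm (fun x hx => by rw [hη0 x hx, hg0 x hx, zero_smul, smul_zero, add_zero]) ?_
    refine MemLp.add ?_ ?_
    · exact hgK.of_le_mul (c := A) (hη.continuous.aestronglyMeasurable.smul hgK.1)
        (Eventually.of_forall fun x => by
          rw [norm_smul]
          exact mul_le_mul_of_nonneg_right (hA x) (norm_nonneg _))
    · exact hvK.of_le_mul (c := C) (hvK.1.smul (measurable_gradient η).aestronglyMeasurable)
        (Eventually.of_forall fun x => by
          rw [norm_smul, mul_comm]
          exact mul_le_mul_of_nonneg_right (hgC x) (norm_nonneg _))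
  · have hlim : Tendsto (fun n => ENNReal.ofReal A * normL2 K (fun x => v x - φ n x)) atTop
        (𝓝 0) := by
      simpa using ENNReal.Tendsto.const_mul l1 (Or.inr (ENNReal.ofReal_ne_top (r := A)))
    refine tendsto_of_tendsto_of_tendsto_of_le_of_le tendsto_const_nhds hlim
      (fun _ => zero_le) fun n => ?_
    refine normL2_le_of_eq_zero_off hKm
      (Eventually.of_forall fun x hx => by rw [hη0 x hx, zero_mul, zero_mul, sub_zero])
      (Eventually.of_forall fun x => ?_)
    rw [← mul_sub, norm_mul]
    exact mul_le_mul_of_nonneg_right (hA x) (norm_nonneg _)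
  · have hlim : Tendsto (fun n => ENNReal.ofReal A * normL2 K (fun x => g x - gradient (φ n) x) +
        ENNReal.ofReal C * normL2 K (fun x => v x - φ n x)) atTop (𝓝 0) := by
      have h1 := ENNReal.Tendsto.const_mul l2 (Or.inr (ENNReal.ofReal_ne_top (r := A)))
      have h2 := ENNReal.Tendsto.const_mul l1 (Or.inr (ENNReal.ofReal_ne_top (r := C)))
      simpa using h1.add h2
    refine tendsto_of_tendsto_of_tendsto_of_le_of_le tendsto_const_nhds hlim
      (fun _ => zero_le) fun n => ?_
    have e : (fun x => η x • g x + v x • gradient η x -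
          (η x • gradient (φ n) x + φ n x • gradient η x)) =
        (fun x => η x • (g x - gradient (φ n) x)) + fun x => (v x - φ n x) • gradient η x := by
      ext1 x
      simp only [Pi.add_apply, smul_sub, sub_smul]
      abel
    have m1 : MemLp (fun x => g x - gradient (φ n) x) 2 (volume.restrict K) := by
      obtain ⟨φ', h', he⟩ := exists_testFunction_eqOn hc.isCompact (hφ n)
      refine hgK.sub ((memLp_congr_ae ?_).1 (h'.memLp_gradient K))
      filter_upwards [ae_restrict_mem hKm] with x hx
      exact (he x hx).gradient_eq
    have m2 : AEStronglyMeasurable (fun x => v x - φ n x) (volume.restrict K) :=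
      hvK.1.sub (hφ n).continuous.aestronglyMeasurable
    have z1 : ∀ x, x ∉ K → η x • (g x - gradient (φ n) x) = 0 := fun x hx => by
      rw [hη0 x hx, zero_smul]
    have z2 : ∀ x, x ∉ K → (v x - φ n x) • gradient η x = 0 := fun x hx => by
      rw [hg0 x hx, smul_zero]
    have b1 : ∀ᵐ x ∂volume.restrict K,
        ‖η x • (g x - gradient (φ n) x)‖ ≤ A * ‖g x - gradient (φ n) x‖ :=
      Eventually.of_forall fun x => by
        rw [norm_smul]
        exact mul_le_mul_of_nonneg_right (hA x) (norm_nonneg _)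
    have b2 : ∀ᵐ x ∂volume.restrict K, ‖(v x - φ n x) • gradient η x‖ ≤ C * ‖v x - φ n x‖ :=
      Eventually.of_forall fun x => by
        rw [norm_smul, mul_comm]
        exact mul_le_mul_of_nonneg_right (hgC x) (norm_nonneg _)
    have M2 : MemLp (fun x => v x - φ n x) 2 (volume.restrict K) := by
      obtain ⟨φ', h', he⟩ := exists_testFunction_eqOn hc.isCompact (hφ n)
      refine hvK.sub ((memLp_congr_ae ?_).1 (h'.memLp K))
      filter_upwards [ae_restrict_mem hKm] with x hx
      exact (he x hx).self_of_nhds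
    rw [e]
    refine (eLpNorm_add_le ?_ ?_ (by norm_num)).trans (add_le_add
      (normL2_le_of_eq_zero_off hKm (Eventually.of_forall z1) b1)
      (normL2_le_of_eq_zero_off hKm (Eventually.of_forall z2) b2))
    · exact (hm z1 (m1.of_le_mul (hη.continuous.aestronglyMeasurable.smul m1.1) b1)).1
    · exact (hm z2 (M2.of_le_mul
        (m2.smul (measurable_gradient η).aestronglyMeasurable) b2)).1

/-! ### Barycentric coordinates of a triangle -/

/-- The vertices of a nondegenerate triangle, as an affine basis of the plane. -/
noncomputable def triBasis {T : Finset Plane} (h : AffineIndependent ℝ ((↑) : T → Plane))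
    (h3 : T.card = 3) : AffineBasis T ℝ Plane :=
  ⟨(↑), h, by
    rw [h.affineSpan_eq_top_iff_card_eq_finrank_add_one]
    simp [h3]⟩

open Classical in
/-- The barycentric coordinate with respect to the vertex `y` of the triangle `T`, as an affine
function on the whole plane (`0` if `y` is not a vertex of `T`). -/
noncomputable def triCoord (T : Finset Plane) (y : Plane) : Plane →ᵃ[ℝ] ℝ :=
  if h : (AffineIndependent ℝ ((↑) : T → Plane) ∧ T.card = 3) ∧ y ∈ T then
    (triBasis h.1.1 h.1.2).coord ⟨y, h.2⟩ else 0

variable {K : Geometry.SimplicialComplex ℝ Plane} {T : Finset Plane}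

theorem triCoord_of_mem (hT : T ∈ triangles K) {y : Plane} (hy : y ∈ T) :
    triCoord T y = (triBasis (K.indep hT.1) hT.2).coord ⟨y, hy⟩ := by
  rw [triCoord, dif_pos ⟨⟨K.indep hT.1, hT.2⟩, hy⟩]

theorem triCoord_of_notMem {y : Plane} (hy : y ∉ T) : triCoord T y = 0 := by
  rw [triCoord, dif_neg fun h => hy h.2]

theorem triCoord_apply_of_notMem {y : Plane} (hy : y ∉ T) (x : Plane) : triCoord T y x = 0 := by
  rw [triCoord_of_notMem hy]
  rfl

theorem sum_triCoord (hT : T ∈ triangles K) (x : Plane) : ∑ y ∈ T, triCoord T y x = 1 := by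
  rw [← (triBasis (K.indep hT.1) hT.2).sum_coord_apply_eq_one x, ← Finset.sum_coe_sort]
  exact Finset.sum_congr rfl fun y _ => by rw [triCoord_of_mem hT y.2]

theorem sum_triCoord_smul (hT : T ∈ triangles K) (x : Plane) :
    ∑ y ∈ T, triCoord T y x • y = x := by
  conv_rhs => rw [← (triBasis (K.indep hT.1) hT.2).linear_combination_coord_eq_self x]
  rw [← Finset.sum_coe_sort]
  exact Finset.sum_congr rfl fun y _ => by rw [triCoord_of_mem hT y.2]; rfl

theorem triCoord_self (hT : T ∈ triangles K) {y : Plane} (hy : y ∈ T) : triCoord T y y = 1 := by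
  rw [triCoord_of_mem hT hy]
  exact (triBasis (K.indep hT.1) hT.2).coord_apply_eq ⟨y, hy⟩

theorem triCoord_of_ne (hT : T ∈ triangles K) {y z : Plane} (hz : z ∈ T) (h : y ≠ z) :
    triCoord T y z = 0 := by
  by_cases hy : y ∈ T
  · rw [triCoord_of_mem hT hy]
    exact (triBasis (K.indep hT.1) hT.2).coord_apply_ne (i := ⟨y, hy⟩) (j := ⟨z, hz⟩)
      (by simpa using h)
  · exact triCoord_apply_of_notMem hy z

theorem range_triBasis (hT : T ∈ triangles K) :
    range (triBasis (K.indep hT.1) hT.2) = (T : Set Plane) :=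
  Subtype.range_coe

theorem mem_convexHull_iff (hT : T ∈ triangles K) {x : Plane} :
    x ∈ convexHull ℝ (T : Set Plane) ↔ ∀ y ∈ T, 0 ≤ triCoord T y x := by
  rw [← range_triBasis hT, AffineBasis.convexHull_eq_nonneg_coord]
  simp only [mem_ofPred_eq, Subtype.forall]
  exact forall₂_congr fun y hy => by rw [triCoord_of_mem hT hy]

theorem triCoord_nonneg_of_mem (hT : T ∈ triangles K) {x : Plane}
    (hx : x ∈ convexHull ℝ (T : Set Plane)) (y : Plane) : 0 ≤ triCoord T y x := by
  by_cases hy : y ∈ T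
  · exact (mem_convexHull_iff hT).1 hx y hy
  · rw [triCoord_apply_of_notMem hy]

theorem triCoord_le_one_of_mem (hT : T ∈ triangles K) {x : Plane}
    (hx : x ∈ convexHull ℝ (T : Set Plane)) (y : Plane) : triCoord T y x ≤ 1 := by
  by_cases hy : y ∈ T
  · rw [← sum_triCoord hT x]
    exact Finset.single_le_sum (f := fun y => triCoord T y x)
      (fun z _ => triCoord_nonneg_of_mem hT hx z) hy
  · rw [triCoord_apply_of_notMem hy]
    exact zero_le_one

theorem continuous_triCoord (T : Finset Plane) (y : Plane) : Continuous (triCoord T y) :=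
  AffineMap.continuous_of_finiteDimensional _

theorem isCompact_convexHull_finset (T : Finset Plane) : IsCompact (convexHull ℝ (T : Set Plane)) :=
  T.finite_toSet.isCompact_convexHull ℝ

/-- The barycentric coordinates scale linearly along the rays from a vertex. -/
theorem triCoord_homothety (hT : T ∈ triangles K) {a y : Plane} (ha : a ∈ T) (hy : y ≠ a) (t : ℝ)
    (x : Plane) : triCoord T y (a + t • (x - a)) = t * triCoord T y x := by
  have := (triCoord T y).apply_lineMap a x t
  rw [AffineMap.lineMap_apply_module', AffineMap.lineMap_apply_module',
    triCoord_of_ne hT ha hy] at this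
  simpa [add_comm] using this

theorem one_sub_triCoord_homothety (hT : T ∈ triangles K) {a : Plane} (ha : a ∈ T) (t : ℝ)
    (x : Plane) : 1 - triCoord T a (a + t • (x - a)) = t * (1 - triCoord T a x) := by
  have := (triCoord T a).apply_lineMap a x t
  rw [AffineMap.lineMap_apply_module', AffineMap.lineMap_apply_module', triCoord_self hT ha] at this
  rw [add_comm a, this]
  simp only [smul_eq_mul]
  ring

/-! ### The hat functions -/

/-- Barycentric coordinates with respect to a simplicial complex are unique. -/
theorem IsBarycentric.unique {x : Plane} {w w' : Plane → ℝ} (h : IsBarycentric K x w)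
    (h' : IsBarycentric K x w') : w = w' := by
  classical
  have aux : ∀ {s : Finset Plane} {w w'' : Plane → ℝ}, s ∈ K.faces → ∑ y ∈ s, w y = 1 →
      ∑ y ∈ s, w y • y = x → ∑ y ∈ s, w'' y = 1 → ∑ y ∈ s, w'' y • y = x →
      ∀ y ∈ s, w y = w'' y := by
    intro s w w'' hs a1 a2 b1 b2 y hy
    have hi := affineIndependent_iff.1 (K.indep hs) Finset.univ (fun y => w y - w'' y) ?_ ?_
      ⟨y, hy⟩ (Finset.mem_univ _)
    · exact sub_eq_zero.1 hi
    · rw [Finset.sum_coe_sort s fun y => w y - w'' y, Finset.sum_sub_distrib, a1, b1, sub_self]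
    · rw [Finset.sum_coe_sort s fun y => (w y - w'' y) • y]
      simp only [sub_smul]
      rw [Finset.sum_sub_distrib, a2, b2, sub_self]
  obtain ⟨s, hs, p1, p2, p3, p4⟩ := h
  obtain ⟨s', hs', q1, q2, q3, q4⟩ := h'
  have m1 : x ∈ convexHull ℝ (s : Set Plane) := Finset.mem_convexHull'.2 ⟨w, p1, p3, p4⟩
  have m2 : x ∈ convexHull ℝ (s' : Set Plane) := Finset.mem_convexHull'.2 ⟨w', q1, q3, q4⟩
  have m3 := K.inter_subset_convexHull hs hs' ⟨m1, m2⟩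
  rw [← Finset.coe_inter, Finset.mem_convexHull'] at m3
  obtain ⟨v, _, v2, v3⟩ := m3
  set w'' : Plane → ℝ := fun y => if y ∈ s ∩ s' then v y else 0 with hw''
  have hext : ∀ t, s ∩ s' ⊆ t → ∑ y ∈ t, w'' y = 1 ∧ ∑ y ∈ t, w'' y • y = x := by
    intro t ht
    constructor
    · rw [← v2, ← Finset.sum_subset ht fun y _ hy => by rw [hw'']; exact if_neg hy]
      exact Finset.sum_congr rfl fun y hy => if_pos hy
    · rw [← v3, ← Finset.sum_subset ht fun y _ hy => by
        rw [show w'' y = 0 from if_neg hy, zero_smul]]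
      exact Finset.sum_congr rfl fun y hy => by rw [show w'' y = v y from if_pos hy]
  have e1 : w = w'' := by
    ext y
    by_cases hy : y ∈ s
    · exact aux hs p3 p4 (hext s Finset.inter_subset_left).1 (hext s Finset.inter_subset_left).2 y hy
    · rw [p2 y hy]
      exact (if_neg fun h => hy (Finset.mem_inter.1 h).1).symm
  have e2 : w' = w'' := by
    ext y
    by_cases hy : y ∈ s'
    · exact aux hs' q3 q4 (hext s' Finset.inter_subset_right).1
        (hext s' Finset.inter_subset_right).2 y hy
    · rw [q2 y hy]
      exact (if_neg fun h => hy (Finset.mem_inter.1 h).2).symm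
  rw [e1, e2]

theorem isBarycentric_triCoord (hT : T ∈ triangles K) {x : Plane}
    (hx : x ∈ convexHull ℝ (T : Set Plane)) : IsBarycentric K x fun y => triCoord T y x :=
  ⟨T, hT.1, (mem_convexHull_iff hT).1 hx, fun _ hy => triCoord_apply_of_notMem hy x,
    sum_triCoord hT x, sum_triCoord_smul hT x⟩

/-- On a triangle, the hat functions are its barycentric coordinates. -/
theorem hat_eq_triCoord (hT : T ∈ triangles K) {x : Plane}
    (hx : x ∈ convexHull ℝ (T : Set Plane)) (a : Plane) : hat K a x = triCoord T a x := by
  have h := isBarycentric_triCoord hT hx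
  rw [hat, dif_pos ⟨_, h⟩]
  exact congr_fun ((Exists.choose_spec (⟨_, h⟩ : ∃ w, IsBarycentric K x w)).unique h) a

theorem hat_of_notMem_space {x : Plane} (hx : x ∉ K.space) (a : Plane) : hat K a x = 0 := by
  rw [hat, dif_neg]
  rintro ⟨w, s, hs, h1, _, h3, h4⟩
  exact hx (Geometry.SimplicialComplex.mem_space_iff.2
    ⟨s, hs, Finset.mem_convexHull'.2 ⟨w, h1, h3, h4⟩⟩)

variable {Ω : Set Plane}

theorem IsTriangulation.finite_triangles (hK : IsTriangulation K Ω) : (triangles K).Finite :=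
  hK.finite.subset fun _ h => h.1

theorem IsTriangulation.mem_space_iff (hK : IsTriangulation K Ω) {x : Plane} :
    x ∈ K.space ↔ ∃ T ∈ triangles K, x ∈ convexHull ℝ (T : Set Plane) := by
  rw [Geometry.SimplicialComplex.mem_space_iff]
  constructor
  · rintro ⟨s, hs, hx⟩
    obtain ⟨T, hT, hsT⟩ := hK.pure s hs
    exact ⟨T, hT, convexHull_mono (by exact_mod_cast hsT) hx⟩
  · rintro ⟨T, hT, hx⟩
    exact ⟨T, hT.1, hx⟩

theorem hat_nonneg (hK : IsTriangulation K Ω) (a x : Plane) : 0 ≤ hat K a x := by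
  by_cases hx : x ∈ K.space
  · obtain ⟨T, hT, hxT⟩ := hK.mem_space_iff.1 hx
    rw [hat_eq_triCoord hT hxT]
    exact triCoord_nonneg_of_mem hT hxT a
  · rw [hat_of_notMem_space hx]

theorem hat_le_one (hK : IsTriangulation K Ω) (a x : Plane) : hat K a x ≤ 1 := by
  by_cases hx : x ∈ K.space
  · obtain ⟨T, hT, hxT⟩ := hK.mem_space_iff.1 hx
    rw [hat_eq_triCoord hT hxT]
    exact triCoord_le_one_of_mem hT hxT a
  · rw [hat_of_notMem_space hx]
    exact zero_le_one

theorem IsTriangulation.isOpen (hK : IsTriangulation K Ω) : IsOpen Ω := by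
  rw [hK.domain_eq]
  exact isOpen_interior

theorem IsTriangulation.subset_space (hK : IsTriangulation K Ω) : Ω ⊆ K.space := by
  rw [hK.domain_eq]
  exact interior_subset

theorem interior_convexHull_nonempty (hT : T ∈ triangles K) :
    (interior (convexHull ℝ (T : Set Plane))).Nonempty := by
  rw [interior_convexHull_nonempty_iff_affineSpan_eq_top, ← range_triBasis hT]
  exact (triBasis (K.indep hT.1) hT.2).tot

theorem convexHull_subset_closure_interior (hT : T ∈ triangles K) :
    convexHull ℝ (T : Set Plane) ⊆ closure (interior (convexHull ℝ (T : Set Plane))) := by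
  rw [(convex_convexHull ℝ _).closure_interior_eq_closure_of_nonempty_interior
    (interior_convexHull_nonempty hT)]
  exact subset_closure

theorem IsTriangulation.space_subset_closure (hK : IsTriangulation K Ω) : K.space ⊆ closure Ω := by
  intro x hx
  obtain ⟨T, hT, hxT⟩ := hK.mem_space_iff.1 hx
  rw [hK.domain_eq]
  exact closure_mono (interior_mono (Geometry.SimplicialComplex.convexHull_subset_space hT.1))
    (convexHull_subset_closure_interior hT hxT)

theorem IsTriangulation.finite_vertices (hK : IsTriangulation K Ω) : K.vertices.Finite :=
  Set.Finite.preimage (f := fun x : Plane => ({x} : Finset Plane))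
    (fun _ _ _ _ h => Finset.singleton_injective h) hK.finite

theorem mem_vertices_of_mem_triangle (hT : T ∈ triangles K) {a : Plane} (ha : a ∈ T) :
    a ∈ K.vertices :=
  K.down_closed hT.1 (Finset.singleton_subset_iff.2 ha) (Finset.singleton_nonempty a)

theorem IsTriangulation.exists_triangle_of_vertex (hK : IsTriangulation K Ω) {a : Plane}
    (ha : a ∈ K.vertices) : ∃ T ∈ triangles K, a ∈ T := by
  obtain ⟨T, hT, h⟩ := hK.pure {a} ha
  exact ⟨T, hT, Finset.singleton_subset_iff.1 h⟩

/-- The hat functions form a partition of unity. -/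
theorem sum_hat (hK : IsTriangulation K Ω) {x : Plane} (hx : x ∈ K.space) :
    ∑ a ∈ hK.finite_vertices.toFinset, hat K a x = 1 := by
  obtain ⟨T, hT, hxT⟩ := hK.mem_space_iff.1 hx
  rw [← sum_triCoord hT x]
  simp only [hat_eq_triCoord hT hxT]
  refine (Finset.sum_subset (fun y hy => ?_) fun y _ hy => triCoord_apply_of_notMem hy x).symm
  rw [Set.Finite.mem_toFinset]
  exact mem_vertices_of_mem_triangle hT hy

/-- Two triangles of a complex meet in a null set. -/
theorem volume_convexHull_inter {T' : Finset Plane} (hT : T ∈ triangles K) (hT' : T' ∈ triangles K)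
    (hne : T ≠ T') :
    volume (convexHull ℝ (T : Set Plane) ∩ convexHull ℝ (T' : Set Plane)) = 0 := by
  classical
  refine measure_mono_null (K.inter_subset_convexHull hT.1 hT'.1) ?_
  rw [← Finset.coe_inter]
  refine measure_mono_null (convexHull_subset_affineSpan _)
    (Measure.addHaar_affineSubspace _ _ fun htop => ?_)
  have hcard : (T ∩ T').card ≤ 2 := by
    by_contra! h
    have h1 : T ∩ T' = T := Finset.eq_of_subset_of_card_le Finset.inter_subset_left (by
      rw [hT.2]; exact h)
    have h2 : T ∩ T' = T' := Finset.eq_of_subset_of_card_le Finset.inter_subset_right (by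
      rw [hT'.2]; exact h)
    exact hne (h1.symm.trans h2)
  have hr : Module.finrank ℝ (vectorSpan ℝ ((T ∩ T' : Finset Plane) : Set Plane)) + 1 ≤ 2 := by
    rcases (T ∩ T').eq_empty_or_nonempty with h0 | h0
    · rw [h0] at htop
      simp only [Finset.coe_empty, AffineSubspace.span_empty] at htop
      exact absurd htop (AffineSubspace.bot_ne_top ℝ Plane Plane)
    · obtain ⟨m, hm⟩ : ∃ m, (T ∩ T').card = m + 1 :=
        ⟨(T ∩ T').card - 1, by have := h0.card_pos; omega⟩
      have := finrank_vectorSpan_image_finset_le ℝ (id : Plane → Plane) (T ∩ T') hm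
      rw [Finset.image_id] at this
      omega
  rw [← direction_affineSpan, htop, AffineSubspace.direction_top, finrank_top] at hr
  simp at hr

/-! ### The star of a vertex as part of a cone -/

/-- The triangles that share the vertex `a`. -/
def starTriangles (K : Geometry.SimplicialComplex ℝ Plane) (a : Plane) : Set (Finset Plane) :=
  {T | T ∈ triangles K ∧ a ∈ T}

/-- The union of the triangles that share the vertex `a`; its interior is the star domain. -/
def closedStar (K : Geometry.SimplicialComplex ℝ Plane) (a : Plane) : Set Plane :=
  ⋃ T ∈ starTriangles K a, convexHull ℝ (T : Set Plane)

/-- The cone with apex `a` that is spanned by the triangle `T`. -/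
def triCone (T : Finset Plane) (a : Plane) : Set Plane :=
  {x | ∀ y ∈ T, y ≠ a → 0 ≤ triCoord T y x}

/-- The union of the cones with apex `a` that are spanned by the triangles that share `a`. -/
def starCone (K : Geometry.SimplicialComplex ℝ Plane) (a : Plane) : Set Plane :=
  ⋃ T ∈ starTriangles K a, triCone T a

open Classical in
/-- The gauge of the star of `a`, with respect to `a`: the function on the star cone which is
positively homogeneous with respect to `a` and equals `1 - ψ_a` on the star (and `0` off the
cone). -/
noncomputable def level (K : Geometry.SimplicialComplex ℝ Plane) (a x : Plane) : ℝ :=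
  if h : ∃ T ∈ starTriangles K a, x ∈ triCone T a then 1 - triCoord h.choose a x else 0

theorem starDomain_eq (a : Plane) : starDomain K a = interior (closedStar K a) := rfl

theorem isOpen_starDomain (a : Plane) : IsOpen (starDomain K a) := isOpen_interior

theorem mem_closedStar {a x : Plane} :
    x ∈ closedStar K a ↔ ∃ T ∈ starTriangles K a, x ∈ convexHull ℝ (T : Set Plane) := by
  simp [closedStar]

theorem mem_starCone {a x : Plane} :
    x ∈ starCone K a ↔ ∃ T ∈ starTriangles K a, x ∈ triCone T a := by
  simp [starCone]

theorem isClosed_triCone (T : Finset Plane) (a : Plane) : IsClosed (triCone T a) := by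
  simp only [triCone, ofPred_forall]
  exact isClosed_iInter fun y => isClosed_iInter fun _ => isClosed_iInter fun _ =>
    isClosed_le continuous_const (continuous_triCoord T y)

theorem mem_triCone_of_mem {a x : Plane} (hT : T ∈ triangles K)
    (hx : x ∈ convexHull ℝ (T : Set Plane)) : x ∈ triCone T a :=
  fun y _ _ => triCoord_nonneg_of_mem hT hx y

theorem mem_convexHull_iff_of_mem_triCone {a x : Plane} (hT : T ∈ starTriangles K a)
    (hx : x ∈ triCone T a) : x ∈ convexHull ℝ (T : Set Plane) ↔ 0 ≤ triCoord T a x := by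
  rw [mem_convexHull_iff hT.1]
  refine ⟨fun h => h a hT.2, fun h y hy => ?_⟩
  by_cases hya : y = a
  · rwa [hya]
  · exact hx y hy hya

theorem homothety_mem_triCone {a x : Plane} (hT : T ∈ starTriangles K a) (hx : x ∈ triCone T a)
    {t : ℝ} (ht : 0 ≤ t) : a + t • (x - a) ∈ triCone T a := fun y hy hya => by
  rw [triCoord_homothety hT.1 hT.2 hya]
  exact mul_nonneg ht (hx y hy hya)

theorem one_sub_triCoord_eq_sum {a : Plane} (hT : T ∈ starTriangles K a) (x : Plane) :
    1 - triCoord T a x = ∑ y ∈ T.erase a, triCoord T y x := by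
  rw [← sum_triCoord hT.1 x, ← Finset.add_sum_erase T _ hT.2, add_sub_cancel_left]

theorem one_sub_triCoord_nonneg {a x : Plane} (hT : T ∈ starTriangles K a) (hx : x ∈ triCone T a) :
    0 ≤ 1 - triCoord T a x := by
  rw [one_sub_triCoord_eq_sum hT]
  exact Finset.sum_nonneg fun y hy => hx y (Finset.mem_of_mem_erase hy) (Finset.ne_of_mem_erase hy)

theorem eq_of_one_sub_triCoord_eq_zero {a x : Plane} (hT : T ∈ starTriangles K a)
    (hx : x ∈ triCone T a) (h : 1 - triCoord T a x = 0) : x = a := by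
  have h0 : ∀ y ∈ T.erase a, triCoord T y x = 0 := by
    rw [one_sub_triCoord_eq_sum hT] at h
    exact (Finset.sum_eq_zero_iff_of_nonneg fun y hy =>
      hx y (Finset.mem_of_mem_erase hy) (Finset.ne_of_mem_erase hy)).1 h
  rw [← sum_triCoord_smul hT.1 x, ← Finset.add_sum_erase T _ hT.2,
    Finset.sum_eq_zero fun y hy => by rw [h0 y hy, zero_smul], ← sub_eq_zero.1 h, one_smul, add_zero]

theorem homothety_mem_convexHull {a x : Plane} (hT : T ∈ starTriangles K a) (hx : x ∈ triCone T a)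
    {t : ℝ} (ht : 0 ≤ t) (ht1 : t * (1 - triCoord T a x) ≤ 1) :
    a + t • (x - a) ∈ convexHull ℝ (T : Set Plane) := by
  rw [mem_convexHull_iff_of_mem_triCone hT (homothety_mem_triCone hT hx ht)]
  have := one_sub_triCoord_homothety hT.1 hT.2 t x
  linarith

/-- The level is well defined: near `a` it is `1 - ψ_a`. -/
theorem level_eq {a x : Plane} (hT : T ∈ starTriangles K a) (hx : x ∈ triCone T a) :
    level K a x = 1 - triCoord T a x := by
  have h : ∃ T ∈ starTriangles K a, x ∈ triCone T a := ⟨T, hT, hx⟩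
  rw [level, dif_pos h]
  obtain ⟨hT', hx'⟩ := h.choose_spec
  set T' := h.choose
  have s1 := one_sub_triCoord_nonneg hT hx
  have s2 := one_sub_triCoord_nonneg hT' hx'
  set t : ℝ := (1 + (1 - triCoord T a x) + (1 - triCoord T' a x))⁻¹ with ht
  have htpos : 0 < t := by positivity
  have b1 : t * (1 - triCoord T a x) ≤ 1 := by
    rw [ht, inv_mul_le_one₀ (by positivity)]
    linarith
  have b2 : t * (1 - triCoord T' a x) ≤ 1 := by
    rw [ht, inv_mul_le_one₀ (by positivity)]
    linarith
  have e1 := hat_eq_triCoord hT.1 (homothety_mem_convexHull hT hx htpos.le b1) a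
  have e2 := hat_eq_triCoord hT'.1 (homothety_mem_convexHull hT' hx' htpos.le b2) a
  have e3 := one_sub_triCoord_homothety hT.1 hT.2 t x
  have e4 := one_sub_triCoord_homothety hT'.1 hT'.2 t x
  rw [← e1] at e3
  rw [← e2] at e4
  exact mul_left_cancel₀ htpos.ne' (e4.symm.trans e3)

theorem level_nonneg {a x : Plane} : 0 ≤ level K a x := by
  by_cases h : ∃ T ∈ starTriangles K a, x ∈ triCone T a
  · obtain ⟨T, hT, hx⟩ := h
    rw [level_eq hT hx]
    exact one_sub_triCoord_nonneg hT hx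
  · rw [level, dif_neg h]

theorem level_pos {a x : Plane} (hx : x ∈ starCone K a) (hne : x ≠ a) : 0 < level K a x := by
  obtain ⟨T, hT, hx⟩ := mem_starCone.1 hx
  refine lt_of_le_of_ne level_nonneg fun h => hne ?_
  rw [level_eq hT hx] at h
  exact eq_of_one_sub_triCoord_eq_zero hT hx h.symm

theorem homothety_mem_starCone {a x : Plane} (hx : x ∈ starCone K a) {t : ℝ} (ht : 0 ≤ t) :
    a + t • (x - a) ∈ starCone K a := by
  obtain ⟨T, hT, hx⟩ := mem_starCone.1 hx
  exact mem_starCone.2 ⟨T, hT, homothety_mem_triCone hT hx ht⟩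

theorem level_homothety {a x : Plane} (hx : x ∈ starCone K a) {t : ℝ} (ht : 0 ≤ t) :
    level K a (a + t • (x - a)) = t * level K a x := by
  obtain ⟨T, hT, hx⟩ := mem_starCone.1 hx
  rw [level_eq hT (homothety_mem_triCone hT hx ht), level_eq hT hx,
    one_sub_triCoord_homothety hT.1 hT.2]

theorem closedStar_subset_starCone {a : Plane} : closedStar K a ⊆ starCone K a := fun x hx => by
  obtain ⟨T, hT, hx⟩ := mem_closedStar.1 hx
  exact mem_starCone.2 ⟨T, hT, mem_triCone_of_mem hT.1 hx⟩

theorem mem_closedStar_iff_level {a x : Plane} (hx : x ∈ starCone K a) :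
    x ∈ closedStar K a ↔ level K a x ≤ 1 := by
  constructor
  · intro h
    obtain ⟨T, hT, hx⟩ := mem_closedStar.1 h
    rw [level_eq hT (mem_triCone_of_mem hT.1 hx)]
    linarith [triCoord_nonneg_of_mem hT.1 hx a]
  · intro h
    obtain ⟨T, hT, hx⟩ := mem_starCone.1 hx
    rw [level_eq hT hx] at h
    exact mem_closedStar.2 ⟨T, hT, (mem_convexHull_iff_of_mem_triCone hT hx).2 (by linarith)⟩

theorem hat_of_mem_closedStar {a x : Plane} (hx : x ∈ closedStar K a) :
    hat K a x = 1 - level K a x := by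
  obtain ⟨T, hT, hx⟩ := mem_closedStar.1 hx
  rw [level_eq hT (mem_triCone_of_mem hT.1 hx), hat_eq_triCoord hT.1 hx]
  ring

theorem hat_of_notMem_closedStar (hK : IsTriangulation K Ω) {a x : Plane}
    (hx : x ∉ closedStar K a) : hat K a x = 0 := by
  by_cases h : x ∈ K.space
  · obtain ⟨T, hT, hxT⟩ := hK.mem_space_iff.1 h
    rw [hat_eq_triCoord hT hxT]
    exact triCoord_apply_of_notMem (fun ha => hx (mem_closedStar.2 ⟨T, ⟨hT, ha⟩, hxT⟩)) x
  · exact hat_of_notMem_space h a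

theorem closedStar_subset_space {a : Plane} : closedStar K a ⊆ K.space := fun x hx => by
  obtain ⟨T, hT, hx⟩ := mem_closedStar.1 hx
  exact Geometry.SimplicialComplex.convexHull_subset_space hT.1.1 hx

theorem starDomain_subset (hK : IsTriangulation K Ω) (a : Plane) : starDomain K a ⊆ Ω := by
  rw [hK.domain_eq]
  exact interior_mono closedStar_subset_space

theorem IsTriangulation.finite_starTriangles (hK : IsTriangulation K Ω) (a : Plane) :
    (starTriangles K a).Finite :=
  hK.finite_triangles.subset fun _ h => h.1

theorem IsTriangulation.isCompact_closedStar (hK : IsTriangulation K Ω) (a : Plane) :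
    IsCompact (closedStar K a) :=
  (hK.finite_starTriangles a).isCompact_biUnion fun s _ => isCompact_convexHull_finset s

theorem IsTriangulation.isClosed_starCone (hK : IsTriangulation K Ω) (a : Plane) :
    IsClosed (starCone K a) :=
  (hK.finite_starTriangles a).isClosed_biUnion fun s _ => isClosed_triCone s a

theorem closedStar_subset_closure (a : Plane) : closedStar K a ⊆ closure (starDomain K a) := by
  intro x hx
  obtain ⟨T, hT, hxT⟩ := mem_closedStar.1 hx
  exact closure_mono (interior_mono fun y hy => mem_closedStar.2 ⟨T, hT, hy⟩)
    (convexHull_subset_closure_interior hT.1 hxT)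

theorem volume_starDomain_ne_top (hK : IsTriangulation K Ω) (a : Plane) :
    volume (starDomain K a) ≠ ⊤ :=
  measure_ne_top_of_subset interior_subset (hK.isCompact_closedStar a).measure_lt_top.ne

theorem volume_closedStar_diff (hK : IsTriangulation K Ω) (a : Plane) :
    volume (closedStar K a \ starDomain K a) = 0 := by
  have hnull : volume (⋃ T ∈ starTriangles K a, frontier (convexHull ℝ (T : Set Plane))) = 0 :=
    (measure_biUnion_null_iff (hK.finite_starTriangles a).countable).2 fun T _ =>
      (convex_convexHull ℝ _).addHaar_frontier volume
  refine measure_mono_null (fun x hx => ?_) hnull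
  obtain ⟨T, hT, hxT⟩ := mem_closedStar.1 hx.1
  refine mem_biUnion hT ⟨subset_closure hxT, fun hi => hx.2 ?_⟩
  exact interior_mono (fun y hy => mem_closedStar.2 ⟨T, hT, hy⟩) hi

/-- Points near `x` can lie only in those sets of a finite closed family that contain `x`. -/
theorem eventually_mem_of_finite_closed {ι X : Type*} [TopologicalSpace X] {I : Set ι}
    (hI : I.Finite) {A : ι → Set X} (hA : ∀ i ∈ I, IsClosed (A i)) (x : X) :
    ∀ᶠ y in 𝓝 x, ∀ i ∈ I, y ∈ A i → x ∈ A i := by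
  refine (Filter.eventually_all_finite hI).2 fun i hi => ?_
  by_cases hx : x ∈ A i
  · exact Eventually.of_forall fun _ _ => hx
  · filter_upwards [(hA i hi).isOpen_compl.mem_nhds hx] with y hy h
    exact absurd h hy

theorem eventually_starCone (hK : IsTriangulation K Ω) (a x : Plane) :
    ∀ᶠ y in 𝓝 x, y ∈ starCone K a → ∃ T ∈ starTriangles K a, y ∈ triCone T a ∧ x ∈ triCone T a := by
  filter_upwards [eventually_mem_of_finite_closed (hK.finite_starTriangles a)
    (fun T _ => isClosed_triCone T a) x] with y hy h
  obtain ⟨T, hT, hyT⟩ := mem_starCone.1 h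
  exact ⟨T, hT, hyT, hy T hT hyT⟩

theorem eventually_space (hK : IsTriangulation K Ω) (x : Plane) :
    ∀ᶠ y in 𝓝 x, y ∈ K.space → ∃ T ∈ triangles K,
      y ∈ convexHull ℝ (T : Set Plane) ∧ x ∈ convexHull ℝ (T : Set Plane) := by
  filter_upwards [eventually_mem_of_finite_closed hK.finite_triangles
    (fun T _ => (isCompact_convexHull_finset T).isClosed) x] with y hy h
  obtain ⟨T, hT, hyT⟩ := hK.mem_space_iff.1 h
  exact ⟨T, hT, hyT, hy T hT hyT⟩

/-- Where `ψ_a` is positive, the triangulation is locally the star of `a`. -/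
theorem eventually_mem_closedStar_of_space (hK : IsTriangulation K Ω) {a x : Plane}
    (hx : hat K a x ≠ 0) : ∀ᶠ y in 𝓝 x, y ∈ K.space → y ∈ closedStar K a := by
  filter_upwards [eventually_space hK x] with y hy h
  obtain ⟨T, hT, hyT, hxT⟩ := hy h
  refine mem_closedStar.2 ⟨T, ⟨hT, ?_⟩, hyT⟩
  by_contra ha
  rw [hat_eq_triCoord hT hxT, triCoord_apply_of_notMem ha] at hx
  exact hx rfl

/-- The barycentric coordinates are uniformly Lipschitz. -/
theorem exists_lipschitz_triCoord (hK : IsTriangulation K Ω) (a : Plane) :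
    ∃ L : ℝ, 0 ≤ L ∧ ∀ T ∈ triangles K, ∀ x y,
      |triCoord T a y - triCoord T a x| ≤ L * ‖y - x‖ := by
  have h : ∀ T : Finset Plane, ∃ L : ℝ, 0 ≤ L ∧ ∀ x y,
      |triCoord T a y - triCoord T a x| ≤ L * ‖y - x‖ := by
    intro T
    refine ⟨‖(triCoord T a).linear.toContinuousLinearMap‖, norm_nonneg _, fun x y => ?_⟩
    have := ((triCoord T a).linear.toContinuousLinearMap).le_opNorm (y - x)
    have e := (triCoord T a).linearMap_vsub y x
    simp only [vsub_eq_sub] at e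
    rw [← e]
    exact this
  choose L hL0 hL using h
  refine ⟨∑ T ∈ hK.finite_triangles.toFinset, L T, Finset.sum_nonneg fun T _ => hL0 T,
    fun T hT x y => (hL T x y).trans ?_⟩
  gcongr
  exact Finset.single_le_sum (fun T _ => hL0 T) (hK.finite_triangles.mem_toFinset.2 hT)

theorem continuousOn_level (hK : IsTriangulation K Ω) (a : Plane) :
    ContinuousOn (level K a) (starCone K a) := by
  intro x _
  obtain ⟨L, hL0, hL⟩ := exists_lipschitz_triCoord hK a
  rw [ContinuousWithinAt, tendsto_iff_dist_tendsto_zero]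
  have hlim : Tendsto (fun y => L * ‖y - x‖) (𝓝[starCone K a] x) (𝓝 0) := by
    have : Continuous fun y : Plane => L * ‖y - x‖ := by fun_prop
    simpa using (this.tendsto x).mono_left nhdsWithin_le_nhds
  refine squeeze_zero' (Eventually.of_forall fun _ => dist_nonneg) ?_ hlim
  filter_upwards [mem_nhdsWithin_of_mem_nhds (eventually_starCone hK a x), self_mem_nhdsWithin]
    with y hy hyC
  obtain ⟨T, hT, h1, h2⟩ := hy hyC
  rw [Real.dist_eq, level_eq hT h1, level_eq hT h2]
  rw [show 1 - triCoord T a y - (1 - triCoord T a x) = -(triCoord T a y - triCoord T a x) by ring,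
    abs_neg]
  exact hL T hT.1 x y

/-! ### Interior and boundary vertices -/

theorem mem_closedStar_self (hK : IsTriangulation K Ω) {a : Plane} (ha : a ∈ K.vertices) :
    a ∈ closedStar K a := by
  obtain ⟨T, hT, haT⟩ := hK.exists_triangle_of_vertex ha
  exact mem_closedStar.2 ⟨T, ⟨hT, haT⟩, subset_convexHull ℝ _ haT⟩

theorem hat_self (hK : IsTriangulation K Ω) {a : Plane} (ha : a ∈ K.vertices) : hat K a a = 1 := by
  obtain ⟨T, hT, haT⟩ := hK.exists_triangle_of_vertex ha
  rw [hat_eq_triCoord hT (subset_convexHull ℝ _ haT), triCoord_self hT haT]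

theorem level_self (hK : IsTriangulation K Ω) {a : Plane} (ha : a ∈ K.vertices) :
    level K a a = 0 := by
  have := hat_of_mem_closedStar (mem_closedStar_self hK ha)
  rw [hat_self hK ha] at this
  linarith

theorem mem_or_mem_frontier (hK : IsTriangulation K Ω) {a : Plane} (ha : a ∈ K.vertices) :
    a ∈ Ω ∨ a ∈ frontier Ω := by
  by_cases h : a ∈ Ω
  · exact Or.inl h
  · refine Or.inr ⟨hK.space_subset_closure (closedStar_subset_space (mem_closedStar_self hK ha)), ?_⟩
    rwa [hK.isOpen.interior_eq]

theorem exists_homothety_mem {a : Plane} {s : Set Plane} (hs : s ∈ 𝓝 a) (x : Plane) :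
    ∃ t : ℝ, 0 < t ∧ a + t • (x - a) ∈ s := by
  have hc : Tendsto (fun t : ℝ => a + t • (x - a)) (𝓝[>] 0) (𝓝 a) := by
    have : Continuous fun t : ℝ => a + t • (x - a) := by fun_prop
    simpa using (this.tendsto 0).mono_left nhdsWithin_le_nhds
  obtain ⟨t, h1, h2⟩ := ((hc.eventually hs).and self_mem_nhdsWithin).exists
  exact ⟨t, h2, h1⟩

theorem starCone_eq_univ_iff (hK : IsTriangulation K Ω) {a : Plane} (ha : a ∈ K.vertices) :
    starCone K a = univ ↔ a ∈ Ω := by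
  constructor
  · intro h
    have hc : Continuous (level K a) := by
      have := continuousOn_level hK a
      rwa [h, continuousOn_univ] at this
    rw [hK.domain_eq, mem_interior_iff_mem_nhds]
    have : {x | level K a x < 1} ∈ 𝓝 a :=
      (isOpen_lt hc continuous_const).mem_nhds (by simp [level_self hK ha])
    filter_upwards [this] with x hx
    exact closedStar_subset_space ((mem_closedStar_iff_level (h ▸ mem_univ x)).2 hx.le)
  · intro h
    rw [hK.domain_eq, mem_interior_iff_mem_nhds] at h
    have h1 := eventually_mem_closedStar_of_space hK (a := a) (x := a)
      (by rw [hat_self hK ha]; exact one_ne_zero)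
    refine eq_univ_of_forall fun x => ?_
    have h2 : ∀ᶠ y in 𝓝 a, y ∈ closedStar K a := by
      filter_upwards [h1, h] with y hy hy' using hy hy'
    obtain ⟨t, ht, hxt⟩ := exists_homothety_mem h2 x
    have := homothety_mem_starCone (closedStar_subset_starCone hxt) (inv_nonneg.2 ht.le)
    simpa [smul_smul, inv_mul_cancel₀ ht.ne'] using this

theorem hat_eq_max (hK : IsTriangulation K Ω) {a : Plane} (h : starCone K a = univ) (x : Plane) :
    hat K a x = max (1 - level K a x) 0 := by
  have hx : x ∈ starCone K a := h ▸ mem_univ x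
  by_cases hxs : x ∈ closedStar K a
  · rw [hat_of_mem_closedStar hxs, max_eq_left]
    linarith [(mem_closedStar_iff_level hx).1 hxs]
  · rw [hat_of_notMem_closedStar hK hxs, max_eq_right]
    rw [mem_closedStar_iff_level hx] at hxs
    linarith

theorem continuous_level (hK : IsTriangulation K Ω) {a : Plane} (h : starCone K a = univ) :
    Continuous (level K a) := by
  have := continuousOn_level hK a
  rwa [h, continuousOn_univ] at this

theorem starDomain_eq_level (hK : IsTriangulation K Ω) {a : Plane} (h : starCone K a = univ) :
    starDomain K a = {x | level K a x < 1} := by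
  have hc := continuous_level hK h
  have hmem : ∀ x, x ∈ starCone K a := fun x => h ▸ mem_univ x
  apply Subset.antisymm
  · intro x hx
    rw [starDomain_eq, mem_interior_iff_mem_nhds] at hx
    have hlim : Tendsto (fun t : ℝ => a + t • (x - a)) (𝓝[>] 1) (𝓝 x) := by
      have : Continuous fun t : ℝ => a + t • (x - a) := by fun_prop
      simpa using (this.tendsto 1).mono_left nhdsWithin_le_nhds
    obtain ⟨t, h1, h2⟩ := ((hlim.eventually hx).and self_mem_nhdsWithin).exists
    have h3 := (mem_closedStar_iff_level (hmem _)).1 h1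
    have ht : (1 : ℝ) < t := h2
    rw [level_homothety (hmem x) (by linarith)] at h3
    rcases (level_nonneg (K := K) (a := a) (x := x)).eq_or_lt with h0 | h0
    · simp [← h0]
    · show level K a x < 1
      nlinarith
  · refine interior_maximal (fun x hx => ?_) (isOpen_lt hc continuous_const)
    exact (mem_closedStar_iff_level (hmem x)).2 (le_of_lt hx)

/-- At a boundary vertex `a`, the points of the star where the cone ends belong to the part of the
boundary of the star on which the functions in `H¹_*` vanish. -/
theorem mem_frontier_of_mem_closure_compl (hK : IsTriangulation K Ω) {a x : Plane}
    (hx : x ∈ closedStar K a) (hx1 : level K a x < 1) (hxc : x ∈ closure (starCone K a)ᶜ) :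
    x ∈ frontier (starDomain K a) ∩ frontier Ω := by
  have hhat : hat K a x ≠ 0 := by
    rw [hat_of_mem_closedStar hx]
    linarith
  have h1 : x ∉ Ω := by
    intro hΩ
    rw [hK.domain_eq, mem_interior_iff_mem_nhds] at hΩ
    obtain ⟨y, hy1, hy2, hy3⟩ := ((mem_closure_iff_frequently.1 hxc).and_eventually
      ((eventually_mem_closedStar_of_space hK hhat).and hΩ)).exists
    exact hy1 (closedStar_subset_starCone (hy2 hy3))
  refine ⟨⟨closedStar_subset_closure a hx, ?_⟩,
    ⟨hK.space_subset_closure (closedStar_subset_space hx), ?_⟩⟩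
  · rw [(isOpen_starDomain a).interior_eq]
    exact fun h => h1 (starDomain_subset hK a h)
  · rwa [hK.isOpen.interior_eq]

/-! ### Shape regularity -/

variable {κ : ℝ}

theorem abs_triCoord_sub_le (hT : T ∈ triangles K) {c : Plane} {ρ : ℝ} (hρ : 0 < ρ)
    (hc : Metric.closedBall c ρ ⊆ convexHull ℝ (T : Set Plane)) (a x y : Plane) :
    |triCoord T a y - triCoord T a x| * (2 * ρ) ≤ ‖y - x‖ := by
  rcases eq_or_ne y x with rfl | hne
  · simp
  have hd : 0 < ‖y - x‖ := norm_pos_iff.2 (sub_ne_zero.2 hne)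
  set u : Plane := (ρ / ‖y - x‖) • (y - x) with hu
  have hun : ‖u‖ = ρ := by
    rw [hu, norm_smul, Real.norm_of_nonneg (by positivity), div_mul_cancel₀ _ hd.ne']
  have m1 : c + u ∈ convexHull ℝ (T : Set Plane) := hc (by simp [hun])
  have m2 : c - u ∈ convexHull ℝ (T : Set Plane) := hc (by simp [hun])
  set f := (triCoord T a).linear with hf
  have e1 : triCoord T a y - triCoord T a x = f (y - x) := by
    have := (triCoord T a).linearMap_vsub y x
    simpa using this.symm
  have e2 : triCoord T a (c + u) - triCoord T a (c - u) = 2 * f u := by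
    have := (triCoord T a).linearMap_vsub (c + u) (c - u)
    simp only [vsub_eq_sub] at this
    rw [← this, show c + u - (c - u) = (2 : ℝ) • u by rw [two_smul]; abel, map_smul, smul_eq_mul]
  have e3 : f u = ρ / ‖y - x‖ * f (y - x) := by rw [hu, map_smul, smul_eq_mul]
  have h2 : |2 * f u| ≤ 1 := by
    rw [← e2, abs_le]
    constructor <;> linarith [triCoord_nonneg_of_mem hT m1 a, triCoord_nonneg_of_mem hT m2 a,
      triCoord_le_one_of_mem hT m1 a, triCoord_le_one_of_mem hT m2 a]
  rw [e3, abs_mul, abs_mul, abs_of_pos (show (0 : ℝ) < 2 by norm_num),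
    abs_of_pos (div_pos hρ hd)] at h2
  rw [e1]
  have h3 : 2 * (ρ / ‖y - x‖ * |f (y - x)|) = |f (y - x)| * (2 * ρ) / ‖y - x‖ := by ring
  rwa [h3, div_le_one hd] at h2

theorem norm_sub_le_of_mem_triCone {a x : Plane} (hT : T ∈ starTriangles K a)
    (hx : x ∈ triCone T a) :
    ‖x - a‖ ≤ Metric.diam (convexHull ℝ (T : Set Plane)) * (1 - triCoord T a x) := by
  rcases (one_sub_triCoord_nonneg hT hx).eq_or_lt with h0 | h0
  · rw [← h0, eq_of_one_sub_triCoord_eq_zero hT hx h0.symm]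
    simp
  · set s := 1 - triCoord T a x with hs
    have hm := homothety_mem_convexHull hT hx (inv_nonneg.2 h0.le) (by rw [inv_mul_cancel₀ h0.ne'])
    have hd := Metric.dist_le_diam_of_mem (isCompact_convexHull_finset T).isBounded hm
      (subset_convexHull ℝ _ hT.2)
    rw [dist_eq_norm, add_sub_cancel_left, norm_smul, Real.norm_of_nonneg (inv_nonneg.2 h0.le),
      inv_mul_le_iff₀ h0] at hd
    linarith

/-- The scale invariant form of shape regularity: on each cone, the gradient of the level is bounded
by `κ / 2` times the quotient of the level and the distance to the vertex. -/
theorem abs_triCoord_sub_mul_le (hκ : IsShapeRegular K κ) {a x : Plane}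
    (hT : T ∈ starTriangles K a) (hx : x ∈ triCone T a) (y z : Plane) :
    |triCoord T a y - triCoord T a z| * ‖x - a‖ ≤ κ / 2 * (1 - triCoord T a x) * ‖y - z‖ := by
  obtain ⟨c, ρ, hρ, hc, hd⟩ := hκ T hT.1
  have h1 := abs_triCoord_sub_le hT.1 hρ hc a z y
  have h2 := norm_sub_le_of_mem_triCone hT hx
  have h3 := one_sub_triCoord_nonneg hT hx
  set A := |triCoord T a y - triCoord T a z|
  have hA : 0 ≤ A := abs_nonneg _
  calc A * ‖x - a‖ ≤ A * (κ * ρ * (1 - triCoord T a x)) := by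
        gcongr
        exact h2.trans (mul_le_mul_of_nonneg_right hd h3)
    _ = (A * (2 * ρ)) * (κ / 2 * (1 - triCoord T a x)) := by ring
    _ ≤ ‖y - z‖ * (κ / 2 * (1 - triCoord T a x)) := by
        refine mul_le_mul_of_nonneg_right h1 (mul_nonneg ?_ h3)
        have : 0 ≤ κ * ρ := Metric.diam_nonneg.trans hd
        have := nonneg_of_mul_nonneg_left this hρ
        positivity
    _ = _ := by ring

theorem kappa_nonneg (hK : IsTriangulation K Ω) (hκ : IsShapeRegular K κ) {a : Plane}
    (ha : a ∈ K.vertices) : 0 ≤ κ := by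
  obtain ⟨T, hT, -⟩ := hK.exists_triangle_of_vertex ha
  obtain ⟨c, ρ, hρ, -, hd⟩ := hκ T hT
  exact nonneg_of_mul_nonneg_left (Metric.diam_nonneg.trans hd) hρ

/-- The level satisfies a scale invariant Lipschitz condition at each point of the cone. -/
theorem eventually_level_sub_le (hK : IsTriangulation K Ω) (hκ : IsShapeRegular K κ) (a x : Plane) :
    ∀ᶠ y in 𝓝 x, y ∈ starCone K a →
      |level K a y - level K a x| * ‖x - a‖ ≤ κ / 2 * level K a x * ‖y - x‖ ∧
      |level K a y - level K a x| * ‖y - a‖ ≤ κ / 2 * level K a y * ‖y - x‖ := by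
  filter_upwards [eventually_starCone hK a x] with y hy hyC
  obtain ⟨T, hT, h1, h2⟩ := hy hyC
  have e : |level K a y - level K a x| = |triCoord T a y - triCoord T a x| := by
    rw [level_eq hT h1, level_eq hT h2, abs_sub_comm]
    ring_nf
  rw [e, level_eq hT h1, level_eq hT h2]
  exact ⟨abs_triCoord_sub_mul_le hκ hT h2 y x, abs_triCoord_sub_mul_le hκ hT h1 y x⟩

theorem eventually_abs_hat_sub_le (hK : IsTriangulation K Ω) {L : ℝ} {a : Plane}
    (hL : ∀ T ∈ triangles K, ∀ x y, |triCoord T a y - triCoord T a x| ≤ L * ‖y - x‖) (x : Plane) :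
    ∀ᶠ y in 𝓝 x, y ∈ K.space → |hat K a y - hat K a x| ≤ L * ‖y - x‖ := by
  filter_upwards [eventually_space hK x] with y hy h
  obtain ⟨T, hT, h1, h2⟩ := hy h
  rw [hat_eq_triCoord hT h1, hat_eq_triCoord hT h2]
  exact hL T hT x y

/-- On the star domain, `|∇ψ_a(x)| ≤ (κ / 2) (1 - ψ_a(x)) / |x - a|`. -/
theorem norm_gradient_hat_le (hK : IsTriangulation K Ω) (hκ : IsShapeRegular K κ) {a x : Plane}
    (ha : a ∈ K.vertices) (hx : x ∈ starDomain K a) :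
    ‖gradient (hat K a) x‖ * ‖x - a‖ ≤ κ / 2 * level K a x := by
  rcases eq_or_ne x a with rfl | hne
  · rw [sub_self, norm_zero, mul_zero]
    exact mul_nonneg (by linarith [kappa_nonneg hK hκ ha]) level_nonneg
  have hd : 0 < ‖x - a‖ := norm_pos_iff.2 (sub_ne_zero.2 hne)
  rw [← le_div_iff₀ hd, norm_gradient]
  refine norm_fderiv_le_of_lip' ℝ ?_ ?_
  · exact div_nonneg (mul_nonneg (by linarith [kappa_nonneg hK hκ ha]) level_nonneg) hd.le
  · filter_upwards [eventually_level_sub_le hK hκ a x,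
      mem_interior_iff_mem_nhds.1 (starDomain_eq (K := K) a ▸ hx)] with y h1 h2
    have h3 := (h1 (closedStar_subset_starCone h2)).1
    rw [hat_of_mem_closedStar h2, hat_of_mem_closedStar (interior_subset hx), Real.norm_eq_abs,
      show 1 - level K a y - (1 - level K a x) = -(level K a y - level K a x) by ring, abs_neg,
      div_mul_eq_mul_div, le_div_iff₀ hd]
    exact h3

theorem ae_differentiableAt_hat (hK : IsTriangulation K Ω) (a : Plane) :
    ∀ᵐ x ∂volume.restrict (starDomain K a), DifferentiableAt ℝ (hat K a) x := by
  have hnull : volume (⋃ T ∈ starTriangles K a, frontier (convexHull ℝ (T : Set Plane))) = 0 :=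
    (measure_biUnion_null_iff (hK.finite_starTriangles a).countable).2 fun T _ =>
      (convex_convexHull ℝ _).addHaar_frontier volume
  filter_upwards [ae_restrict_mem (isOpen_starDomain a).measurableSet,
    ae_restrict_of_ae (measure_eq_zero_iff_ae_notMem.1 hnull)] with x hx hx'
  obtain ⟨T, hT, hxT⟩ := mem_closedStar.1 (interior_subset hx)
  have hi : x ∈ interior (convexHull ℝ (T : Set Plane)) := by
    by_contra hi
    exact hx' (mem_biUnion hT ⟨subset_closure hxT, hi⟩)
  have he : hat K a =ᶠ[𝓝 x] triCoord T a := by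
    filter_upwards [mem_interior_iff_mem_nhds.1 hi] with y hy
    exact hat_eq_triCoord hT.1 hy a
  refine DifferentiableAt.congr_of_eventuallyEq ?_ he
  exact (⟨triCoord T a, continuous_triCoord T a⟩ : Plane →ᴬ[ℝ] ℝ).differentiable x

/-! ### Mean value inequalities under pointwise conditions -/

/-- A bound of the increments of a function by the integral of a pointwise bound of its upper
right slopes. -/
theorem norm_sub_le_integral_of_slope {E : Type*} [NormedAddCommGroup E] {α β : ℝ} (hαβ : α ≤ β)
    {h : ℝ → E} {m : ℝ → ℝ} (hh : ContinuousOn h (Icc α β)) (hm : ContinuousOn m (Icc α β))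
    (hs : ∀ t ∈ Ico α β, ∀ r, m t < r → ∀ᶠ z in 𝓝[>] t, ‖h z - h t‖ ≤ r * (z - t)) :
    ‖h β - h α‖ ≤ ∫ t in α..β, m t := by
  set m' : ℝ → ℝ := IccExtend hαβ ((Icc α β).domRestrict m) with hm'
  have hm'c : Continuous m' := (continuousOn_iff_continuous_domRestrict.1 hm).Icc_extend'
  have hmm : ∀ t ∈ Icc α β, m' t = m t := fun t ht => IccExtend_of_mem hαβ _ ht
  have key := image_le_of_liminf_slope_right_le_deriv_boundary (f := fun t => ‖h t - h α‖)
    (a := α) (b := β) (B := fun t => ∫ s in α..t, m' s) (B' := m') (hh.sub continuousOn_const).norm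
    (by simp) (intervalIntegral.differentiable_integral_of_continuous hm'c).continuous.continuousOn
    (fun t _ => (intervalIntegral.integral_hasDerivAt_right (hm'c.intervalIntegrable _ _)
      hm'c.aestronglyMeasurable.stronglyMeasurableAtFilter hm'c.continuousAt).hasDerivWithinAt) ?_
    (right_mem_Icc.2 hαβ)
  · refine key.trans (le_of_eq ?_)
    refine intervalIntegral.integral_congr fun t ht => hmm t ?_
    rwa [uIcc_of_le hαβ] at ht
  · intro t ht r hr
    rw [hmm t (Ico_subset_Icc_self ht)] at hr
    obtain ⟨r', h1, h2⟩ := exists_between hr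
    refine Eventually.frequently ?_
    filter_upwards [hs t ht r' h1, self_mem_nhdsWithin] with z hz hzt
    have hpos : 0 < z - t := sub_pos.2 hzt
    rw [slope_def_field, div_lt_iff₀ hpos]
    calc ‖h z - h α‖ - ‖h t - h α‖ ≤ ‖(h z - h α) - (h t - h α)‖ := norm_sub_norm_le _ _
      _ = ‖h z - h t‖ := by rw [sub_sub_sub_cancel_right]
      _ ≤ r' * (z - t) := hz
      _ < r * (z - t) := by gcongr

/-- A function with a uniform pointwise Lipschitz bound is Lipschitz. -/
theorem lipschitzWith_of_eventually {f : Plane → ℝ} {L : NNReal}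
    (h : ∀ x, ∀ᶠ y in 𝓝 x, |f y - f x| ≤ L * ‖y - x‖) : LipschitzWith L f := by
  have hc : Continuous f := by
    refine continuous_iff_continuousAt.2 fun x => ?_
    rw [ContinuousAt, tendsto_iff_dist_tendsto_zero]
    have hlim : Tendsto (fun y => (L : ℝ) * ‖y - x‖) (𝓝 x) (𝓝 0) := by
      have : Continuous fun y : Plane => (L : ℝ) * ‖y - x‖ := by fun_prop
      simpa using this.tendsto x
    exact squeeze_zero' (Eventually.of_forall fun _ => dist_nonneg) (h x) hlim
  refine LipschitzWith.of_dist_le_mul fun y x => ?_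
  have hp : Continuous fun t : ℝ => x + t • (y - x) := by fun_prop
  have key := norm_sub_le_integral_of_slope (zero_le_one (α := ℝ))
    (h := fun t => f (x + t • (y - x))) (m := fun _ => L * ‖y - x‖)
    (hc.comp hp).continuousOn continuousOn_const fun t _ r hr => ?_
  · simpa [dist_eq_norm] using key
  · filter_upwards [(hp.tendsto t).eventually (h _) |>.filter_mono nhdsWithin_le_nhds,
      self_mem_nhdsWithin] with z hz hzt
    have hpos : 0 < z - t := sub_pos.2 hzt
    refine hz.trans ?_
    rw [add_sub_add_left_eq_sub, ← sub_smul, norm_smul, Real.norm_of_nonneg hpos.le]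
    calc (L : ℝ) * ((z - t) * ‖y - x‖) = L * ‖y - x‖ * (z - t) := by ring
      _ ≤ r * (z - t) := by gcongr

/-! ### The Poincaré inequality on star-shaped sets -/

/-- The fundamental theorem of calculus along a segment, squared. -/
theorem enorm_sub_sq_le {v : Plane → ℝ} (hv : ContDiff ℝ 1 v) (x y : Plane) :
    ‖v x - v y‖ₑ ^ 2 ≤
      ‖x - y‖ₑ ^ 2 * ∫⁻ s in Ioc (0 : ℝ) 1, ‖gradient v (y + s • (x - y))‖ₑ ^ 2 := by
  have hp : Continuous fun s : ℝ => y + s • (x - y) := by fun_prop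
  have hg : Continuous fun s : ℝ => gradient v (y + s • (x - y)) := (continuous_gradient hv).comp hp
  have hd : ∀ s : ℝ, HasDerivAt (fun s => v (y + s • (x - y)))
      (inner ℝ (gradient v (y + s • (x - y))) (x - y)) s := by
    intro s
    have h1 : HasDerivAt (fun s : ℝ => y + s • (x - y)) (x - y) s := by
      simpa using ((hasDerivAt_id s).smul_const (x - y)).const_add y
    rw [inner_gradient_left]
    exact ((hv.differentiable one_ne_zero) _).hasFDerivAt.comp_hasDerivAt s h1
  have key := intervalIntegral.integral_eq_sub_of_hasDerivAt (a := 0) (b := 1) (fun s _ => hd s)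
    ((hg.inner continuous_const).intervalIntegrable _ _)
  have e : v x - v y = ∫ s in Ioc (0 : ℝ) 1, inner ℝ (gradient v (y + s • (x - y))) (x - y) := by
    rw [← intervalIntegral.integral_of_le zero_le_one, key]
    simp
  calc ‖v x - v y‖ₑ ^ 2
      ≤ (∫⁻ s in Ioc (0 : ℝ) 1, ‖x - y‖ₑ * ‖gradient v (y + s • (x - y))‖ₑ) ^ 2 := by
        gcongr
        rw [e]
        refine (enorm_integral_le_lintegral_enorm _).trans (lintegral_mono fun s => ?_)
        rw [mul_comm, ← enorm_norm (gradient v _), ← enorm_norm (x - y), ← enorm_mul,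
          enorm_le_iff_norm_le]
        simpa using norm_inner_le_norm (𝕜 := ℝ) (gradient v (y + s • (x - y))) (x - y)
    _ = ‖x - y‖ₑ ^ 2 * (∫⁻ s in Ioc (0 : ℝ) 1, ‖gradient v (y + s • (x - y))‖ₑ) ^ 2 := by
        rw [lintegral_const_mul _ hg.enorm.measurable, mul_pow]
    _ ≤ _ := by
        gcongr
        refine (sq_lintegral_le _ hg.enorm.measurable.aemeasurable).trans ?_
        simp

theorem lintegral_comp_smul_add (F : Plane → ℝ≥0∞) (hF : Measurable F) {s : ℝ} (hs : 0 < s)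
    (b : Plane) : ∫⁻ x, F (s • x + b) = ENNReal.ofReal (s⁻¹ ^ 2) * ∫⁻ x, F x := by
  have hm : Measurable fun x : Plane => s • x := measurable_const_smul s
  have h1 : ∫⁻ x, F (s • x + b) = ∫⁻ x, F (x + b) ∂(Measure.map (fun x : Plane => s • x) volume) :=
    (lintegral_map (hF.comp (measurable_id.add_const b)) hm).symm
  rw [h1, Measure.map_addHaar_smul volume hs.ne', lintegral_smul_measure,
    lintegral_add_right_eq_self F b]
  simp [abs_of_pos hs]

theorem lintegral_homothety_le {F : Plane → ℝ≥0∞} (hF : Measurable F) {S S' : Set Plane}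
    (hS : MeasurableSet S) (hS' : MeasurableSet S') {s t : ℝ} (ht : 0 < t) (hts : t ≤ s) {p : Plane}
    (h : ∀ x ∈ S, p + s • (x - p) ∈ S') :
    ∫⁻ x in S, F (p + s • (x - p)) ≤ ENNReal.ofReal (t⁻¹ ^ 2) * ∫⁻ x in S', F x := by
  have hs : 0 < s := ht.trans_le hts
  have e : ∀ x : Plane, p + s • (x - p) = s • x + (p - s • p) := fun x => by
    rw [smul_sub]
    abel
  calc ∫⁻ x in S, F (p + s • (x - p)) ≤ ∫⁻ x, S'.indicator F (s • x + (p - s • p)) := by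
        rw [← lintegral_indicator hS]
        refine lintegral_mono fun x => ?_
        by_cases hx : x ∈ S
        · rw [indicator_of_mem hx, ← e, indicator_of_mem (h x hx)]
        · rw [indicator_of_notMem hx]
          exact zero_le
    _ = ENNReal.ofReal (s⁻¹ ^ 2) * ∫⁻ x in S', F x := by
        rw [lintegral_comp_smul_add _ (hF.indicator hS') hs, lintegral_indicator hS']
    _ ≤ _ := by
        gcongr

theorem measurable_gradient_sq (v : Plane → ℝ) : Measurable fun x => ‖gradient v x‖ₑ ^ 2 :=
  (measurable_gradient v).enorm.pow_const 2

/-- The effect of a dilation on a function in `H¹` of a star-shaped set. -/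
theorem lintegral_sub_homothety_le {v : Plane → ℝ} (hv : ContDiff ℝ 1 v) {S : Set Plane}
    (hS : MeasurableSet S) {a : Plane} {R t : ℝ} (ht : 0 < t) (ht1 : t ≤ 1)
    (hR : ∀ x ∈ S, ‖x - a‖ ≤ R)
    (hstar : ∀ x ∈ S, ∀ s : ℝ, 0 ≤ s → s ≤ 1 → a + s • (x - a) ∈ S) :
    ∫⁻ x in S, ‖v x - v (a + t • (x - a))‖ₑ ^ 2 ≤
      ENNReal.ofReal ((R * t⁻¹) ^ 2) * ∫⁻ x in S, ‖gradient v x‖ₑ ^ 2 := by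
  have hgm := measurable_gradient_sq v
  have hjm : Measurable fun p : Plane × ℝ =>
      ‖gradient v (a + (t + p.2 * (1 - t)) • (p.1 - a))‖ₑ ^ 2 :=
    hgm.comp (by fun_prop : Continuous fun p : Plane × ℝ =>
      a + (t + p.2 * (1 - t)) • (p.1 - a)).measurable
  calc ∫⁻ x in S, ‖v x - v (a + t • (x - a))‖ₑ ^ 2
      ≤ ∫⁻ x in S, ENNReal.ofReal (R ^ 2) *
          ∫⁻ s in Ioc (0 : ℝ) 1, ‖gradient v (a + (t + s * (1 - t)) • (x - a))‖ₑ ^ 2 := by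
        refine setLIntegral_mono' hS fun x hx => (enorm_sub_sq_le hv _ _).trans ?_
        have e : ∀ s : ℝ, a + t • (x - a) + s • (x - (a + t • (x - a))) =
            a + (t + s * (1 - t)) • (x - a) := fun s => by module
        simp only [e]
        gcongr
        have hn : ‖x - (a + t • (x - a))‖ ≤ R := by
          rw [show x - (a + t • (x - a)) = (1 - t) • (x - a) by module, norm_smul,
            Real.norm_of_nonneg (by linarith)]
          have := hR x hx
          nlinarith [norm_nonneg (x - a)]
        rw [← ofReal_norm, ← ENNReal.ofReal_pow (norm_nonneg _)]
        gcongr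
    _ = ENNReal.ofReal (R ^ 2) * ∫⁻ s in Ioc (0 : ℝ) 1, ∫⁻ x in S,
          ‖gradient v (a + (t + s * (1 - t)) • (x - a))‖ₑ ^ 2 := by
        rw [lintegral_const_mul' _ _ ENNReal.ofReal_ne_top,
          lintegral_lintegral_swap hjm.aemeasurable]
    _ ≤ ENNReal.ofReal (R ^ 2) * ∫⁻ s in Ioc (0 : ℝ) 1, ENNReal.ofReal (t⁻¹ ^ 2) *
          ∫⁻ x in S, ‖gradient v x‖ₑ ^ 2 := by
        refine mul_le_mul_right ?_ _
        refine setLIntegral_mono' measurableSet_Ioc fun s hs => ?_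
        have h1 : 0 ≤ s * (1 - t) := mul_nonneg hs.1.le (by linarith)
        have h2 : s * (1 - t) ≤ 1 - t := mul_le_of_le_one_left (by linarith) hs.2
        exact lintegral_homothety_le hgm hS hS ht (by linarith)
          fun x hx => hstar x hx _ (by linarith) (by linarith)
    _ = _ := by
        rw [lintegral_const, Measure.restrict_apply_univ, Real.volume_Ioc, sub_zero,
          ENNReal.ofReal_one, mul_one, ← mul_assoc, ← ENNReal.ofReal_mul (by positivity), mul_pow]

/-- The averages of an integral over the points that divide the segments between two points of a
convex set in a fixed ratio: one end point can be fixed so that the division point depends on the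
other one through a dilation by a factor of at least `1 / 2`. -/
theorem lintegral_segment_le {G : Plane → ℝ≥0∞} (hG : Measurable G) {B : Set Plane}
    (hB : MeasurableSet B) (hconv : Convex ℝ B) {s : ℝ} (hs : s ∈ Ioc (0 : ℝ) 1) :
    ∫⁻ x in B, ∫⁻ y in B, G (y + s • (x - y)) ≤
      ENNReal.ofReal 4 * volume B * ∫⁻ x in B, G x := by
  have hseg : ∀ x ∈ B, ∀ y ∈ B, y + s • (x - y) ∈ B :=
    fun x hx y hy => hconv.add_smul_sub_mem hy hx ⟨hs.1.le, hs.2⟩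
  have h4 : ((1 / 2 : ℝ)⁻¹) ^ 2 = 4 := by norm_num
  rcases le_total (1 / 2) s with h | h
  · have hc : Continuous fun p : Plane × Plane => p.2 + s • (p.1 - p.2) := by fun_prop
    have hj : Measurable fun p : Plane × Plane => G (p.2 + s • (p.1 - p.2)) :=
      hG.comp hc.measurable
    rw [lintegral_lintegral_swap hj.aemeasurable]
    calc ∫⁻ y in B, ∫⁻ x in B, G (y + s • (x - y))
        ≤ ∫⁻ _ in B, ENNReal.ofReal 4 * ∫⁻ x in B, G x := by
          refine setLIntegral_mono' hB fun y hy => ?_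
          rw [← h4]
          exact lintegral_homothety_le hG hB hB (by norm_num) h fun x hx => hseg x hx y hy
      _ = _ := by
          rw [lintegral_const, Measure.restrict_apply_univ]
          ring
  · calc ∫⁻ x in B, ∫⁻ y in B, G (y + s • (x - y))
        ≤ ∫⁻ _ in B, ENNReal.ofReal 4 * ∫⁻ x in B, G x := by
          refine setLIntegral_mono' hB fun x hx => ?_
          have e : ∀ y, y + s • (x - y) = x + (1 - s) • (y - x) := fun y => by module
          rw [← h4]
          simp only [e]
          refine lintegral_homothety_le hG hB hB (by norm_num) (by linarith) fun y hy => ?_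
          rw [← e]
          exact hseg x hx y hy
      _ = _ := by
          rw [lintegral_const, Measure.restrict_apply_univ]
          ring

/-- The Poincaré inequality on a bounded convex set, in terms of differences. -/
theorem lintegral_lintegral_sub_le {v : Plane → ℝ} (hv : ContDiff ℝ 1 v) {B : Set Plane}
    (hB : MeasurableSet B) (hconv : Convex ℝ B) {d : ℝ} (hd : ∀ x ∈ B, ∀ y ∈ B, ‖x - y‖ ≤ d) :
    ∫⁻ x in B, ∫⁻ y in B, ‖v x - v y‖ₑ ^ 2 ≤
      ENNReal.ofReal (4 * d ^ 2) * volume B * ∫⁻ x in B, ‖gradient v x‖ₑ ^ 2 := by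
  have key : ∀ G : Plane → ℝ≥0∞, Measurable G →
      ∫⁻ x in B, ∫⁻ y in B, ENNReal.ofReal (d ^ 2) * ∫⁻ s in Ioc (0 : ℝ) 1, G (y + s • (x - y)) ≤
      ENNReal.ofReal (4 * d ^ 2) * volume B * ∫⁻ x in B, G x := by
    intro G hG
    have hc : Continuous fun p : (Plane × Plane) × ℝ => p.1.2 + p.2 • (p.1.1 - p.1.2) := by fun_prop
    have hj : Measurable fun p : (Plane × Plane) × ℝ => G (p.1.2 + p.2 • (p.1.1 - p.1.2)) :=
      hG.comp hc.measurable
    have hin : ∀ x, ∫⁻ y in B, ∫⁻ s in Ioc (0 : ℝ) 1, G (y + s • (x - y)) =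
        ∫⁻ s in Ioc (0 : ℝ) 1, ∫⁻ y in B, G (y + s • (x - y)) := fun x =>
      lintegral_lintegral_swap (f := fun y s => G (y + s • (x - y))) (hj.comp
        ((measurable_const.prodMk measurable_fst).prodMk measurable_snd)).aemeasurable
    have hxs : Measurable fun p : Plane × ℝ => ∫⁻ y in B, G (y + p.2 • (p.1 - y)) :=
      Measurable.lintegral_prod_right'
        (f := fun q : (Plane × ℝ) × Plane => G (q.2 + q.1.2 • (q.1.1 - q.2)))
        (hj.comp ((measurable_fst.fst.prodMk measurable_snd).prodMk measurable_fst.snd))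
    simp_rw [lintegral_const_mul' _ _ ENNReal.ofReal_ne_top, hin]
    rw [lintegral_lintegral_swap (f := fun x s => ∫⁻ y in B, G (y + s • (x - y))) hxs.aemeasurable]
    calc _ ≤ ENNReal.ofReal (d ^ 2) * ∫⁻ _ in Ioc (0 : ℝ) 1,
          ENNReal.ofReal 4 * volume B * ∫⁻ x in B, G x := by
          refine mul_le_mul_right ?_ _
          exact setLIntegral_mono' measurableSet_Ioc fun s hs => lintegral_segment_le hG hB hconv hs
      _ = _ := by
          rw [lintegral_const, Measure.restrict_apply_univ, Real.volume_Ioc, sub_zero,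
            ENNReal.ofReal_one, mul_one, ENNReal.ofReal_mul (by norm_num)]
          ring
  refine le_trans ?_ (key _ (measurable_gradient_sq v))
  refine setLIntegral_mono' hB fun x hx => setLIntegral_mono' hB fun y hy => ?_
  refine (enorm_sub_sq_le hv x y).trans (mul_le_mul_left ?_ _)
  rw [← ofReal_norm, ← ENNReal.ofReal_pow (norm_nonneg _)]
  have := hd x hx y hy
  gcongr

/-- The mean square deviation from the mean is at most the mean of the squared differences. -/
theorem lintegral_sub_average_le {v : Plane → ℝ} {B : Set Plane} (hB : MeasurableSet B)
    (hB0 : volume B ≠ 0) (hBt : volume B ≠ ⊤) (hm : Measurable v) (hv : IntegrableOn v B) :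
    volume B * ∫⁻ x in B, ‖v x - ⨍ y in B, v y‖ₑ ^ 2 ≤ ∫⁻ x in B, ∫⁻ y in B, ‖v x - v y‖ₑ ^ 2 := by
  have : IsFiniteMeasure (volume.restrict B) := ⟨by simpa using hBt.lt_top⟩
  have hV : 0 < volume.real B := ENNReal.toReal_pos hB0 hBt
  rw [← lintegral_const_mul' _ _ hBt]
  refine setLIntegral_mono' hB fun x _ => ?_
  have e : v x - ⨍ y in B, v y = (volume.real B)⁻¹ * ∫ y in B, (v x - v y) := by
    rw [integral_sub (integrable_const _) hv, setAverage_eq]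
    simp only [integral_const, measureReal_restrict_apply_univ, smul_eq_mul, mul_sub]
    rw [← mul_assoc, inv_mul_cancel₀ hV.ne', one_mul]
  have hin : ‖∫ y in B, (v x - v y)‖ₑ ^ 2 ≤ volume B * ∫⁻ y in B, ‖v x - v y‖ₑ ^ 2 := by
    refine (ENNReal.pow_le_pow_left (enorm_integral_le_lintegral_enorm _)).trans ?_
    refine (sq_lintegral_le _ (hm.const_sub (v x)).enorm.aemeasurable).trans (le_of_eq ?_)
    rw [Measure.restrict_apply_univ]
  have hinv : ‖(volume.real B)⁻¹‖ₑ = (volume B)⁻¹ := by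
    rw [Real.enorm_of_nonneg (by positivity), ENNReal.ofReal_inv_of_pos hV, measureReal_def,
      ENNReal.ofReal_toReal hBt]
  rw [e, enorm_mul, mul_pow, hinv]
  calc volume B * ((volume B)⁻¹ ^ 2 * ‖∫ y in B, (v x - v y)‖ₑ ^ 2)
      ≤ volume B * ((volume B)⁻¹ ^ 2 * (volume B * ∫⁻ y in B, ‖v x - v y‖ₑ ^ 2)) := by
        gcongr
    _ = (volume B * (volume B)⁻¹) ^ 2 * ∫⁻ y in B, ‖v x - v y‖ₑ ^ 2 := by ring
    _ = _ := by rw [ENNReal.mul_inv_cancel hB0 hBt, one_pow, one_mul]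

/-- The Poincaré inequality for smooth functions on a set that is star-shaped with respect to `a` and
lies between two balls with center `a`: it is reduced to the inner ball by a dilation. -/
theorem poincare_starShaped {v : Plane → ℝ} (hv : ContDiff ℝ 1 v) {S : Set Plane}
    (hS : MeasurableSet S) {a : Plane} {r R : ℝ} (hr : 0 < r) (hrR : r ≤ R)
    (hR : ∀ x ∈ S, ‖x - a‖ ≤ R) (hB : Metric.ball a r ⊆ S)
    (hstar : ∀ x ∈ S, ∀ s : ℝ, 0 ≤ s → s ≤ 1 → a + s • (x - a) ∈ S) :
    normL2 S (fun x => v x - ⨍ y in Metric.ball a r, v y) ≤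
      ENNReal.ofReal (12 * R ^ 2 / r) * normL2 S (gradient v) := by
  set B := Metric.ball a r with hBdef
  set c := ⨍ y in B, v y with hc
  have hBm : MeasurableSet B := Metric.isOpen_ball.measurableSet
  have hB0 : volume B ≠ 0 := (Metric.measure_ball_pos volume a hr).ne'
  have hBt : volume B ≠ ⊤ := measure_ball_lt_top.ne
  have hR0 : 0 < R := hr.trans_le hrR
  set t := r / (2 * R) with ht
  have ht0 : 0 < t := by positivity
  have ht1 : t ≤ 1 := by
    rw [ht, div_le_one (by positivity)]
    linarith
  set I := ∫⁻ x in S, ‖gradient v x‖ₑ ^ 2 with hI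
  have hBI : ∫⁻ x in B, ‖gradient v x‖ₑ ^ 2 ≤ I := lintegral_mono_set hB
  have hball : ∫⁻ x in B, ‖v x - c‖ₑ ^ 2 ≤ ENNReal.ofReal (16 * r ^ 2) * I := by
    have h1 := lintegral_sub_average_le hBm hB0 hBt hv.continuous.measurable
      ((hv.continuous.continuousOn.integrableOn_compact (isCompact_closedBall a r)).mono_set
        Metric.ball_subset_closedBall)
    have h2 := lintegral_lintegral_sub_le hv hBm (convex_ball a r) (d := 2 * r) fun x hx y hy => by
      rw [← dist_eq_norm]
      have := dist_triangle_right x y a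
      rw [hBdef, Metric.mem_ball] at hx hy
      linarith
    have h3 := h1.trans h2
    rw [show ENNReal.ofReal (4 * (2 * r) ^ 2) * volume B * ∫⁻ x in B, ‖gradient v x‖ₑ ^ 2 =
      volume B * (ENNReal.ofReal (4 * (2 * r) ^ 2) * ∫⁻ x in B, ‖gradient v x‖ₑ ^ 2) by ring,
      ENNReal.mul_le_mul_iff_right hB0 hBt] at h3
    refine h3.trans ?_
    rw [show 4 * (2 * r) ^ 2 = 16 * r ^ 2 by ring]
    gcongr
  have hdil := lintegral_sub_homothety_le hv hS ht0 ht1 hR hstar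
  have hin : ∫⁻ x in S, ‖v (a + t • (x - a)) - c‖ₑ ^ 2 ≤
      ENNReal.ofReal (t⁻¹ ^ 2) * ∫⁻ x in B, ‖v x - c‖ₑ ^ 2 := by
    refine lintegral_homothety_le (F := fun x => ‖v x - c‖ₑ ^ 2)
      ((hv.continuous.measurable.sub_const c).enorm.pow_const 2) hS hBm ht0 le_rfl fun x hx => ?_
    rw [hBdef, Metric.mem_ball, dist_eq_norm, add_sub_cancel_left, norm_smul,
      Real.norm_of_nonneg ht0.le]
    calc t * ‖x - a‖ ≤ t * R := by
          gcongr
          exact hR x hx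
      _ = r / 2 := by
          rw [ht]
          field_simp
      _ < r := half_lt_self hr
  have hsq : ∀ x, ‖v x - c‖ₑ ^ 2 ≤
      2 * ‖v x - v (a + t • (x - a))‖ₑ ^ 2 + 2 * ‖v (a + t • (x - a)) - c‖ₑ ^ 2 := by
    intro x
    set p := v x - v (a + t • (x - a))
    set q := v (a + t • (x - a)) - c
    rw [show v x - c = p + q by simp [p, q], ← ofReal_norm, ← ofReal_norm,
      ← ofReal_norm, ← ENNReal.ofReal_pow (norm_nonneg _),
      ← ENNReal.ofReal_pow (norm_nonneg _), ← ENNReal.ofReal_pow (norm_nonneg _),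
      show (2 : ℝ≥0∞) = ENNReal.ofReal 2 by simp, ← ENNReal.ofReal_mul (by norm_num),
      ← ENNReal.ofReal_mul (by norm_num), ← ENNReal.ofReal_add (by positivity) (by positivity)]
    refine ENNReal.ofReal_le_ofReal ?_
    simp only [Real.norm_eq_abs, sq_abs]
    nlinarith [sq_nonneg (p - q)]
  have hm1 : Measurable fun x => 2 * ‖v x - v (a + t • (x - a))‖ₑ ^ 2 := by
    have : Continuous fun x => v x - v (a + t • (x - a)) :=
      hv.continuous.sub (hv.continuous.comp (by fun_prop))
    exact (this.measurable.enorm.pow_const 2).const_mul 2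
  have htot : ∫⁻ x in S, ‖v x - c‖ₑ ^ 2 ≤ ENNReal.ofReal ((12 * R ^ 2 / r) ^ 2) * I := by
    calc ∫⁻ x in S, ‖v x - c‖ₑ ^ 2
        ≤ 2 * (∫⁻ x in S, ‖v x - v (a + t • (x - a))‖ₑ ^ 2) +
            2 * ∫⁻ x in S, ‖v (a + t • (x - a)) - c‖ₑ ^ 2 := by
          rw [← lintegral_const_mul' _ _ ENNReal.ofNat_ne_top,
            ← lintegral_const_mul' _ _ ENNReal.ofNat_ne_top, ← lintegral_add_left hm1]
          exact lintegral_mono hsq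
      _ ≤ 2 * (ENNReal.ofReal ((R * t⁻¹) ^ 2) * I) +
            2 * (ENNReal.ofReal (t⁻¹ ^ 2) * (ENNReal.ofReal (16 * r ^ 2) * I)) := by
          gcongr
          exact hin.trans (by gcongr)
      _ = ENNReal.ofReal (2 * (R * t⁻¹) ^ 2 + 2 * (t⁻¹ ^ 2 * (16 * r ^ 2))) * I := by
          rw [ENNReal.ofReal_add (by positivity) (by positivity),
            ENNReal.ofReal_mul (p := 2) (by norm_num),
            ENNReal.ofReal_mul (p := 2) (q := t⁻¹ ^ 2 * (16 * r ^ 2)) (by norm_num),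
            ENNReal.ofReal_mul (p := t⁻¹ ^ 2) (by positivity), ENNReal.ofReal_ofNat]
          ring
      _ ≤ _ := by
          gcongr
          have hti : t⁻¹ = 2 * R / r := by rw [ht, inv_div]
          rw [hti]
          have e1 : 2 * (R * (2 * R / r)) ^ 2 + 2 * ((2 * R / r) ^ 2 * (16 * r ^ 2)) =
              (8 * R ^ 4 + 128 * R ^ 2 * r ^ 2) / r ^ 2 := by
            field_simp
            ring
          have e2 : (12 * R ^ 2 / r) ^ 2 = 144 * R ^ 4 / r ^ 2 := by
            field_simp
            ring
          rw [e1, e2]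
          gcongr
          have : r ^ 2 ≤ R ^ 2 := by gcongr
          nlinarith [sq_nonneg R, mul_le_mul_of_nonneg_left this (sq_nonneg R)]
  rw [← ENNReal.pow_le_pow_left_iff two_ne_zero, mul_pow, normL2, normL2, eLpNorm_two_sq,
    eLpNorm_two_sq, ← ENNReal.ofReal_pow (by positivity)]
  exact htot

/-! ### Polar coordinates -/

/-- The unit vector with angle `θ`. -/
noncomputable def circ (θ : ℝ) : Plane := !₂[Real.cos θ, Real.sin θ]

theorem norm_circ (θ : ℝ) : ‖circ θ‖ = 1 := by
  simp [circ, EuclideanSpace.norm_eq]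

theorem continuous_circ : Continuous circ := by
  unfold circ
  fun_prop

theorem circ_add_two_pi (θ : ℝ) : circ (θ + 2 * Real.pi) = circ θ := by
  simp [circ]

theorem norm_circ_sub_le (θ η : ℝ) : ‖circ θ - circ η‖ ≤ |θ - η| := by
  refine abs_le_of_sq_le_sq' ?_ (abs_nonneg _) |>.2
  rw [EuclideanSpace.norm_sq_eq, sq_abs]
  simp only [circ, Fin.sum_univ_two, PiLp.sub_apply, Real.norm_eq_abs, sq_abs]
  have h := Real.one_sub_sq_div_two_le_cos (x := θ - η)
  rw [Real.cos_sub] at h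
  have h1 := Real.sin_sq_add_cos_sq θ
  have h2 := Real.sin_sq_add_cos_sq η
  simp
  nlinarith

theorem exists_circ_eq {x : Plane} (hx : ‖x‖ = 1) (η : ℝ) :
    ∃ θ ∈ Ico η (η + 2 * Real.pi), circ θ = x := by
  have h1 : x 0 ^ 2 + x 1 ^ 2 = 1 := by
    have := EuclideanSpace.norm_sq_eq x
    rw [hx, Fin.sum_univ_two] at this
    simpa using this.symm
  set z : ℂ := ⟨x 0, x 1⟩ with hz
  have hzn : ‖z‖ = 1 := by
    rw [Complex.norm_def, Complex.normSq_apply, Real.sqrt_eq_one]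
    simp only [hz]
    linarith
  have hz0 : z ≠ 0 := by
    rw [← norm_ne_zero_iff, hzn]
    exact one_ne_zero
  have hc : circ z.arg = x := by
    have e1 := Complex.cos_arg hz0
    have e2 := Complex.sin_arg z
    rw [hzn, div_one] at e1 e2
    ext i
    fin_cases i
    · simpa [circ] using e1
    · simpa [circ] using e2
  refine ⟨toIcoMod Real.two_pi_pos η z.arg, toIcoMod_mem_Ico _ _ _, ?_⟩
  rw [← hc]
  simp only [circ, toIcoMod, zsmul_eq_mul, Real.cos_sub_int_mul_two_pi,
    Real.sin_sub_int_mul_two_pi]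

/-- Polar coordinates around the point `a`. -/
theorem lintegral_polar {F : Plane → ℝ≥0∞} (hF : Measurable F) (a : Plane) :
    ∫⁻ x, F x = ∫⁻ θ in Ioo (-Real.pi) Real.pi, ∫⁻ r in Ioi (0 : ℝ),
      ENNReal.ofReal r * F (a + r • circ θ) := by
  set e : Plane → ℝ × ℝ := fun x => (x 0, x 1) with he
  have hep : MeasurePreserving e volume volume :=
    (volume_preserving_finTwoArrow ℝ).comp (PiLp.volume_preserving_ofLp (Fin 2))
  set f : ℝ × ℝ → ℝ≥0∞ := fun p => F (a + !₂[p.1, p.2]) with hf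
  have hfm : Measurable f := by
    have : Continuous fun p : ℝ × ℝ => a + !₂[p.1, p.2] := by fun_prop
    exact hF.comp this.measurable
  have h1 : ∫⁻ x, F x = ∫⁻ x, f (e x) := by
    rw [← lintegral_add_left_eq_self F a]
    refine lintegral_congr fun x => ?_
    simp only [hf, he]
    congr 2
    ext i
    fin_cases i <;> simp
  have hcont : Continuous fun p : ℝ × ℝ => a + p.1 • circ p.2 := by
    have := continuous_circ
    fun_prop
  have hm : Measurable fun p : ℝ × ℝ => ENNReal.ofReal p.1 * F (a + p.1 • circ p.2) :=
    measurable_fst.ennreal_ofReal.mul (hF.comp hcont.measurable)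
  rw [h1, hep.lintegral_comp hfm, ← lintegral_comp_polarCoord_symm,
    show polarCoord.target = Ioi (0 : ℝ) ×ˢ Ioo (-Real.pi) Real.pi from rfl]
  have h2 : ∀ p : ℝ × ℝ, ENNReal.ofReal p.1 • f (polarCoord.symm p) =
      ENNReal.ofReal p.1 * F (a + p.1 • circ p.2) := by
    intro p
    rw [polarCoord_symm_apply, smul_eq_mul]
    simp only [hf]
    congr 3
    ext i
    fin_cases i <;> simp [circ]
  simp only [h2]
  rw [Measure.volume_eq_prod, setLIntegral_prod _ hm.aemeasurable,
    lintegral_lintegral_swap hm.aemeasurable]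

theorem lintegral_comp_div {f : ℝ → ℝ≥0∞} (hf : Measurable f) {c : ℝ} (hc : 0 < c) :
    ∫⁻ r, f r = ENNReal.ofReal c⁻¹ * ∫⁻ s, f (s / c) := by
  have h := lintegral_map (μ := volume) hf (measurable_const_mul c⁻¹)
  rw [Real.map_volume_mul_left (inv_ne_zero hc.ne'), lintegral_smul_measure, inv_inv,
    abs_of_pos hc] at h
  simp only [div_eq_inv_mul, ← h, smul_eq_mul]
  rw [← mul_assoc, ← ENNReal.ofReal_mul (by positivity), inv_mul_cancel₀ hc.ne', ENNReal.ofReal_one,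
    one_mul]

/-! ### The star in polar coordinates -/

/-- The angles of the rays from `a` in the star cone. -/
def starAngles (K : Geometry.SimplicialComplex ℝ Plane) (a : Plane) : Set ℝ :=
  {θ | a + circ θ ∈ starCone K a}

/-- The point of level `s` on the ray from `a` with angle `θ`. -/
noncomputable def starPoint (K : Geometry.SimplicialComplex ℝ Plane) (a : Plane) (s θ : ℝ) : Plane :=
  a + (s / level K a (a + circ θ)) • circ θ

theorem measurable_level (hK : IsTriangulation K Ω) (a : Plane) : Measurable (level K a) := by
  classical
  have h := ContinuousOn.measurable_piecewise (continuousOn_level hK a)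
    (continuousOn_const (c := (0 : ℝ))) (hK.isClosed_starCone a).measurableSet
  convert h using 1
  ext x
  by_cases hx : x ∈ starCone K a
  · rw [piecewise_eq_of_mem _ _ _ hx]
  · rw [piecewise_eq_of_notMem _ _ _ hx, level, dif_neg fun h => hx (mem_starCone.2 h)]

theorem isClosed_starAngles (hK : IsTriangulation K Ω) (a : Plane) : IsClosed (starAngles K a) :=
  (hK.isClosed_starCone a).preimage (continuous_circ.const_add a)

theorem level_circ_pos {a : Plane} {θ : ℝ} (hθ : θ ∈ starAngles K a) :
    0 < level K a (a + circ θ) := by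
  refine level_pos hθ fun h => ?_
  have := norm_circ θ
  rw [add_eq_left.1 h, norm_zero] at this
  exact zero_ne_one this

theorem ray_mem_starCone_iff {a : Plane} {θ r : ℝ} (hr : 0 < r) :
    a + r • circ θ ∈ starCone K a ↔ θ ∈ starAngles K a := by
  constructor
  · intro h
    have := homothety_mem_starCone h (inv_nonneg.2 hr.le)
    rwa [add_sub_cancel_left, smul_smul, inv_mul_cancel₀ hr.ne', one_smul] at this
  · intro h
    simpa using homothety_mem_starCone h hr.le

theorem level_ray {a : Plane} {θ r : ℝ} (hθ : θ ∈ starAngles K a) (hr : 0 ≤ r) :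
    level K a (a + r • circ θ) = r * level K a (a + circ θ) := by
  simpa using level_homothety hθ hr

theorem starPoint_mem_starCone {a : Plane} {s θ : ℝ} (hθ : θ ∈ starAngles K a) (hs : 0 < s) :
    starPoint K a s θ ∈ starCone K a :=
  (ray_mem_starCone_iff (div_pos hs (level_circ_pos hθ))).2 hθ

theorem level_starPoint {a : Plane} {s θ : ℝ} (hθ : θ ∈ starAngles K a) (hs : 0 < s) :
    level K a (starPoint K a s θ) = s := by
  rw [starPoint, level_ray hθ (div_pos hs (level_circ_pos hθ)).le,
    div_mul_cancel₀ _ (level_circ_pos hθ).ne']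

theorem measurable_starPoint (hK : IsTriangulation K Ω) (a : Plane) :
    Measurable fun p : ℝ × ℝ => starPoint K a p.1 p.2 := by
  have h1 : Measurable circ := continuous_circ.measurable
  have h2 : Measurable fun p : ℝ × ℝ => level K a (a + circ p.2) :=
    (measurable_level hK a).comp ((h1.comp measurable_snd).const_add a)
  exact ((measurable_fst.div h2).smul (h1.comp measurable_snd)).const_add a

/-- The coordinates `(s, θ)`, where `s` is the level and `θ` is the angle, on the star of `a`. -/
theorem lintegral_closedStar (hK : IsTriangulation K Ω) (a : Plane) {F : Plane → ℝ≥0∞}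
    (hF : Measurable F) :
    ∫⁻ x in closedStar K a, F x = ∫⁻ θ in Ioo (-Real.pi) Real.pi ∩ starAngles K a,
      ∫⁻ s in Ioo (0 : ℝ) 1, ENNReal.ofReal (s / level K a (a + circ θ) ^ 2) *
        F (starPoint K a s θ) := by
  have hSm : MeasurableSet (closedStar K a) := (hK.isCompact_closedStar a).isClosed.measurableSet
  have hAm := (isClosed_starAngles hK a).measurableSet
  rw [← lintegral_indicator hSm, lintegral_polar (hF.indicator hSm) a, inter_comm,
    ← Measure.restrict_restrict hAm, ← lintegral_indicator hAm]
  refine lintegral_congr fun θ => ?_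
  by_cases hθ : θ ∈ starAngles K a
  · rw [indicator_of_mem hθ]
    set g := level K a (a + circ θ) with hg
    have hg0 : 0 < g := level_circ_pos hθ
    have hray : Continuous fun r : ℝ => a + r • circ θ := by fun_prop
    have hm : Measurable fun r : ℝ => ENNReal.ofReal r *
        (closedStar K a).indicator F (a + r • circ θ) :=
      measurable_id.ennreal_ofReal.mul ((hF.indicator hSm).comp hray.measurable)
    rw [← lintegral_indicator measurableSet_Ioi,
      lintegral_comp_div (hm.indicator measurableSet_Ioi) hg0, Measure.restrict_congr_set Ioo_ae_eq_Ioc,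
      ← lintegral_indicator measurableSet_Ioc, ← lintegral_const_mul' _ _ ENNReal.ofReal_ne_top]
    refine lintegral_congr fun s => ?_
    by_cases hs : 0 < s
    · have hsg : 0 < s / g := div_pos hs hg0
      have hmem : a + (s / g) • circ θ ∈ closedStar K a ↔ s ≤ 1 := by
        rw [mem_closedStar_iff_level ((ray_mem_starCone_iff hsg).2 hθ), level_ray hθ hsg.le, ← hg,
          div_mul_cancel₀ _ hg0.ne']
      rw [indicator_of_mem (show s / g ∈ Ioi 0 from hsg)]
      by_cases hs1 : s ≤ 1
      · rw [indicator_of_mem (hmem.2 hs1), indicator_of_mem (show s ∈ Ioc 0 1 from ⟨hs, hs1⟩),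
          ← mul_assoc, ← ENNReal.ofReal_mul (by positivity)]
        congr 2
        field_simp
      · rw [indicator_of_notMem fun h => hs1 (hmem.1 h), indicator_of_notMem fun h => hs1 h.2]
        simp
    · rw [indicator_of_notMem, indicator_of_notMem fun h => hs h.1, mul_zero]
      intro h
      exact hs ((div_pos_iff_of_pos_right hg0).1 h)
  · rw [indicator_of_notMem hθ]
    refine (setLIntegral_congr_fun measurableSet_Ioi fun r hr => ?_).trans lintegral_zero
    rw [indicator_of_notMem, mul_zero]
    exact fun h => hθ ((ray_mem_starCone_iff hr).1 (closedStar_subset_starCone h))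

/-! ### Hardy's inequality on the star of a boundary vertex -/

/-- The scale invariant Lipschitz condition for the level, on the unit circle around `a`. -/
theorem eventually_level_circ (hK : IsTriangulation K Ω) (hκ : IsShapeRegular K κ) (a : Plane)
    (θ : ℝ) : ∀ᶠ z in 𝓝 θ, z ∈ starAngles K a →
      |level K a (a + circ z) - level K a (a + circ θ)| ≤
          κ / 2 * level K a (a + circ θ) * ‖circ z - circ θ‖ ∧
        |level K a (a + circ z) - level K a (a + circ θ)| ≤
          κ / 2 * level K a (a + circ z) * ‖circ z - circ θ‖ := by
  have hc : Continuous fun z => a + circ z := continuous_circ.const_add a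
  filter_upwards [(hc.tendsto θ).eventually (eventually_level_sub_le hK hκ a (a + circ θ))]
    with z hz hzA
  have := hz hzA
  simpa [norm_circ] using this

/-- The curves of constant level have a scale invariant speed bound. -/
theorem eventually_starPoint_sub_le (hK : IsTriangulation K Ω) (hκ : IsShapeRegular K κ)
    {a : Plane} {s θ : ℝ} (hs : 0 < s) (hθ : θ ∈ starAngles K a) :
    ∀ᶠ z in 𝓝 θ, z ∈ starAngles K a → ‖starPoint K a s z - starPoint K a s θ‖ ≤
      (1 + κ / 2) * (s / level K a (a + circ θ)) * |z - θ| := by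
  have hκ0 : 0 ≤ κ := by
    obtain ⟨T, hT, -⟩ := mem_starCone.1 hθ
    obtain ⟨c, ρ, hρ, -, hd⟩ := hκ T hT.1
    exact nonneg_of_mul_nonneg_left (Metric.diam_nonneg.trans hd) hρ
  filter_upwards [eventually_level_circ hK hκ a θ] with z hz hzA
  have h2 := (hz hzA).2
  have hg := level_circ_pos hθ
  have hg' := level_circ_pos hzA
  set g := level K a (a + circ θ)
  set g' := level K a (a + circ z)
  set d := ‖circ z - circ θ‖
  have hd0 : 0 ≤ d := norm_nonneg _
  have hd : d ≤ |z - θ| := norm_circ_sub_le z θ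
  have e : starPoint K a s z - starPoint K a s θ =
      (s / g) • (circ z - circ θ) + (s / g' - s / g) • circ z := by
    simp only [starPoint]
    module
  have e2 : |s / g' - s / g| = s / g * (|g' - g| / g') := by
    rw [show s / g' - s / g = -(s / g * ((g' - g) / g')) by field_simp; ring, abs_neg, abs_mul,
      abs_of_pos (div_pos hs hg), abs_div, abs_of_pos hg']
  have h3 : |g' - g| / g' ≤ κ / 2 * d := by
    rw [div_le_iff₀ hg']
    linarith
  calc ‖starPoint K a s z - starPoint K a s θ‖
      ≤ s / g * d + s / g * (|g' - g| / g') := by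
        rw [e]
        refine (norm_add_le _ _).trans (le_of_eq ?_)
        rw [norm_smul, norm_smul, norm_circ, mul_one, Real.norm_eq_abs, Real.norm_eq_abs, e2,
          abs_of_pos (div_pos hs hg)]
    _ ≤ s / g * d + s / g * (κ / 2 * d) := by gcongr
    _ = (s / g) * (d + κ * d / 2) := by ring
    _ ≤ (s / g) * (|z - θ| + κ * |z - θ| / 2) := by
        gcongr
    _ = _ := by ring

theorem continuousOn_starPoint (hK : IsTriangulation K Ω) (a : Plane) (s : ℝ) :
    ContinuousOn (starPoint K a s) (starAngles K a) := by
  have h1 : ContinuousOn (fun θ => level K a (a + circ θ)) (starAngles K a) :=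
    (continuousOn_level hK a).comp (continuous_circ.const_add a).continuousOn fun _ h => h
  exact continuousOn_const.add ((continuousOn_const.div h1
    fun θ hθ => (level_circ_pos hθ).ne').smul continuous_circ.continuousOn)

theorem exists_notMem_starAngles (hK : IsTriangulation K Ω) {a : Plane} (ha : a ∈ K.vertices)
    (h : starCone K a ≠ univ) (η : ℝ) :
    ∃ θ ∈ Ico η (η + 2 * Real.pi), θ ∉ starAngles K a := by
  obtain ⟨x, hx⟩ := (ne_univ_iff_exists_notMem _).1 h
  have hxa : x ≠ a := fun hxa =>
    hx (by rw [hxa]; exact closedStar_subset_starCone (mem_closedStar_self hK ha))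
  have hn : 0 < ‖x - a‖ := norm_pos_iff.2 (sub_ne_zero.2 hxa)
  obtain ⟨θ, hθ, hc⟩ := exists_circ_eq (x := ‖x - a‖⁻¹ • (x - a))
    (by rw [norm_smul, norm_inv, norm_norm, inv_mul_cancel₀ hn.ne']) η
  refine ⟨θ, hθ, fun hA => hx ?_⟩
  have := (ray_mem_starCone_iff (K := K) (a := a) (θ := θ) hn).2 hA
  rwa [hc, smul_smul, mul_inv_cancel₀ hn.ne', one_smul, add_sub_cancel] at this

/-- Each angle in the star cone of a boundary vertex is connected within the cone to an end of the
cone, where the functions in `H¹_*` vanish. -/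
theorem exists_angle_on_frontier (hK : IsTriangulation K Ω) {a : Plane} (ha : a ∈ K.vertices)
    (h : starCone K a ≠ univ) {θ₁ : ℝ} (hθ : θ₁ ∈ starAngles K a) :
    ∃ θ₀, θ₁ - 2 * Real.pi ≤ θ₀ ∧ θ₀ ≤ θ₁ ∧ Icc θ₀ θ₁ ⊆ starAngles K a ∧
      ∀ s ∈ Ioo (0 : ℝ) 1,
        starPoint K a s θ₀ ∈ frontier (starDomain K a) ∩ frontier Ω := by
  obtain ⟨η, hη, hηA⟩ := exists_notMem_starAngles hK ha h (θ₁ - 2 * Real.pi)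
  -- `θ₀` is the supremum of the angles up to `θ₁` with a ray outside the cone
  set Z : Set ℝ := (starAngles K a)ᶜ ∩ Iic θ₁ with hZ
  have hηZ : η ∈ Z := ⟨hηA, show η ≤ θ₁ by linarith [hη.2]⟩
  have hbdd : BddAbove Z := ⟨θ₁, fun z hz => hz.2⟩
  set θ₀ := sSup Z with hθ₀
  have hle : θ₀ ≤ θ₁ := csSup_le ⟨η, hηZ⟩ fun z hz => hz.2
  have hη0 : η ≤ θ₀ := le_csSup hbdd hηZ
  have hoc : Ioc θ₀ θ₁ ⊆ starAngles K a := by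
    intro z hz
    by_contra hzA
    exact absurd (le_csSup hbdd ⟨hzA, hz.2⟩) (not_le.2 hz.1)
  have hcl : θ₀ ∈ closure (starAngles K a)ᶜ :=
    closure_mono inter_subset_left (csSup_mem_closure ⟨η, hηZ⟩ hbdd)
  have h0 : θ₀ ∈ starAngles K a := by
    rcases hle.eq_or_lt with he | hlt
    · rwa [he]
    · rw [← (isClosed_starAngles hK a).closure_eq]
      refine closure_mono hoc ?_
      rw [closure_Ioc hlt.ne]
      exact left_mem_Icc.2 hle
  refine ⟨θ₀, hη.1.trans hη0, hle, fun z hz => ?_, fun s hs => ?_⟩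
  · rcases hz.1.eq_or_lt with he | hlt
    · rwa [← he]
    · exact hoc ⟨hlt, hz.2⟩
  · have hC := starPoint_mem_starCone h0 hs.1
    have hlev := level_starPoint h0 hs.1
    refine mem_frontier_of_mem_closure_compl hK
      ((mem_closedStar_iff_level hC).2 (hlev.trans_le hs.2.le)) (hlev.trans_lt hs.2) ?_
    have hpos := div_pos hs.1 (level_circ_pos h0)
    have hcont : Continuous fun z => a + (s / level K a (a + circ θ₀)) • circ z := by
      have := continuous_circ
      fun_prop
    have : a + (s / level K a (a + circ θ₀)) • circ θ₀ ∈ closure (starCone K a)ᶜ :=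
      map_mem_closure (f := fun z => a + (s / level K a (a + circ θ₀)) • circ z) hcont hcl
        fun z hz hzC => hz ((ray_mem_starCone_iff hpos).1 hzC)
    exact this

/-- A smooth function that vanishes at the ends of the cone is bounded on each curve of constant
level by the integral of its gradient along that curve. -/
theorem enorm_starPoint_sq_le (hK : IsTriangulation K Ω) (hκ : IsShapeRegular K κ) {a : Plane}
    (ha : a ∈ K.vertices) (h : starCone K a ≠ univ) {φ : Plane → ℝ} (hφ : ContDiff ℝ 1 φ)
    (hφ0 : ∀ x ∈ frontier (starDomain K a) ∩ frontier Ω, φ x = 0) {θ₁ : ℝ}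
    (hθ : θ₁ ∈ starAngles K a) {s : ℝ} (hs : s ∈ Ioo (0 : ℝ) 1) :
    ‖φ (starPoint K a s θ₁)‖ₑ ^ 2 ≤ ENNReal.ofReal (2 * Real.pi) *
      ∫⁻ θ in Ioc (θ₁ - 2 * Real.pi) θ₁ ∩ starAngles K a,
        ENNReal.ofReal (((1 + κ / 2) * (s / level K a (a + circ θ))) ^ 2) *
          ‖gradient φ (starPoint K a s θ)‖ₑ ^ 2 := by
  have hκ0 := kappa_nonneg hK hκ ha
  obtain ⟨θ₀, h1, h2, h3, h4⟩ := exists_angle_on_frontier hK ha h hθ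
  set q : ℝ → ℝ := fun θ => (1 + κ / 2) * (s / level K a (a + circ θ)) with hq
  have hq0 : ∀ θ ∈ starAngles K a, 0 < q θ := fun θ hθ => by
    have := level_circ_pos hθ
    have := hs.1
    simp only [hq]
    positivity
  set m : ℝ → ℝ := fun θ => q θ * ‖gradient φ (starPoint K a s θ)‖ with hm
  have hlc : ContinuousOn (fun θ => level K a (a + circ θ)) (starAngles K a) :=
    (continuousOn_level hK a).comp (continuous_circ.const_add a).continuousOn fun _ h => h
  have hpc := continuousOn_starPoint hK a s
  have hmc : ContinuousOn m (Icc θ₀ θ₁) := by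
    refine (ContinuousOn.mul ?_ ?_).mono h3
    · exact continuousOn_const.mul
        (continuousOn_const.div hlc fun θ hθ => (level_circ_pos hθ).ne')
    · exact ((continuous_gradient hφ).norm.comp_continuousOn hpc)
  have key := norm_sub_le_integral_of_slope h2 (h := fun θ => φ (starPoint K a s θ)) (m := m)
    (hφ.continuous.comp_continuousOn (hpc.mono h3)) hmc ?_
  · rw [hφ0 _ (h4 s hs), sub_zero] at key
    have hm0 : ∀ θ ∈ Icc θ₀ θ₁, 0 ≤ m θ := fun θ hθ =>
      mul_nonneg (hq0 θ (h3 hθ)).le (norm_nonneg _)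
    have hmi : IntegrableOn m (Ioc θ₀ θ₁) :=
      (hmc.integrableOn_compact isCompact_Icc).mono_set Ioc_subset_Icc_self
    rw [intervalIntegral.integral_of_le h2] at key
    have key2 : ‖φ (starPoint K a s θ₁)‖ₑ ≤ ∫⁻ θ in Ioc θ₀ θ₁, ENNReal.ofReal (m θ) := by
      rw [← ofReal_integral_eq_lintegral_ofReal hmi ((ae_restrict_iff' measurableSet_Ioc).2
        (Eventually.of_forall fun θ hθ => hm0 θ (Ioc_subset_Icc_self hθ))), ← ofReal_norm]
      exact ENNReal.ofReal_le_ofReal key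
    calc ‖φ (starPoint K a s θ₁)‖ₑ ^ 2 ≤ (∫⁻ θ in Ioc θ₀ θ₁, ENNReal.ofReal (m θ)) ^ 2 := by
          gcongr
      _ ≤ volume (Ioc θ₀ θ₁) * ∫⁻ θ in Ioc θ₀ θ₁, ENNReal.ofReal (m θ) ^ 2 := by
          refine (sq_lintegral_le _ hmi.aestronglyMeasurable.aemeasurable.ennreal_ofReal).trans ?_
          rw [Measure.restrict_apply_univ]
      _ ≤ ENNReal.ofReal (2 * Real.pi) *
            ∫⁻ θ in Ioc (θ₁ - 2 * Real.pi) θ₁ ∩ starAngles K a, ENNReal.ofReal (m θ) ^ 2 := by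
          rw [Real.volume_Ioc]
          gcongr
          · linarith
          · exact fun θ hθ => ⟨⟨h1.trans_lt hθ.1, hθ.2⟩, h3 (Ioc_subset_Icc_self hθ)⟩
      _ = _ := by
          congr 1
          refine setLIntegral_congr_fun
            (measurableSet_Ioc.inter (isClosed_starAngles hK a).measurableSet) fun θ hθ => ?_
          simp only [hm]
          rw [ENNReal.ofReal_mul (hq0 θ hθ.2).le, mul_pow, ofReal_norm,
            ENNReal.ofReal_pow (hq0 θ hθ.2).le]
  · intro θ hθ' r hr
    have hA := h3 (Ico_subset_Icc_self hθ')
    have hqθ := hq0 θ hA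
    set ε := r / q θ - ‖gradient φ (starPoint K a s θ)‖ with hε
    have hε0 : 0 < ε := by
      rw [hε, sub_pos, lt_div_iff₀ hqθ, mul_comm]
      exact hr
    have hd := ((hφ.differentiable one_ne_zero) (starPoint K a s θ)).hasFDerivAt
    have ho := hd.isLittleO.def hε0
    have hcw : Tendsto (starPoint K a s) (𝓝[starAngles K a] θ) (𝓝 (starPoint K a s θ)) := hpc θ hA
    have hIoo : ∀ᶠ z in 𝓝[>] θ, z ∈ starAngles K a := by
      filter_upwards [Ioo_mem_nhdsGT hθ'.2] with z hz
      exact h3 ⟨hθ'.1.trans hz.1.le, hz.2.le⟩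
    have hle : 𝓝[>] θ ≤ 𝓝[starAngles K a] θ :=
      le_inf nhdsWithin_le_nhds (le_principal_iff.2 hIoo)
    filter_upwards [(hcw.mono_left hle).eventually ho, hIoo, self_mem_nhdsWithin,
      (eventually_starPoint_sub_le hK hκ hs.1 hA).filter_mono nhdsWithin_le_nhds]
      with z hz1 hz2 hz3 hz4
    have hz5 := hz4 hz2
    rw [abs_of_pos (sub_pos.2 hz3)] at hz5
    set w := starPoint K a s z - starPoint K a s θ
    set D := fderiv ℝ φ (starPoint K a s θ) with hD
    calc ‖φ (starPoint K a s z) - φ (starPoint K a s θ)‖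
        ≤ ‖φ (starPoint K a s z) - φ (starPoint K a s θ) - D w‖ + ‖D w‖ := by
          simpa using norm_add_le (φ (starPoint K a s z) - φ (starPoint K a s θ) - D w) (D w)
      _ ≤ ε * ‖w‖ + ‖D‖ * ‖w‖ := add_le_add hz1 (D.le_opNorm w)
      _ = (r / q θ) * ‖w‖ := by
          rw [hε, norm_gradient]
          ring
      _ ≤ (r / q θ) * (q θ * (z - θ)) := by
          have : 0 ≤ r / q θ := by
            have : 0 ≤ m θ := mul_nonneg hqθ.le (norm_nonneg _)
            exact div_nonneg (this.trans hr.le) hqθ.le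
          gcongr
      _ = r * (z - θ) := by
          field_simp

/-- The interval is covered by two periods that end at `-π` and at `π`. -/
theorem lintegral_Ioc_le_of_periodic {f : ℝ → ℝ≥0∞} (hf : ∀ θ, f (θ + 2 * Real.pi) = f θ) {η : ℝ}
    (hη : η ∈ Ioo (-Real.pi) Real.pi) :
    ∫⁻ θ in Ioc (η - 2 * Real.pi) η, f θ ≤ 2 * ∫⁻ θ in Ioo (-Real.pi) Real.pi, f θ := by
  have hsub : Ioc (η - 2 * Real.pi) η ⊆
      Ioc (-Real.pi - 2 * Real.pi) (Real.pi - 2 * Real.pi) ∪ Ioc (-Real.pi) Real.pi := by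
    intro θ hθ
    rcases le_or_gt θ (-Real.pi) with h | h
    · exact Or.inl ⟨by linarith [hθ.1, hη.1], by linarith⟩
    · exact Or.inr ⟨h, by linarith [hθ.2, hη.2]⟩
  have hshift : ∫⁻ θ in Ioc (-Real.pi - 2 * Real.pi) (Real.pi - 2 * Real.pi), f θ =
      ∫⁻ θ in Ioc (-Real.pi) Real.pi, f θ := by
    rw [← lintegral_indicator measurableSet_Ioc, ← lintegral_indicator measurableSet_Ioc,
      ← lintegral_sub_right_eq_self _ (2 * Real.pi)]
    refine lintegral_congr fun θ => ?_
    have hf' : f (θ - 2 * Real.pi) = f θ := by rw [← hf, sub_add_cancel]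
    by_cases h : θ ∈ Ioc (-Real.pi) Real.pi
    · rw [indicator_of_mem h, indicator_of_mem, hf']
      exact ⟨by linarith [h.1], by linarith [h.2]⟩
    · rw [indicator_of_notMem h, indicator_of_notMem]
      exact fun h' => h ⟨by linarith [h'.1], by linarith [h'.2]⟩
  calc _ ≤ _ := lintegral_mono_set hsub
    _ ≤ _ := lintegral_union_le _ _ _
    _ = _ := by rw [hshift, Measure.restrict_congr_set Ioo_ae_eq_Ioc, two_mul]

/-- Hardy's inequality on the star of a boundary vertex. Because of the scale invariance, neither
the sizes of the triangles nor their number enters in the constant. -/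
theorem hardy_closedStar (hK : IsTriangulation K Ω) (hκ : IsShapeRegular K κ) {a : Plane}
    (ha : a ∈ K.vertices) (h : starCone K a ≠ univ) {φ : Plane → ℝ} (hφ : ContDiff ℝ 1 φ)
    (hφ0 : ∀ x ∈ frontier (starDomain K a) ∩ frontier Ω, φ x = 0) :
    ∫⁻ x in closedStar K a, ENNReal.ofReal ((φ x / ‖x - a‖) ^ 2) ≤
      ENNReal.ofReal (8 * Real.pi ^ 2 * (1 + κ / 2) ^ 2) *
        ∫⁻ x in closedStar K a, ‖gradient φ x‖ₑ ^ 2 := by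
  have hκ0 := kappa_nonneg hK hκ ha
  have hAm := (isClosed_starAngles hK a).measurableSet
  have hgm := measurable_gradient_sq φ
  have hm1 : Measurable fun x => ENNReal.ofReal ((φ x / ‖x - a‖) ^ 2) :=
    ((hφ.continuous.measurable.div (measurable_id.sub_const a).norm).pow_const 2).ennreal_ofReal
  set L := 1 + κ / 2 with hL
  set A := Ioo (-Real.pi) Real.pi ∩ starAngles K a with hA
  set g : ℝ → ℝ := fun θ => level K a (a + circ θ) with hg
  set G : ℝ → ℝ → ℝ≥0∞ := fun s θ =>
    ENNReal.ofReal (s / g θ ^ 2) * ‖gradient φ (starPoint K a s θ)‖ₑ ^ 2 with hG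
  have hgmeas : Measurable g :=
    (measurable_level hK a).comp (continuous_circ.measurable.const_add a)
  have hGm : Measurable fun p : ℝ × ℝ => G p.1 p.2 :=
    (measurable_fst.div ((hgmeas.comp measurable_snd).pow_const 2)).ennreal_ofReal.mul
      (hgm.comp (measurable_starPoint hK a))
  -- the bound along the curve of level `s`, written in terms of the density `G`
  have hpt : ∀ θ₁ ∈ A, ∀ s ∈ Ioo (0 : ℝ) 1,
      ENNReal.ofReal (s / g θ₁ ^ 2) * ENNReal.ofReal ((φ (starPoint K a s θ₁) /
        ‖starPoint K a s θ₁ - a‖) ^ 2) ≤ ENNReal.ofReal (4 * Real.pi * L ^ 2) * ∫⁻ θ in A, G s θ := by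
    intro θ₁ hθ₁ s hs
    have hg0 : 0 < g θ₁ := level_circ_pos hθ₁.2
    have hs0 : 0 < s := hs.1
    have hn : ‖starPoint K a s θ₁ - a‖ = s / g θ₁ := by
      rw [starPoint, add_sub_cancel_left, norm_smul, norm_circ, mul_one, Real.norm_of_nonneg]
      positivity
    have e1 : ENNReal.ofReal (s / g θ₁ ^ 2) * ENNReal.ofReal ((φ (starPoint K a s θ₁) /
        ‖starPoint K a s θ₁ - a‖) ^ 2) =
        ENNReal.ofReal s⁻¹ * ‖φ (starPoint K a s θ₁)‖ₑ ^ 2 := by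
      rw [← ofReal_norm, ← ENNReal.ofReal_pow (norm_nonneg _),
        ← ENNReal.ofReal_mul (by positivity), ← ENNReal.ofReal_mul (by positivity), hn,
        Real.norm_eq_abs, sq_abs]
      congr 1
      field_simp
    have e2 : ∀ θ ∈ starAngles K a, ENNReal.ofReal s⁻¹ * (ENNReal.ofReal ((L * (s / g θ)) ^ 2) *
        ‖gradient φ (starPoint K a s θ)‖ₑ ^ 2) = ENNReal.ofReal (L ^ 2) * G s θ := by
      intro θ hθ
      have : 0 < g θ := level_circ_pos hθ
      simp only [hG]
      rw [← mul_assoc, ← mul_assoc, ← ENNReal.ofReal_mul (by positivity),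
        ← ENNReal.ofReal_mul (by positivity)]
      congr 2
      field_simp
    have hper : ∀ θ, (starAngles K a).indicator (G s) (θ + 2 * Real.pi) =
        (starAngles K a).indicator (G s) θ := by
      intro θ
      have hmem : θ + 2 * Real.pi ∈ starAngles K a ↔ θ ∈ starAngles K a := by
        change a + circ (θ + 2 * Real.pi) ∈ starCone K a ↔ a + circ θ ∈ starCone K a
        rw [circ_add_two_pi]
      by_cases hθ : θ ∈ starAngles K a
      · rw [indicator_of_mem hθ, indicator_of_mem (hmem.2 hθ)]
        simp only [hG, hg, starPoint, circ_add_two_pi]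
      · rw [indicator_of_notMem hθ, indicator_of_notMem fun h => hθ (hmem.1 h)]
    have hA' : ∀ I : Set ℝ, ∫⁻ θ in I ∩ starAngles K a, G s θ =
        ∫⁻ θ in I, (starAngles K a).indicator (G s) θ := fun I => by
      rw [lintegral_indicator hAm, Measure.restrict_restrict hAm, inter_comm]
    calc _ = ENNReal.ofReal s⁻¹ * ‖φ (starPoint K a s θ₁)‖ₑ ^ 2 := e1
      _ ≤ ENNReal.ofReal s⁻¹ * (ENNReal.ofReal (2 * Real.pi) *
            ∫⁻ θ in Ioc (θ₁ - 2 * Real.pi) θ₁ ∩ starAngles K a,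
              ENNReal.ofReal ((L * (s / g θ)) ^ 2) * ‖gradient φ (starPoint K a s θ)‖ₑ ^ 2) := by
          gcongr
          exact enorm_starPoint_sq_le hK hκ ha h hφ hφ0 hθ₁.2 hs
      _ = ENNReal.ofReal (2 * Real.pi) * ∫⁻ θ in Ioc (θ₁ - 2 * Real.pi) θ₁ ∩ starAngles K a,
            ENNReal.ofReal (L ^ 2) * G s θ := by
          rw [mul_left_comm, ← lintegral_const_mul' _ _ ENNReal.ofReal_ne_top]
          congr 1
          exact setLIntegral_congr_fun (measurableSet_Ioc.inter hAm) fun θ hθ => e2 θ hθ.2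
      _ = ENNReal.ofReal (2 * Real.pi) * (ENNReal.ofReal (L ^ 2) *
            ∫⁻ θ in Ioc (θ₁ - 2 * Real.pi) θ₁, (starAngles K a).indicator (G s) θ) := by
          rw [lintegral_const_mul' _ _ ENNReal.ofReal_ne_top, hA']
      _ ≤ ENNReal.ofReal (2 * Real.pi) * (ENNReal.ofReal (L ^ 2) *
            (2 * ∫⁻ θ in Ioo (-Real.pi) Real.pi, (starAngles K a).indicator (G s) θ)) := by
          gcongr
          exact lintegral_Ioc_le_of_periodic hper hθ₁.1
      _ = _ := by
          rw [← hA', ← hA, show (4 : ℝ) * Real.pi * L ^ 2 = 2 * Real.pi * (L ^ 2 * 2) by ring,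
            ENNReal.ofReal_mul (p := 2 * Real.pi) (by positivity),
            ENNReal.ofReal_mul (p := L ^ 2) (by positivity), ENNReal.ofReal_ofNat]
          ring
  rw [lintegral_closedStar hK a hm1, lintegral_closedStar hK a hgm]
  calc _ ≤ ∫⁻ _ in A, ∫⁻ s in Ioo (0 : ℝ) 1,
        ENNReal.ofReal (4 * Real.pi * L ^ 2) * ∫⁻ θ in A, G s θ := by
        exact setLIntegral_mono' (measurableSet_Ioo.inter hAm) fun θ₁ hθ₁ =>
          setLIntegral_mono' measurableSet_Ioo fun s hs => hpt θ₁ hθ₁ s hs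
    _ = (ENNReal.ofReal (4 * Real.pi * L ^ 2) * ∫⁻ θ in A, ∫⁻ s in Ioo (0 : ℝ) 1, G s θ) *
          volume A := by
        rw [lintegral_const, Measure.restrict_apply_univ,
          lintegral_const_mul' _ _ ENNReal.ofReal_ne_top,
          lintegral_lintegral_swap hGm.aemeasurable]
    _ ≤ (ENNReal.ofReal (4 * Real.pi * L ^ 2) * ∫⁻ θ in A, ∫⁻ s in Ioo (0 : ℝ) 1, G s θ) *
          ENNReal.ofReal (2 * Real.pi) := by
        gcongr
        refine (measure_mono inter_subset_left).trans (le_of_eq ?_)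
        rw [Real.volume_Ioo]
        congr 1
        ring
    _ = _ := by
        rw [mul_right_comm, ← ENNReal.ofReal_mul (by positivity)]
        congr 2
        ring

/-! ### Multiplication by a hat function -/

theorem measurable_hat (hK : IsTriangulation K Ω) (a : Plane) : Measurable (hat K a) := by
  classical
  have h : hat K a = (closedStar K a).indicator fun x => 1 - level K a x := by
    ext x
    by_cases hx : x ∈ closedStar K a
    · rw [indicator_of_mem hx, hat_of_mem_closedStar hx]
    · rw [indicator_of_notMem hx, hat_of_notMem_closedStar hK hx]
  rw [h]
  exact ((measurable_level hK a).const_sub 1).indicator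
    (hK.isCompact_closedStar a).isClosed.measurableSet

theorem norm_hat_le_one (hK : IsTriangulation K Ω) (a x : Plane) : ‖hat K a x‖ ≤ 1 := by
  rw [Real.norm_of_nonneg (hat_nonneg hK a x)]
  exact hat_le_one hK a x

theorem ae_mem_starDomain_of_mem_closedStar (hK : IsTriangulation K Ω) (a : Plane) :
    ∀ᵐ x : Plane, x ∈ closedStar K a → x ∈ starDomain K a := by
  have h := volume_closedStar_diff hK a
  rw [← compl_mem_ae_iff] at h
  filter_upwards [h] with x hx hxa
  by_contra hn
  exact hx ⟨hxa, hn⟩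

theorem ae_hat_eq_zero (hK : IsTriangulation K Ω) (a : Plane) :
    ∀ᵐ x : Plane, x ∉ starDomain K a → hat K a x = 0 := by
  filter_upwards [ae_mem_starDomain_of_mem_closedStar hK a] with x hx hn
  exact hat_of_notMem_closedStar hK fun h => hn (hx h)

theorem exists_norm_gradient_hat_le (hK : IsTriangulation K Ω) (a : Plane) :
    ∃ L : ℝ, 0 ≤ L ∧ ∀ x ∈ Ω, ‖gradient (hat K a) x‖ ≤ L := by
  obtain ⟨L, hL0, hL⟩ := exists_lipschitz_triCoord hK a
  refine ⟨L, hL0, fun x hx => ?_⟩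
  rw [norm_gradient]
  refine norm_fderiv_le_of_lip' ℝ hL0 ?_
  filter_upwards [eventually_abs_hat_sub_le hK hL x, hK.isOpen.mem_nhds hx] with y hy hyΩ
  exact hy (hK.subset_space hyΩ)

theorem mem_frontier_inter_of_mem_closedStar (hK : IsTriangulation K Ω) {a x : Plane}
    (hx : x ∈ closedStar K a) (hxΩ : x ∉ Ω) : x ∈ frontier (starDomain K a) ∩ frontier Ω := by
  rw [(isOpen_starDomain a).frontier_eq, hK.isOpen.frontier_eq]
  exact ⟨⟨closedStar_subset_closure a hx, fun h => hxΩ (starDomain_subset hK a h)⟩,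
    hK.space_subset_closure (closedStar_subset_space hx), hxΩ⟩

/-- The product of a hat function with a smooth function that vanishes near `∂ω_a ∩ ∂Ω` is Lipschitz
continuous on the whole plane and compactly supported in `Ω`. -/
theorem hat_mul_testFunction (hK : IsTriangulation K Ω) {a : Plane} {φ : Plane → ℝ}
    (hφ : IsTestFunction (frontier (starDomain K a) ∩ frontier Ω)ᶜ φ) :
    (∃ C, LipschitzWith C fun x => hat K a x * φ x) ∧
      (HasCompactSupport fun x => hat K a x * φ x) ∧ tsupport (fun x => hat K a x * φ x) ⊆ Ω := by
  have hts : tsupport (fun x => hat K a x * φ x) ⊆ closedStar K a ∩ tsupport φ := by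
    refine closure_minimal (fun x hx => ⟨?_, subset_tsupport _ (right_ne_zero_of_mul hx)⟩)
      ((hK.isCompact_closedStar a).isClosed.inter (isClosed_tsupport φ))
    by_contra hn
    exact hx (by simp [hat_of_notMem_closedStar hK hn])
  refine ⟨?_, hφ.2.1.mono' (fun x hx => subset_tsupport _ (right_ne_zero_of_mul hx)), fun x hx => ?_⟩
  · obtain ⟨L, hL0, hL⟩ := exists_lipschitz_triCoord hK a
    obtain ⟨D, hD⟩ := hφ.lipschitz
    obtain ⟨B, hB⟩ := exists_bound_of_hasCompactSupport hφ.continuous hφ.2.1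
    refine ⟨D + B * L.toNNReal, lipschitzWith_of_eventually fun x => ?_⟩
    by_cases hx : x ∈ tsupport φ
    · have hev : ∀ᶠ y in 𝓝 x, |hat K a y - hat K a x| ≤ L * ‖y - x‖ := by
        by_cases hxΩ : x ∈ Ω
        · filter_upwards [eventually_abs_hat_sub_le hK hL x, hK.isOpen.mem_nhds hxΩ] with y hy hyΩ
          exact hy (hK.subset_space hyΩ)
        · have h0 : hat K a x = 0 := hat_of_notMem_closedStar hK fun h =>
            hφ.2.2 hx (mem_frontier_inter_of_mem_closedStar hK h hxΩ)
          filter_upwards [eventually_abs_hat_sub_le hK hL x] with y hy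
          by_cases hyK : y ∈ K.space
          · exact hy hyK
          · rw [hat_of_notMem_space hyK, h0, sub_zero, abs_zero]
            positivity
      filter_upwards [hev] with y hy
      have h1 : |φ y - φ x| ≤ D * ‖y - x‖ := by simpa [dist_eq_norm] using hD.dist_le_mul y x
      have h2 : |hat K a y| ≤ 1 := norm_hat_le_one hK a y
      calc |hat K a y * φ y - hat K a x * φ x|
          = |hat K a y * (φ y - φ x) + φ x * (hat K a y - hat K a x)| := by ring_nf
        _ ≤ |hat K a y| * |φ y - φ x| + |φ x| * |hat K a y - hat K a x| := by
            rw [← abs_mul, ← abs_mul]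
            exact abs_add_le _ _
        _ ≤ 1 * (D * ‖y - x‖) + B * (L * ‖y - x‖) := by
            gcongr
            exact hB x
        _ = _ := by
            rw [NNReal.coe_add, NNReal.coe_mul, Real.coe_toNNReal _ hL0]
            ring
    · filter_upwards [notMem_tsupport_iff_eventuallyEq.1 hx] with y hy
      rw [hy, image_eq_zero_of_notMem_tsupport hx]
      simp only [Pi.zero_apply, mul_zero, sub_self, abs_zero]
      positivity
  · by_contra hxΩ
    exact hφ.2.2 (hts hx).2 (mem_frontier_inter_of_mem_closedStar hK (hts hx).1 hxΩ)

/-- The weak gradient of `ψ_a v`, where `g` is the weak gradient of `v` on `ω_a`. -/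
noncomputable def hatMulGrad (K : Geometry.SimplicialComplex ℝ Plane) (a : Plane) (v : Plane → ℝ)
    (g : Plane → Plane) : Plane → Plane :=
  (starDomain K a).indicator fun x => hat K a x • g x + v x • gradient (hat K a) x

theorem hasWeakGrad_hat_mul_testFunction (hK : IsTriangulation K Ω) {a : Plane} {φ : Plane → ℝ}
    (hφ : IsTestFunction (frontier (starDomain K a) ∩ frontier Ω)ᶜ φ) :
    HasWeakGrad Ω (fun x => hat K a x * φ x) (hatMulGrad K a φ (gradient φ)) := by
  obtain ⟨⟨C, hC⟩, hc, -⟩ := hat_mul_testFunction hK hφ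
  refine ((hasWeakGrad_of_lipschitz hC hc).mono (subset_univ Ω)).congr (ae_eq_refl _) ?_
  have h1 := (ae_restrict_iff' (isOpen_starDomain a).measurableSet).1 (ae_differentiableAt_hat hK a)
  refine ae_restrict_of_ae ?_
  filter_upwards [h1, ae_mem_starDomain_of_mem_closedStar hK a] with x hx1 hx2
  by_cases hx : x ∈ starDomain K a
  · rw [hatMulGrad, indicator_of_mem hx,
      gradient_mul_apply (hx1 hx) (hφ.contDiff_one.differentiable one_ne_zero x)]
  · rw [hatMulGrad, indicator_of_notMem hx]
    refine gradient_eq_zero_of_notMem fun h => hx (hx2 ?_)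
    refine closure_minimal (fun y hy => ?_) (hK.isCompact_closedStar a).isClosed h
    by_contra hn
    exact hy (by simp [hat_of_notMem_closedStar hK hn])

theorem memL2_indicator {F : Type*} [NormedAddCommGroup F] {ω Ω : Set Plane} (hω : IsOpen ω)
    (hs : ω ⊆ Ω) {g : Plane → F} (h : MemL2 ω g) : MemL2 Ω (ω.indicator g) := by
  unfold MemL2
  rw [memLp_indicator_iff_restrict hω.measurableSet, Measure.restrict_restrict_of_subset hs]
  exact h

theorem normL2_indicator {F : Type*} [NormedAddCommGroup F] {ω Ω : Set Plane} (hω : IsOpen ω)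
    (hs : ω ⊆ Ω) (g : Plane → F) : normL2 Ω (ω.indicator g) = normL2 ω g := by
  unfold normL2
  rw [eLpNorm_indicator_eq_eLpNorm_restrict hω.measurableSet,
    Measure.restrict_restrict_of_subset hs]

theorem memL2_hat_smul {F : Type*} [NormedAddCommGroup F] [NormedSpace ℝ F]
    (hK : IsTriangulation K Ω) (a : Plane) {ω : Set Plane} {g : Plane → F} (h : MemL2 ω g) :
    MemL2 ω fun x => hat K a x • g x := by
  refine MemLp.of_le h ((measurable_hat hK a).aestronglyMeasurable.smul h.1)
    (Eventually.of_forall fun x => ?_)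
  rw [norm_smul]
  exact mul_le_of_le_one_left (norm_nonneg _) (norm_hat_le_one hK a x)

theorem normL2_hat_smul_le {F : Type*} [NormedAddCommGroup F] [NormedSpace ℝ F]
    (hK : IsTriangulation K Ω) (a : Plane) (ω : Set Plane) (g : Plane → F) :
    normL2 ω (fun x => hat K a x • g x) ≤ normL2 ω g := by
  refine eLpNorm_mono fun x => ?_
  rw [norm_smul]
  exact mul_le_of_le_one_left (norm_nonneg _) (norm_hat_le_one hK a x)

theorem aestronglyMeasurable_smul_gradient_hat {a : Plane} {ω : Set Plane} {v : Plane → ℝ}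
    (h : MemL2 ω v) :
    AEStronglyMeasurable (fun x => v x • gradient (hat K a) x) (volume.restrict ω) :=
  h.1.smul (measurable_gradient _).aestronglyMeasurable

theorem normL2_smul_gradient_hat_le {a : Plane} {L : ℝ}
    {ω : Set Plane} (hω : MeasurableSet ω) (hL : ∀ x ∈ ω, ‖gradient (hat K a) x‖ ≤ L)
    (v : Plane → ℝ) :
    normL2 ω (fun x => v x • gradient (hat K a) x) ≤ ENNReal.ofReal L * normL2 ω v := by
  refine normL2_le_of_eq_zero_off hω ?_ ?_
  · exact (ae_restrict_iff' hω).2 (Eventually.of_forall fun x hx hn => absurd hx hn)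
  · refine (ae_restrict_iff' hω).2 (Eventually.of_forall fun x hx => ?_)
    rw [norm_smul, mul_comm]
    exact mul_le_mul_of_nonneg_right (hL x hx) (norm_nonneg _)

theorem memL2_hatMulGrad_aux (hK : IsTriangulation K Ω) {a : Plane} {v : Plane → ℝ}
    {g : Plane → Plane} (hv : MemL2 (starDomain K a) v) (hg : MemL2 (starDomain K a) g) :
    MemL2 (starDomain K a) fun x => hat K a x • g x + v x • gradient (hat K a) x := by
  obtain ⟨L, hL0, hL⟩ := exists_norm_gradient_hat_le hK a
  refine (memL2_hat_smul hK a hg).add ⟨aestronglyMeasurable_smul_gradient_hat hv, ?_⟩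
  refine (normL2_smul_gradient_hat_le (isOpen_starDomain a).measurableSet
    (fun x hx => hL x (starDomain_subset hK a hx)) v).trans_lt ?_
  exact ENNReal.mul_lt_top ENNReal.ofReal_lt_top hv.2

theorem memL2_hat_mul (hK : IsTriangulation K Ω) {a : Plane} {v : Plane → ℝ}
    (hv : MemL2 (starDomain K a) v) : MemL2 Ω fun x => hat K a x * v x := by
  refine (memLp_congr_ae ?_).1
    (memL2_indicator (isOpen_starDomain a) (starDomain_subset hK a) (memL2_hat_smul hK a hv))
  refine ae_restrict_of_ae ?_
  filter_upwards [ae_hat_eq_zero hK a] with x hx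
  by_cases h : x ∈ starDomain K a
  · rw [indicator_of_mem h, smul_eq_mul]
  · rw [indicator_of_notMem h, hx h, zero_mul]

theorem normL2_hatMulGrad_le (hK : IsTriangulation K Ω) {a : Plane} {v : Plane → ℝ}
    {g : Plane → Plane} (hv : MemL2 (starDomain K a) v) (hg : MemL2 (starDomain K a) g) :
    normL2 Ω (hatMulGrad K a v g) ≤
      normL2 (starDomain K a) g + normL2 (starDomain K a) (fun x => v x • gradient (hat K a) x) := by
  rw [hatMulGrad, normL2_indicator (isOpen_starDomain a) (starDomain_subset hK a)]
  refine (eLpNorm_add_le (memL2_hat_smul hK a hg).1 (aestronglyMeasurable_smul_gradient_hat hv)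
    (by norm_num)).trans ?_
  exact add_le_add (normL2_hat_smul_le hK a _ g) le_rfl

/-- An estimate of one `L²` norm by another one passes to the limit. -/
theorem normL2_le_of_tendsto {F G : Type*} [NormedAddCommGroup F] [NormedAddCommGroup G]
    {P : Set Plane} {C : ℝ≥0∞} (hC : C ≠ ⊤) {f : Plane → F} {g : Plane → G} {fn : ℕ → Plane → F}
    {gn : ℕ → Plane → G} (hf : AEStronglyMeasurable f (volume.restrict P))
    (hfn : ∀ n, AEStronglyMeasurable (fn n) (volume.restrict P))
    (hg : AEStronglyMeasurable g (volume.restrict P))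
    (hgn : ∀ n, AEStronglyMeasurable (gn n) (volume.restrict P))
    (h1 : Tendsto (fun n => normL2 P (fun x => f x - fn n x)) atTop (𝓝 0))
    (h2 : Tendsto (fun n => normL2 P (fun x => g x - gn n x)) atTop (𝓝 0))
    (hle : ∀ n, normL2 P (fn n) ≤ C * normL2 P (gn n)) : normL2 P f ≤ C * normL2 P g := by
  have hlim : Tendsto (fun n => normL2 P (fun x => f x - fn n x) +
      C * (normL2 P g + normL2 P (fun x => g x - gn n x))) atTop
      (𝓝 (0 + C * (normL2 P g + 0))) :=
    h1.add (ENNReal.Tendsto.const_mul (tendsto_const_nhds.add h2) (Or.inr hC))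
  rw [zero_add, add_zero] at hlim
  refine ge_of_tendsto hlim (Eventually.of_forall fun n => ?_)
  have e1 : normL2 P f ≤ normL2 P (fun x => f x - fn n x) + normL2 P (fn n) := by
    have := eLpNorm_add_le (hf.sub (hfn n)) (hfn n) (p := 2) (by norm_num)
    rwa [sub_add_cancel] at this
  have e2 : normL2 P (gn n) ≤ normL2 P g + normL2 P (fun x => g x - gn n x) := by
    have := eLpNorm_sub_le hg (hg.sub (hgn n)) (p := 2) (by norm_num)
    rwa [sub_sub_cancel] at this
  calc normL2 P f ≤ _ := e1
    _ ≤ _ := by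
      gcongr
      exact (hle n).trans (by gcongr)

/-- Hardy's inequality controls the critical term of the product rule at a boundary vertex. -/
theorem normL2_testFunction_smul_gradient_hat_le (hK : IsTriangulation K Ω)
    (hκ : IsShapeRegular K κ) {a : Plane} (ha : a ∈ K.vertices) (h : starCone K a ≠ univ)
    {φ : Plane → ℝ} (hφ : IsTestFunction (frontier (starDomain K a) ∩ frontier Ω)ᶜ φ) :
    normL2 (starDomain K a) (fun x => φ x • gradient (hat K a) x) ≤
      ENNReal.ofReal (κ / 2 * (9 * (1 + κ / 2))) * normL2 (starDomain K a) (gradient φ) := by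
  have hκ0 := kappa_nonneg hK hκ ha
  have hm := (isOpen_starDomain (K := K) a).measurableSet
  have haΩ : a ∉ Ω := fun h' => h ((starCone_eq_univ_iff hK ha).2 h')
  have h1 : normL2 (starDomain K a) (fun x => φ x • gradient (hat K a) x) ≤
      ENNReal.ofReal (κ / 2) * normL2 (starDomain K a) (fun x => φ x / ‖x - a‖) := by
    refine normL2_le_of_eq_zero_off hm ?_ ?_
    · exact (ae_restrict_iff' hm).2 (Eventually.of_forall fun x hx hn => absurd hx hn)
    · refine (ae_restrict_iff' hm).2 (Eventually.of_forall fun x hx => ?_)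
      have hxa : 0 < ‖x - a‖ := norm_pos_iff.2 (sub_ne_zero.2 fun h' =>
        haΩ (h' ▸ starDomain_subset hK a hx))
      have hxS : x ∈ closedStar K a := interior_subset hx
      have hlev := (mem_closedStar_iff_level (closedStar_subset_starCone hxS)).1 hxS
      have hg : ‖gradient (hat K a) x‖ ≤ κ / 2 / ‖x - a‖ := by
        rw [le_div_iff₀ hxa]
        exact (norm_gradient_hat_le hK hκ ha hx).trans (mul_le_of_le_one_right (by positivity) hlev)
      calc ‖φ x • gradient (hat K a) x‖ = ‖φ x‖ * ‖gradient (hat K a) x‖ := norm_smul _ _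
        _ ≤ ‖φ x‖ * (κ / 2 / ‖x - a‖) := by gcongr
        _ = _ := by
          rw [norm_div, norm_norm]
          ring
  have hΓ : ∀ x ∈ frontier (starDomain K a) ∩ frontier Ω, φ x = 0 := fun x hx =>
    image_eq_zero_of_notMem_tsupport fun hx' => hφ.2.2 hx' hx
  have hH := hardy_closedStar hK hκ ha h hφ.contDiff_one hΓ
  have hae : (closedStar K a : Set Plane) =ᵐ[volume] starDomain K a := by
    refine (ae_le_set.2 (volume_closedStar_diff hK a)).antisymm ?_
    exact (interior_subset : interior (closedStar K a) ⊆ _).eventuallyLE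
  rw [Measure.restrict_congr_set hae] at hH
  have h2 : normL2 (starDomain K a) (fun x => φ x / ‖x - a‖) ≤
      ENNReal.ofReal (9 * (1 + κ / 2)) * normL2 (starDomain K a) (gradient φ) := by
    rw [← ENNReal.pow_le_pow_left_iff two_ne_zero, mul_pow, normL2, normL2, eLpNorm_two_sq,
      eLpNorm_two_sq]
    calc _ = ∫⁻ x in starDomain K a, ENNReal.ofReal ((φ x / ‖x - a‖) ^ 2) := by
          refine lintegral_congr fun x => ?_
          rw [← ofReal_norm, ← ENNReal.ofReal_pow (norm_nonneg _), Real.norm_eq_abs, sq_abs]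
      _ ≤ _ := hH
      _ ≤ _ := by
        rw [← ENNReal.ofReal_pow (by positivity)]
        gcongr
        rw [mul_pow]
        -- `8 π² ≤ 9²`
        have hpi : Real.pi < 3.15 := Real.pi_lt_d2
        have := Real.pi_pos
        gcongr
        nlinarith
  calc _ ≤ _ := h1
    _ ≤ ENNReal.ofReal (κ / 2) *
        (ENNReal.ofReal (9 * (1 + κ / 2)) * normL2 (starDomain K a) (gradient φ)) := by gcongr
    _ = _ := by rw [← mul_assoc, ← ENNReal.ofReal_mul (by positivity)]

/-- The stability of the multiplication by the hat function of a boundary vertex. -/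
theorem hat_mul_of_boundary (hK : IsTriangulation K Ω) (hκ : IsShapeRegular K κ) {a : Plane}
    (ha : a ∈ K.vertices) (h : starCone K a ≠ univ) {v : Plane → ℝ}
    (hv : MemH1VanishingOn (starDomain K a) (frontier (starDomain K a) ∩ frontier Ω) v) :
    HasWeakGrad Ω (fun x => hat K a x * v x) (hatMulGrad K a v (weakGrad (starDomain K a) v)) ∧
      MemH10 Ω (fun x => hat K a x * v x) ∧
      normL2 Ω (hatMulGrad K a v (weakGrad (starDomain K a) v)) ≤
        ENNReal.ofReal (1 + κ / 2 * (9 * (1 + κ / 2))) *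
          normL2 (starDomain K a) (weakGrad (starDomain K a) v) := by
  have hκ0 := kappa_nonneg hK hκ ha
  have hsub := starDomain_subset hK a
  have hω := isOpen_starDomain (K := K) a
  obtain ⟨hv1, φ, hφ, hl1, hl2⟩ := hv
  have hg := hv1.hasWeakGrad
  set ω := starDomain K a with hωdef
  set g := weakGrad ω v with hgdef
  obtain ⟨L, hL0, hL⟩ := exists_norm_gradient_hat_le hK a
  have hLω : ∀ x ∈ ω, ‖gradient (hat K a) x‖ ≤ L := fun x hx => hL x (hsub hx)
  have hd1 : ∀ n, MemL2 ω (fun x => v x - φ n x) := fun n => hg.memL2.sub ((hφ n).memLp ω)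
  have hd2 : ∀ n, MemL2 ω (fun x => g x - gradient (φ n) x) := fun n =>
    hg.memL2_grad.sub ((hφ n).memLp_gradient ω)
  have hlim3 : Tendsto (fun n => normL2 ω
      (fun x => v x • gradient (hat K a) x - φ n x • gradient (hat K a) x)) atTop (𝓝 0) := by
    have := ENNReal.Tendsto.const_mul hl1 (Or.inr (ENNReal.ofReal_ne_top (r := L)))
    rw [mul_zero] at this
    refine tendsto_of_tendsto_of_tendsto_of_le_of_le tendsto_const_nhds this (fun _ => zero_le)
      fun n => ?_
    simp only [← sub_smul]
    exact normL2_smul_gradient_hat_le hω.measurableSet hLω _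
  have hbound : normL2 ω (fun x => v x • gradient (hat K a) x) ≤
      ENNReal.ofReal (κ / 2 * (9 * (1 + κ / 2))) * normL2 ω g :=
    normL2_le_of_tendsto ENNReal.ofReal_ne_top (aestronglyMeasurable_smul_gradient_hat hg.memL2)
      (fun n => aestronglyMeasurable_smul_gradient_hat ((hφ n).memLp ω)) hg.memL2_grad.1
      (fun n => ((hφ n).memLp_gradient ω).1) hlim3 hl2
      fun n => normL2_testFunction_smul_gradient_hat_le hK hκ ha h (hφ n)
  have hmain := memH10_of_tendsto hK.isOpen (w := fun x => hat K a x * v x)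
    (g := hatMulGrad K a v g)
    (fun n => hasWeakGrad_hat_mul_testFunction hK (hφ n))
    (fun n => by
      obtain ⟨⟨C, hC⟩, hc, hs⟩ := hat_mul_testFunction hK (hφ n)
      exact memH10_of_lipschitz hK.isOpen hC hc hs)
    (memL2_hat_mul hK hg.memL2) (memL2_indicator hω hsub
      (memL2_hatMulGrad_aux hK hg.memL2 hg.memL2_grad))
    (tendsto_of_tendsto_of_tendsto_of_le_of_le tendsto_const_nhds hl1 (fun _ => zero_le)
      fun n => ?_)
    (tendsto_of_tendsto_of_tendsto_of_le_of_le tendsto_const_nhds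
      (by simpa using hl2.add hlim3) (fun _ => zero_le) fun n => ?_)
  · refine ⟨hmain.1, hmain.2, (normL2_hatMulGrad_le hK hg.memL2 hg.memL2_grad).trans ?_⟩
    rw [ENNReal.ofReal_add zero_le_one (by positivity), ENNReal.ofReal_one, add_mul, one_mul]
    gcongr
  · have := normL2_le_of_eq_zero_off (ω := Ω) (c := 1) hω.measurableSet
      (f := fun x => hat K a x * v x - hat K a x * φ n x) (h := fun x => v x - φ n x) ?_ ?_
    · simpa using this
    · refine ae_restrict_of_ae ?_
      filter_upwards [ae_hat_eq_zero hK a] with x hx hn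
      simp [hx hn]
    · refine Eventually.of_forall fun x => ?_
      rw [← mul_sub, norm_mul]
      gcongr
      exact norm_hat_le_one hK a x
  · have e : (fun x => hatMulGrad K a v g x - hatMulGrad K a (φ n) (gradient (φ n)) x) =
        hatMulGrad K a (fun x => v x - φ n x) (fun x => g x - gradient (φ n) x) := by
      ext1 x
      simp only [hatMulGrad]
      by_cases hx : x ∈ starDomain K a
      · rw [indicator_of_mem hx, indicator_of_mem hx, indicator_of_mem hx]
        module
      · rw [indicator_of_notMem hx, indicator_of_notMem hx, indicator_of_notMem hx, sub_zero]
    rw [e]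
    refine (normL2_hatMulGrad_le hK (hd1 n) (hd2 n)).trans (le_of_eq ?_)
    simp only [sub_smul]
    rfl

/-! ### The star of an interior vertex -/

/-- By shape regularity, the logarithm of the level is Lipschitz continuous along the unit circle
around `a`. -/
theorem level_circ_le (hK : IsTriangulation K Ω) (hκ : IsShapeRegular K κ) {a : Plane}
    (h : starCone K a = univ) {θ η : ℝ} (hle : θ ≤ η) :
    level K a (a + circ η) ≤ Real.exp (κ / 2 * (η - θ)) * level K a (a + circ θ) := by
  set γ : ℝ → ℝ := fun θ => level K a (a + circ θ) with hγ
  have hpos : ∀ θ, 0 < γ θ := fun θ => level_circ_pos (by simp [starAngles, h])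
  have hc : Continuous γ := (continuous_level hK h).comp (continuous_circ.const_add a)
  have key := norm_sub_le_integral_of_slope hle (h := fun θ => Real.log (γ θ))
    (m := fun _ => κ / 2) (hc.log fun θ => (hpos θ).ne').continuousOn continuousOn_const ?_
  · rw [intervalIntegral.integral_const, smul_eq_mul, Real.norm_eq_abs] at key
    have h1 := (le_abs_self _).trans key
    have h2 : Real.log (γ η) ≤ κ / 2 * (η - θ) + Real.log (γ θ) := by linarith
    calc γ η = Real.exp (Real.log (γ η)) := (Real.exp_log (hpos η)).symm
      _ ≤ Real.exp (κ / 2 * (η - θ) + Real.log (γ θ)) := Real.exp_le_exp.2 h2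
      _ = _ := by rw [Real.exp_add, Real.exp_log (hpos θ)]
  · intro t _ r hr
    filter_upwards [(eventually_level_circ hK hκ a t).filter_mono nhdsWithin_le_nhds,
      self_mem_nhdsWithin] with z hz hzt
    obtain ⟨h1, h2⟩ := hz (by simp [starAngles, h])
    have hzt' : 0 < z - t := sub_pos.2 hzt
    have hd : ‖circ z - circ t‖ ≤ z - t := by
      simpa [abs_of_pos hzt'] using norm_circ_sub_le z t
    have hκ0 : 0 ≤ κ := by
      have ht : a + circ t ∈ starCone K a := by simp [h]
      obtain ⟨T, hT, -⟩ := mem_starCone.1 ht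
      obtain ⟨c, ρ, hρ, -, hd⟩ := hκ T hT.1
      exact nonneg_of_mul_nonneg_left (Metric.diam_nonneg.trans hd) hρ
    have hlog : ∀ {p q : ℝ}, 0 < p → 0 < q → |p - q| ≤ κ / 2 * q * ‖circ z - circ t‖ →
        Real.log p - Real.log q ≤ r * (z - t) := by
      intro p q hp hq hpq
      have e1 := Real.log_le_sub_one_of_pos (div_pos hp hq)
      rw [Real.log_div hp.ne' hq.ne'] at e1
      have e2 : p / q - 1 ≤ κ / 2 * ‖circ z - circ t‖ := by
        rw [div_sub_one hq.ne', div_le_iff₀ hq]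
        have := (le_abs_self _).trans hpq
        linarith
      calc _ ≤ κ / 2 * ‖circ z - circ t‖ := e1.trans e2
        _ ≤ κ / 2 * (z - t) := by gcongr
        _ ≤ _ := by gcongr
    rw [Real.norm_eq_abs, abs_le]
    have l1 := hlog (hpos z) (hpos t) h1
    have l2 := hlog (hpos t) (hpos z) (by rw [abs_sub_comm]; exact h2)
    constructor
    · linarith
    · exact l1

/-- The level is comparable to the distance from an interior vertex `a`, with constants whose ratio
is controlled by the shape regularity. -/
theorem exists_level_bounds (hK : IsTriangulation K Ω) (hκ : IsShapeRegular K κ) {a : Plane}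
    (ha : a ∈ K.vertices) (h : starCone K a = univ) :
    ∃ m M : ℝ, 0 < m ∧ m ≤ M ∧ M ≤ Real.exp (Real.pi * κ) * m ∧
      ∀ x, m * ‖x - a‖ ≤ level K a x ∧ level K a x ≤ M * ‖x - a‖ := by
  set γ : ℝ → ℝ := fun θ => level K a (a + circ θ) with hγ
  have hpos : ∀ θ, 0 < γ θ := fun θ => level_circ_pos (by simp [starAngles, h])
  have hc : Continuous γ := (continuous_level hK h).comp (continuous_circ.const_add a)
  have hκ0 := kappa_nonneg hK hκ ha
  have hpi := Real.two_pi_pos.le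
  obtain ⟨θm, -, hm⟩ := isCompact_Icc.exists_isMinOn (nonempty_Icc.2 hpi) hc.continuousOn
  have hred : ∀ x : Plane, x ≠ a → ∀ η, ∃ θ ∈ Ico η (η + 2 * Real.pi),
      level K a x = ‖x - a‖ * γ θ := by
    intro x hx η
    have hn : 0 < ‖x - a‖ := norm_pos_iff.2 (sub_ne_zero.2 hx)
    obtain ⟨θ, hθ, hcθ⟩ := exists_circ_eq (x := ‖x - a‖⁻¹ • (x - a))
      (by rw [norm_smul, norm_inv, norm_norm, inv_mul_cancel₀ hn.ne']) η
    refine ⟨θ, hθ, ?_⟩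
    rw [← level_ray (by simp [starAngles, h]) hn.le, hcθ, smul_smul, mul_inv_cancel₀ hn.ne',
      one_smul, add_sub_cancel]
  refine ⟨γ θm, Real.exp (Real.pi * κ) * γ θm, hpos θm, ?_, le_rfl, fun x => ?_⟩
  · refine le_mul_of_one_le_left (hpos θm).le (Real.one_le_exp ?_)
    have := Real.pi_pos
    positivity
  · rcases eq_or_ne x a with rfl | hx
    · simp [level_self hK ha]
    · constructor
      · obtain ⟨θ, hθ, e⟩ := hred x hx 0
        rw [e, mul_comm]
        have : γ θm ≤ γ θ := hm ⟨hθ.1, by linarith [hθ.2]⟩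
        gcongr
      · obtain ⟨θ, hθ, e⟩ := hred x hx θm
        rw [e, mul_comm]
        have h1 := level_circ_le hK hκ h hθ.1
        have h2 : κ / 2 * (θ - θm) ≤ Real.pi * κ := by nlinarith [hθ.2]
        have h3 : γ θ ≤ Real.exp (Real.pi * κ) * γ θm :=
          h1.trans (mul_le_mul_of_nonneg_right (Real.exp_le_exp.2 h2) (hpos θm).le)
        gcongr

theorem exists_lipschitzWith_hat (hK : IsTriangulation K Ω) {a : Plane} (h : starCone K a = univ) :
    ∃ L, LipschitzWith L (hat K a) := by
  obtain ⟨L, hL0, hL⟩ := exists_lipschitz_triCoord hK a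
  refine ⟨L.toNNReal, lipschitzWith_of_eventually fun x => ?_⟩
  rw [Real.coe_toNNReal _ hL0]
  by_cases hx : x ∈ starDomain K a
  · filter_upwards [eventually_abs_hat_sub_le hK hL x,
      hK.isOpen.mem_nhds (starDomain_subset hK a hx)] with y hy hyΩ
    exact hy (hK.subset_space hyΩ)
  · have h0 : hat K a x = 0 := by
      rw [starDomain_eq_level hK h, mem_ofPred_eq, not_lt] at hx
      rw [hat_eq_max hK h, max_eq_right (by linarith)]
    filter_upwards [eventually_abs_hat_sub_le hK hL x] with y hy
    by_cases hyK : y ∈ K.space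
    · exact hy hyK
    · rw [hat_of_notMem_space hyK, h0, sub_zero, abs_zero]
      positivity

theorem mem_starDomain_iff_hat_pos (hK : IsTriangulation K Ω) {a : Plane} (h : starCone K a = univ)
    {x : Plane} : x ∈ starDomain K a ↔ 0 < hat K a x := by
  rw [starDomain_eq_level hK h, mem_ofPred_eq, hat_eq_max hK h, lt_max_iff]
  simp

/-- The product with the hat function of an interior vertex is in `H¹₀`. It is the limit of the
products with the truncations `max (ψ_a - δ, 0)`, whose supports are compact subsets of `ω_a`. -/
theorem hat_mul_memH10_of_interior (hK : IsTriangulation K Ω) {a : Plane}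
    (h : starCone K a = univ) {v : Plane → ℝ} {g : Plane → Plane}
    (hv : HasWeakGrad (starDomain K a) v g) :
    HasWeakGrad Ω (fun x => hat K a x * v x) (hatMulGrad K a v g) ∧
      MemH10 Ω (fun x => hat K a x * v x) := by
  have hsub := starDomain_subset hK a
  have hω := isOpen_starDomain (K := K) a
  obtain ⟨L, hL⟩ := exists_lipschitzWith_hat hK h
  set δ : ℕ → ℝ := fun n => 1 / ((n : ℝ) + 1) with hδ
  have hδ0 : ∀ n, 0 < δ n := fun n => Nat.one_div_pos_of_nat
  have hδlim : Tendsto δ atTop (𝓝 0) := tendsto_one_div_add_atTop_nhds_zero_nat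
  set η : ℕ → Plane → ℝ := fun n x => max (hat K a x - δ n) 0 with hη
  have hηL : ∀ n, LipschitzWith L (η n) := fun n => by
    have h1 : LipschitzWith L fun x => hat K a x - δ n := by
      refine LipschitzWith.of_dist_le_mul fun x y => ?_
      rw [dist_sub_right]
      exact hL.dist_le_mul x y
    exact h1.max_const 0
  have hηt : ∀ n, tsupport (η n) ⊆ {x | δ n ≤ hat K a x} := fun n => by
    refine closure_minimal (fun x hx => ?_) (isClosed_le continuous_const hL.continuous)
    by_contra hn
    refine hx (max_eq_right ?_)
    have : hat K a x < δ n := not_le.1 hn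
    linarith
  have hηω : ∀ n, tsupport (η n) ⊆ starDomain K a := fun n x hx =>
    (mem_starDomain_iff_hat_pos hK h).2 ((hδ0 n).trans_le (hηt n hx))
  have hηc : ∀ n, HasCompactSupport (η n) := fun n =>
    (hK.isCompact_closedStar a).of_isClosed_subset (isClosed_tsupport _)
      ((hηω n).trans interior_subset)
  have hw := fun n => memH10_mul_of_lipschitz hK.isOpen hω hsub hv (hηL n) (hηc n) (hηω n)
  have hη0 : ∀ n x, 0 ≤ η n x := fun n x => le_max_right _ _
  have hηle : ∀ n x, η n x ≤ hat K a x := fun n x =>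
    max_le (by linarith [hδ0 n]) (hat_nonneg hK a x)
  have hdiff : ∀ n x, ‖hat K a x - η n x‖ ≤ 1 := fun n x => by
    rw [Real.norm_of_nonneg (sub_nonneg.2 (hηle n x))]
    linarith [hη0 n x, hat_le_one hK a x]
  have hlim : ∀ x, Tendsto (fun n => hat K a x - η n x) atTop (𝓝 0) := fun x => by
    refine squeeze_zero (fun n => sub_nonneg.2 (hηle n x)) (fun n => ?_) hδlim
    have : hat K a x - δ n ≤ η n x := le_max_left _ _
    linarith
  have hoff : ∀ x, x ∉ starDomain K a → hat K a x = 0 := fun x hx =>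
    le_antisymm (not_lt.1 fun h' => hx ((mem_starDomain_iff_hat_pos hK h).2 h')) (hat_nonneg hK a x)
  have hηoff : ∀ n x, x ∉ starDomain K a → η n x = 0 := fun n x hx =>
    image_eq_zero_of_notMem_tsupport fun h' => hx (hηω n h')
  have hgrad : ∀ x, ‖gradient (hat K a) x‖ ≤ L := fun x => by
    rw [norm_gradient]
    exact norm_fderiv_le_of_lipschitz ℝ hL
  have hgradη : ∀ n x, ‖gradient (η n) x‖ ≤ L := fun n x => by
    rw [norm_gradient]
    exact norm_fderiv_le_of_lipschitz ℝ (hηL n)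
  refine memH10_of_tendsto hK.isOpen (fun n => (hw n).1) (fun n => (hw n).2)
    (memL2_hat_mul hK hv.memL2)
    (memL2_indicator hω hsub (memL2_hatMulGrad_aux hK hv.memL2 hv.memL2_grad)) ?_ ?_
  · refine tendsto_eLpNorm_two_of_dominated
      (b := (starDomain K a).indicator fun x => ‖v x‖)
      (fun n => ((memL2_hat_mul hK hv.memL2).sub (hw n).1.memL2).1)
      (memL2_indicator hω hsub hv.memL2.norm) (fun n => Eventually.of_forall fun x => ?_)
      (Eventually.of_forall fun x => ?_)
    · by_cases hx : x ∈ starDomain K a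
      · rw [indicator_of_mem hx, ← sub_mul, norm_mul]
        exact mul_le_of_le_one_left (norm_nonneg _) (hdiff n x)
      · rw [indicator_of_notMem hx, hoff x hx, hηoff n x hx]
        simp
    · simpa [sub_mul] using (hlim x).mul_const (v x)
  · refine tendsto_eLpNorm_two_of_dominated
      (b := (starDomain K a).indicator fun x => ‖g x‖ + 2 * L * ‖v x‖)
      (fun n => ((memL2_indicator hω hsub
        (memL2_hatMulGrad_aux hK hv.memL2 hv.memL2_grad)).sub (hw n).1.memL2_grad).1)
      (memL2_indicator hω hsub (hv.memL2_grad.norm.add (hv.memL2.norm.const_mul _)))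
      (fun n => Eventually.of_forall fun x => ?_) (Eventually.of_forall fun x => ?_)
    · by_cases hx : x ∈ starDomain K a
      · rw [indicator_of_mem hx, hatMulGrad, indicator_of_mem hx]
        calc _ = ‖(hat K a x - η n x) • g x + v x • (gradient (hat K a) x - gradient (η n) x)‖ := by
              congr 1
              module
          _ ≤ ‖hat K a x - η n x‖ * ‖g x‖ + ‖v x‖ * (‖gradient (hat K a) x‖ + ‖gradient (η n) x‖) := by
              refine (norm_add_le _ _).trans ?_
              rw [norm_smul, norm_smul]
              gcongr
              exact norm_sub_le _ _
          _ ≤ 1 * ‖g x‖ + ‖v x‖ * (L + L) := by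
              gcongr
              · exact hdiff n x
              · exact hgrad x
              · exact hgradη n x
          _ = _ := by ring
      · rw [indicator_of_notMem hx, hatMulGrad, indicator_of_notMem hx, hηoff n x hx,
          gradient_eq_zero_of_notMem fun h' => hx (hηω n h')]
        simp
    · by_cases hx : x ∈ starDomain K a
      · have hpos := (mem_starDomain_iff_hat_pos hK h).1 hx
        have h1 : Tendsto (fun n => (hat K a x - η n x) • g x) atTop (𝓝 0) := by
          simpa using (hlim x).smul_const (g x)
        refine h1.congr' ?_
        filter_upwards [hδlim.eventually (gt_mem_nhds hpos)] with n hn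
        have heq : η n =ᶠ[𝓝 x] fun y => hat K a y - δ n := by
          filter_upwards [hL.continuous.continuousAt.eventually (lt_mem_nhds hn)] with y hy
          exact max_eq_left (sub_nonneg.2 hy.le)
        have hge : gradient (η n) x = gradient (hat K a) x := by
          simp only [gradient]
          rw [heq.fderiv_eq, fderiv_sub_const]
        rw [hatMulGrad, indicator_of_mem hx, hge]
        module
      · refine tendsto_const_nhds.congr fun n => ?_
        rw [hatMulGrad, indicator_of_notMem hx, hηoff n x hx,
          gradient_eq_zero_of_notMem fun h' => hx (hηω n h')]
        simp

/-! ### Poincaré's inequality on the star of an interior vertex -/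

theorem memL2_of_continuous {S : Set Plane} (hS : IsCompact S) {φ : Plane → ℝ}
    (hφ : Continuous φ) : MemL2 S φ := by
  obtain ⟨C, hC⟩ := hS.exists_bound_of_continuousOn hφ.continuousOn
  have : IsFiniteMeasure (volume.restrict S) := ⟨by
    rw [Measure.restrict_apply_univ]; exact hS.measure_lt_top⟩
  exact MemLp.of_bound hφ.aestronglyMeasurable C
    ((ae_restrict_iff' hS.measurableSet).2 (Eventually.of_forall hC))

theorem tendsto_average_of_tendsto_normL2 {S B : Set Plane} (hBS : B ⊆ S) (hBt : volume B ≠ ⊤)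
    {v : Plane → ℝ} {φ : ℕ → Plane → ℝ} (hv : MemL2 S v) (hφ : ∀ n, MemL2 S (φ n))
    (h : Tendsto (fun n => normL2 S (fun x => v x - φ n x)) atTop (𝓝 0)) :
    Tendsto (fun n => ⨍ x in B, φ n x) atTop (𝓝 (⨍ x in B, v x)) := by
  have hle : volume.restrict B ≤ volume.restrict S := Measure.restrict_mono_set _ hBS
  have : IsFiniteMeasure (volume.restrict B) := ⟨by
    rw [Measure.restrict_apply_univ]; exact hBt.lt_top⟩
  have h1 := tendsto_integral_smul (μ := volume.restrict B) (v := fun _ => (1 : ℝ))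
    (vn := fun _ _ => (1 : ℝ)) (g := v) (gn := φ) (memLp_const 1) (hv.mono_measure hle)
    (fun _ => memLp_const 1) (fun n => (hφ n).mono_measure hle) (by simp)
    (tendsto_of_tendsto_of_tendsto_of_le_of_le tendsto_const_nhds h (fun _ => zero_le)
      fun n => eLpNorm_mono_measure _ hle) (Or.inl fun _ => rfl)
  simp only [one_smul] at h1
  simp only [setAverage_eq]
  exact h1.const_smul _

/-- Poincaré's inequality on a compact set that is star shaped with respect to a disc, for functions
in `H¹` of a neighbourhood of this set. -/
theorem HasWeakGrad.poincare {ω S : Set Plane} (hω : IsOpen ω) (hS : IsCompact S) (hSω : S ⊆ ω)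
    {v : Plane → ℝ} {g : Plane → Plane} (hv : HasWeakGrad ω v g) {a : Plane} {r R : ℝ} (hr : 0 < r)
    (hrR : r ≤ R) (hR : ∀ x ∈ S, ‖x - a‖ ≤ R) (hB : Metric.ball a r ⊆ S)
    (hstar : ∀ x ∈ S, ∀ s : ℝ, 0 ≤ s → s ≤ 1 → a + s • (x - a) ∈ S) :
    normL2 S (fun x => v x - ⨍ y in Metric.ball a r, v y) ≤
      ENNReal.ofReal (12 * R ^ 2 / r) * normL2 S g := by
  obtain ⟨ρ, hρ, hρω⟩ := hS.exists_cthickening_subset_open hω hSω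
  obtain ⟨φ, hφ, h1, h2⟩ := hv.exists_approx hω.measurableSet hS.measurableSet hρ
    fun x hx => (Metric.closedBall_subset_cthickening hx ρ).trans hρω
  have hvS : MemL2 S v := hv.memL2.mono_measure (Measure.restrict_mono_set _ hSω)
  have hgS : MemL2 S g := hv.memL2_grad.mono_measure (Measure.restrict_mono_set _ hSω)
  have hφS : ∀ n, MemL2 S (φ n) := fun n => memL2_of_continuous hS (hφ n).continuous
  have hφ1 : ∀ n, ContDiff ℝ 1 (φ n) := fun n => (hφ n).of_le (by simp)
  set c := ⨍ y in Metric.ball a r, v y with hc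
  set cn : ℕ → ℝ := fun n => ⨍ y in Metric.ball a r, φ n y with hcn
  have hclim : Tendsto cn atTop (𝓝 c) :=
    tendsto_average_of_tendsto_normL2 hB measure_ball_lt_top.ne hvS hφS h1
  have hμ : IsFiniteMeasure (volume.restrict S) := ⟨by
    rw [Measure.restrict_apply_univ]; exact hS.measure_lt_top⟩
  have hconst : Tendsto (fun n => normL2 S (fun _ : Plane => c - cn n)) atTop (𝓝 0) := by
    have h0 : Tendsto (fun n => ‖c - cn n‖ₑ) atTop (𝓝 0) := by
      simpa using (hclim.const_sub c).enorm
    simp only [normL2, eLpNorm_const' _ two_ne_zero ENNReal.ofNat_ne_top]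
    have := ENNReal.Tendsto.mul_const h0 (Or.inr (ENNReal.rpow_ne_top_of_nonneg
      (y := 1 / (2 : ℝ≥0∞).toReal) (by positivity) (measure_ne_top (volume.restrict S) univ)))
    rwa [zero_mul] at this
  refine normL2_le_of_tendsto ENNReal.ofReal_ne_top (f := fun x => v x - c)
    (fn := fun n x => φ n x - cn n) (gn := fun n => gradient (φ n))
    (hvS.1.sub aestronglyMeasurable_const) (fun n => (hφS n).1.sub aestronglyMeasurable_const)
    hgS.1 (fun n => (measurable_gradient _).aestronglyMeasurable) ?_ h2
    fun n => poincare_starShaped (hφ1 n) hS.measurableSet hr hrR hR hB hstar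
  refine tendsto_of_tendsto_of_tendsto_of_le_of_le tendsto_const_nhds
    (by simpa using h1.add hconst) (fun _ => zero_le) fun n => ?_
  have e : (fun x => v x - c - (φ n x - cn n)) = (fun x => v x - φ n x) - fun _ => c - cn n := by
    ext x
    simp only [Pi.sub_apply]
    ring
  rw [e]
  exact eLpNorm_sub_le (hvS.1.sub (hφS n).1) aestronglyMeasurable_const (by norm_num)

theorem normL2_sq_eq_ofReal {F : Type*} [NormedAddCommGroup F] [InnerProductSpace ℝ F]
    {ω : Set Plane} {g : Plane → F} (h : MemL2 ω g) :
    normL2 ω g ^ 2 = ENNReal.ofReal (∫ x in ω, inner ℝ (g x) (g x)) := by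
  rw [normL2, eLpNorm_two_sq, ofReal_integral_eq_lintegral_ofReal
    (integrable_inner_of_memLp_two h h) (Eventually.of_forall fun x => real_inner_self_nonneg)]
  refine lintegral_congr fun x => ?_
  rw [real_inner_self_eq_norm_sq, ENNReal.ofReal_pow (norm_nonneg _), ofReal_norm]

/-- Among the functions that differ by constants, the one with vanishing mean has the smallest
`L²` norm. -/
theorem normL2_le_sub_const {ω : Set Plane} (hfin : volume ω ≠ ⊤) {v : Plane → ℝ} (hv : MemL2 ω v)
    (h0 : ∫ x in ω, v x = 0) (c : ℝ) : normL2 ω v ≤ normL2 ω (fun x => v x - c) := by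
  have : IsFiniteMeasure (volume.restrict ω) := ⟨by
    rw [Measure.restrict_apply_univ]; exact hfin.lt_top⟩
  have hvc : MemL2 ω (fun x => v x - c) := hv.sub (memLp_const c)
  rw [← ENNReal.pow_le_pow_left_iff two_ne_zero, normL2_sq_eq_ofReal hv, normL2_sq_eq_ofReal hvc]
  refine ENNReal.ofReal_le_ofReal ?_
  have hi : Integrable v (volume.restrict ω) := hv.integrable (by norm_num)
  have hi2 := integrable_inner_of_memLp_two hv hv
  have e : ∫ x in ω, inner ℝ (v x - c) (v x - c) =
      (∫ x in ω, inner ℝ (v x) (v x)) + ((∫ x in ω, c ^ 2) - 2 * c * ∫ x in ω, v x) := by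
    have hi3 : Integrable (fun x => c ^ 2 - 2 * c * v x) (volume.restrict ω) :=
      (integrable_const _).sub (hi.const_mul _)
    rw [← integral_const_mul, ← integral_sub (integrable_const _) (hi.const_mul _),
      ← integral_add hi2 hi3]
    refine integral_congr_ae (Eventually.of_forall fun x => ?_)
    simp only [RCLike.inner_apply, conj_trivial]
    ring
  rw [e, h0, mul_zero, sub_zero]
  exact le_add_of_nonneg_right (integral_nonneg fun x => sq_nonneg c)

/-- Poincaré's inequality on the star of an interior vertex. The sublevel sets of the level at less than
`1` exhaust the star, and those above `1 / 2` contain a disc of radius `1 / (2 M)`. -/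
theorem poincare_starDomain (hK : IsTriangulation K Ω) {a : Plane} (h : starCone K a = univ)
    {m M : ℝ} (hm : 0 < m) (hmM : m ≤ M)
    (hmM' : ∀ x, m * ‖x - a‖ ≤ level K a x ∧ level K a x ≤ M * ‖x - a‖) {v : Plane → ℝ}
    {g : Plane → Plane} (hv : HasWeakGrad (starDomain K a) v g) :
    normL2 (starDomain K a) (fun x => v x - ⨍ y in Metric.ball a (1 / (2 * M)), v y) ≤
      ENNReal.ofReal (24 * M / m ^ 2) * normL2 (starDomain K a) g := by
  have hM : 0 < M := hm.trans_le hmM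
  set S : ℕ → Set Plane := fun n => {x | level K a x ≤ 1 - 1 / ((n : ℝ) + 2)} with hS
  have hcl := continuous_level hK h
  have hsub : ∀ n, S n ⊆ starDomain K a := fun n x hx => by
    rw [starDomain_eq_level hK h]
    have hx' : level K a x ≤ 1 - 1 / ((n : ℝ) + 2) := hx
    have : 0 < 1 / ((n : ℝ) + 2) := by positivity
    exact hx'.trans_lt (by linarith)
  have hcomp : ∀ n, IsCompact (S n) := fun n =>
    (hK.isCompact_closedStar a).of_isClosed_subset (isClosed_le hcl continuous_const)
      ((hsub n).trans interior_subset)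
  have hmono : Monotone S := fun n k hnk x hx => by
    have hx' : level K a x ≤ 1 - 1 / ((n : ℝ) + 2) := hx
    refine hx'.trans ?_
    gcongr
  have hU : ⋃ n, S n = starDomain K a := by
    refine subset_antisymm (iUnion_subset hsub) fun x hx => ?_
    rw [starDomain_eq_level hK h] at hx
    have hx' : 0 < 1 - level K a x := sub_pos.2 hx
    obtain ⟨n, hn⟩ := exists_nat_one_div_lt hx'
    refine mem_iUnion.2 ⟨n, show level K a x ≤ 1 - 1 / ((n : ℝ) + 2) from ?_⟩
    have : 1 / ((n : ℝ) + 2) ≤ 1 / ((n : ℝ) + 1) := by gcongr; norm_num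
    linarith
  set f : Plane → ℝ := fun x => v x - ⨍ y in Metric.ball a (1 / (2 * M)), v y with hf
  have hn : ∀ n, normL2 (S n) f ≤ ENNReal.ofReal (24 * M / m ^ 2) * normL2 (starDomain K a) g := by
    intro n
    have h2 : (1 : ℝ) / ((n : ℝ) + 2) ≤ 1 / 2 := by
      gcongr
      linarith [n.cast_nonneg (α := ℝ)]
    have key := hv.poincare (isOpen_starDomain a) (hcomp n) (hsub n) (a := a)
      (r := 1 / (2 * M)) (R := 1 / m) (by positivity)
      (one_div_le_one_div_of_le hm (by linarith)) (fun x hx => ?_) (fun x hx => ?_)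
      (fun x hx s hs0 hs1 => ?_)
    · refine key.trans (mul_le_mul' (le_of_eq ?_) (eLpNorm_mono_measure _
        (Measure.restrict_mono_set _ (hsub n))))
      congr 1
      field_simp
      norm_num
    · have hx' : level K a x ≤ 1 - 1 / ((n : ℝ) + 2) := hx
      have : 0 < 1 / ((n : ℝ) + 2) := by positivity
      rw [le_div_iff₀ hm, mul_comm]
      linarith [(hmM' x).1]
    · rw [mem_ball_iff_norm, lt_div_iff₀ (by positivity)] at hx
      change level K a x ≤ 1 - 1 / ((n : ℝ) + 2)
      linarith [(hmM' x).2]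
    · have hx' : level K a x ≤ 1 - 1 / ((n : ℝ) + 2) := hx
      change level K a (a + s • (x - a)) ≤ 1 - 1 / ((n : ℝ) + 2)
      rw [level_homothety (by simp [h]) hs0]
      exact (mul_le_of_le_one_left level_nonneg hs1).trans hx'
  rw [← ENNReal.pow_le_pow_left_iff two_ne_zero]
  conv_lhs => rw [normL2, eLpNorm_two_sq, ← hU]
  rw [setLIntegral_iUnion_of_directed _ hmono.directed_le]
  refine iSup_le fun n => ?_
  rw [← eLpNorm_two_sq]
  exact (ENNReal.pow_le_pow_left_iff two_ne_zero).2 (hn n)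

/-- The stability of the multiplication by the hat function of an interior vertex. -/
theorem hat_mul_of_interior (hK : IsTriangulation K Ω) (hκ : IsShapeRegular K κ) {a : Plane}
    (ha : a ∈ K.vertices) (h : starCone K a = univ) {v : Plane → ℝ}
    (hv : MemH1 (starDomain K a) v) (h0 : ∫ x in starDomain K a, v x = 0) :
    normL2 Ω (hatMulGrad K a v (weakGrad (starDomain K a) v)) ≤
      ENNReal.ofReal (1 + 12 * κ * Real.exp (2 * Real.pi * κ)) *
        normL2 (starDomain K a) (weakGrad (starDomain K a) v) := by
  have hκ0 := kappa_nonneg hK hκ ha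
  have hg := hv.hasWeakGrad
  have hm := (isOpen_starDomain (K := K) a).measurableSet
  obtain ⟨m, M, hm0, hmM, hexp, hb⟩ := exists_level_bounds hK hκ ha h
  have hM0 := hm0.trans_le hmM
  set ω := starDomain K a with hω
  set g := weakGrad ω v with hgdef
  have hne : ∀ᵐ x ∂volume.restrict ω, x ≠ a := by
    refine ae_restrict_of_ae ?_
    rw [ae_iff]
    simp
  have h1 : normL2 ω (fun x => v x • gradient (hat K a) x) ≤
      ENNReal.ofReal (κ * M / 2) * normL2 ω v := by
    refine normL2_le_of_eq_zero_off hm ?_ ?_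
    · exact (ae_restrict_iff' hm).2 (Eventually.of_forall fun x hx hn => absurd hx hn)
    · filter_upwards [hne, ae_restrict_mem hm] with x hxa hx
      have hxa' : 0 < ‖x - a‖ := norm_pos_iff.2 (sub_ne_zero.2 hxa)
      rw [norm_smul, mul_comm]
      gcongr
      refine le_of_mul_le_mul_right ((norm_gradient_hat_le hK hκ ha hx).trans ?_) hxa'
      calc κ / 2 * level K a x ≤ κ / 2 * (M * ‖x - a‖) := by
            gcongr
            exact (hb x).2
        _ = _ := by ring
  have h2 : normL2 ω v ≤ ENNReal.ofReal (24 * M / m ^ 2) * normL2 ω g :=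
    (normL2_le_sub_const (volume_starDomain_ne_top hK a) hg.memL2 h0 _).trans
      (poincare_starDomain hK h hm0 hmM hb hg)
  have h3 : κ * M / 2 * (24 * M / m ^ 2) ≤ 12 * κ * Real.exp (2 * Real.pi * κ) := by
    have e : Real.exp (2 * Real.pi * κ) = Real.exp (Real.pi * κ) ^ 2 := by
      rw [← Real.exp_nat_mul]
      congr 1
      push_cast
      ring
    rw [e, show κ * M / 2 * (24 * M / m ^ 2) = 12 * κ * (M / m) ^ 2 by field_simp; ring]
    have : M / m ≤ Real.exp (Real.pi * κ) := (div_le_iff₀ hm0).2 hexp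
    gcongr
  calc _ ≤ normL2 ω g + normL2 ω (fun x => v x • gradient (hat K a) x) :=
        normL2_hatMulGrad_le hK hg.memL2 hg.memL2_grad
    _ ≤ normL2 ω g + ENNReal.ofReal (κ * M / 2) *
          (ENNReal.ofReal (24 * M / m ^ 2) * normL2 ω g) := by
        gcongr
        exact h1.trans (by gcongr)
    _ = (1 + ENNReal.ofReal (κ * M / 2 * (24 * M / m ^ 2))) * normL2 ω g := by
        rw [ENNReal.ofReal_mul (by positivity)]
        ring
    _ ≤ _ := by
        rw [ENNReal.ofReal_add zero_le_one (by positivity), ENNReal.ofReal_one]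
        gcongr

/-! ### Hat functions and the localized residuals -/

theorem exists_mvPolynomial_eq (A : Plane →ᵃ[ℝ] ℝ) :
    ∃ P : MvPolynomial (Fin 2) ℝ, P.totalDegree ≤ 1 ∧
      ∀ x : Plane, A x = MvPolynomial.eval (fun i => x i) P := by
  refine ⟨MvPolynomial.C (A 0) + ∑ i, MvPolynomial.C (A.linear (EuclideanSpace.single i 1)) *
    MvPolynomial.X i, ?_, fun x => ?_⟩
  · refine (MvPolynomial.totalDegree_add _ _).trans (max_le (by simp) ?_)
    refine MvPolynomial.totalDegree_finsetSum_le fun i _ => ?_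
    refine (MvPolynomial.totalDegree_mul _ _).trans ?_
    simp
  · have hx : x = x 0 • EuclideanSpace.single 0 1 + x 1 • EuclideanSpace.single 1 1 := by
      ext i
      fin_cases i <;> simp
    have hA : A x = A.linear x + A 0 := by
      have := A.map_vadd 0 x
      simpa using this
    rw [hA]
    conv_lhs => rw [hx]
    simp
    ring

/-- The hat function of an interior vertex is a continuous piecewise affine function in `H¹₀(Ω)`. -/
theorem hat_mem_piecewisePoly (hK : IsTriangulation K Ω) {a : Plane} (h : starCone K a = univ) :
    hat K a ∈ piecewisePoly K Ω (fun _ => 1) := by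
  obtain ⟨L, hL⟩ := exists_lipschitzWith_hat hK h
  refine ⟨hL.continuous, fun x hx => ?_, ?_, fun T hT => ?_⟩
  · by_contra hn
    exact hx (starDomain_subset hK a ((mem_starDomain_iff_hat_pos hK h).2
      ((hat_nonneg hK a x).lt_of_ne' hn)))
  · have := (hat_mul_memH10_of_interior hK h
      (HasWeakGrad.const (volume_starDomain_ne_top hK a) 1)).2
    simpa using this
  · obtain ⟨P, hP, hPx⟩ := exists_mvPolynomial_eq (triCoord T a)
    exact ⟨P, hP, fun x hx => by rw [hat_eq_triCoord hT hx, hPx]⟩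

/-- The constant in the efficiency estimate, which dominates the norms of the multiplication by the hat
functions of interior vertices and of boundary vertices. The absolute values only make it positive for
`κ < 0`, where there is no triangle. -/
noncomputable def efficiencyConst (κ : ℝ) : ℝ :=
  1 + 12 * |κ| * Real.exp (2 * Real.pi * |κ|) + |κ| / 2 * (9 * (1 + |κ| / 2))

theorem efficiencyConst_pos (κ : ℝ) : 0 < efficiencyConst κ := by
  unfold efficiencyConst
  positivity

/-- The multiplication by a hat function `ψ_a` is bounded from `H¹_*(ω_a)` to `H¹₀(Ω)`, uniformly in
all triangulations with the same constant of shape regularity. -/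
theorem hat_mul_of_mem_starSpace (hK : IsTriangulation K Ω) (hκ : IsShapeRegular K κ) {a : Plane}
    (ha : a ∈ K.vertices) {v : Plane → ℝ} (hv : v ∈ starSpace K Ω a) :
    HasWeakGrad Ω (fun x => hat K a x * v x) (hatMulGrad K a v (weakGrad (starDomain K a) v)) ∧
      MemH10 Ω (fun x => hat K a x * v x) ∧
      normL2 Ω (hatMulGrad K a v (weakGrad (starDomain K a) v)) ≤
        ENNReal.ofReal (efficiencyConst κ) *
          normL2 (starDomain K a) (weakGrad (starDomain K a) v) := by
  have hκ0 := kappa_nonneg hK hκ ha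
  have hC : efficiencyConst κ =
      1 + 12 * κ * Real.exp (2 * Real.pi * κ) + κ / 2 * (9 * (1 + κ / 2)) := by
    rw [efficiencyConst, abs_of_nonneg hκ0]
  have h1 : 0 ≤ 12 * κ * Real.exp (2 * Real.pi * κ) := by positivity
  have h2 : 0 ≤ κ / 2 * (9 * (1 + κ / 2)) := by positivity
  rcases hv with ⟨haΩ, hv1, hv0⟩ | ⟨haΩ, hv1⟩
  · have h := (starCone_eq_univ_iff hK ha).2 haΩ
    have h3 := hat_mul_memH10_of_interior hK h hv1.hasWeakGrad
    refine ⟨h3.1, h3.2, (hat_mul_of_interior hK hκ ha h hv1 hv0).trans ?_⟩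
    gcongr
    linarith
  · have h : starCone K a ≠ univ := fun h => by
      rw [hK.isOpen.frontier_eq] at haΩ
      exact haΩ.2 ((starCone_eq_univ_iff hK ha).1 h)
    have h3 := hat_mul_of_boundary hK hκ ha h hv1
    refine ⟨h3.1, h3.2.1, h3.2.2.trans ?_⟩
    gcongr
    linarith

/-- The residual of the approximation is the energy product with the error. -/
theorem residual_eq {f u uT w : Plane → ℝ} (hΩ : IsOpen Ω) (hu : IsWeakSolution Ω f u)
    (huT : MemH10 Ω uT) (hw : MemH10 Ω w) :
    residual Ω f uT w =
      ∫ x in Ω, inner ℝ (weakGrad Ω (fun x => u x - uT x) x) (weakGrad Ω w x) := by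
  have h1 := hu.1.1.hasWeakGrad
  have h2 := huT.1.hasWeakGrad
  have h3 := hw.1.hasWeakGrad
  have h := hu.2 w hw
  rw [residual, sub_eq_zero] at h
  rw [residual, h, ← integral_sub (integrable_inner_of_memLp_two h1.memL2_grad h3.memL2_grad)
    (integrable_inner_of_memLp_two h2.memL2_grad h3.memL2_grad)]
  refine integral_congr_ae ?_
  filter_upwards [(h1.sub h2).weakGrad_ae_eq hΩ] with x hx
  rw [hx, inner_sub_left]

theorem integral_inner_hatMulGrad {a : Plane} (hK : IsTriangulation K Ω) (E : Plane → Plane)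
    (v : Plane → ℝ) (g : Plane → Plane) :
    ∫ x in Ω, inner ℝ (E x) (hatMulGrad K a v g x) =
      ∫ x in starDomain K a, inner ℝ (E x) (hatMulGrad K a v g x) := by
  refine setIntegral_eq_of_subset_of_forall_sdiff_eq_zero hK.isOpen.measurableSet
    (starDomain_subset hK a) fun x hx => ?_
  rw [hatMulGrad, indicator_of_notMem hx.2, inner_zero_right]

/-- Efficiency. -/
theorem dualNorm_localResidual_le (hK : IsTriangulation K Ω) (hκ : IsShapeRegular K κ)
    {f u uT : Plane → ℝ} (hu : IsWeakSolution Ω f u) (huT : MemH10 Ω uT) {a : Plane}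
    (ha : a ∈ K.vertices) :
    dualNorm (starDomain K a) (starSpace K Ω a) (localResidual K Ω f uT a) ≤
      ENNReal.ofReal (efficiencyConst κ) *
        normL2 (starDomain K a) (weakGrad Ω (fun x => u x - uT x)) := by
  refine iSup₂_le fun v hv => ENNReal.div_le_of_le_mul ?_
  obtain ⟨h1, h2, h3⟩ := hat_mul_of_mem_starSpace hK hκ ha hv
  have hE := (MemH10.sub hK.isOpen hu.1 huT).1.hasWeakGrad.memL2_grad
  set E := weakGrad Ω (fun x => u x - uT x)
  set G := hatMulGrad K a v (weakGrad (starDomain K a) v)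
  have hle : volume.restrict (starDomain K a) ≤ volume.restrict Ω :=
    Measure.restrict_mono_set _ (starDomain_subset hK a)
  have e : localResidual K Ω f uT a v = ∫ x in starDomain K a, inner ℝ (E x) (G x) := by
    rw [localResidual, residual_eq hK.isOpen hu huT h2, ← integral_inner_hatMulGrad hK]
    refine integral_congr_ae ?_
    filter_upwards [h1.weakGrad_ae_eq hK.isOpen] with x hx
    rw [hx]
  rw [e]
  calc _ ≤ normL2 (starDomain K a) E * normL2 (starDomain K a) G :=
        enorm_integral_inner_le (hE.1.mono_measure hle) (h1.memL2_grad.1.mono_measure hle)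
    _ ≤ normL2 (starDomain K a) E * (ENNReal.ofReal (efficiencyConst κ) *
          normL2 (starDomain K a) (weakGrad (starDomain K a) v)) := by
        gcongr
        exact (eLpNorm_mono_measure _ hle).trans h3
    _ = _ := by ring

/-! ### Reliability -/

theorem MemH10.memH1VanishingOn {ω : Set Plane} {v : Plane → ℝ} (hΩ : IsOpen Ω) (hω : IsOpen ω)
    (hs : ω ⊆ Ω) (hv : MemH10 Ω v) : MemH1VanishingOn ω (frontier ω ∩ frontier Ω) v := by
  obtain ⟨h1, φ, hφ, hl1, hl2⟩ := hv
  have hg := h1.hasWeakGrad.mono hs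
  have hle : volume.restrict ω ≤ volume.restrict Ω := Measure.restrict_mono_set _ hs
  refine ⟨hg.memH1, φ, fun n => (hφ n).mono fun x hx hxf => ?_,
    tendsto_of_tendsto_of_tendsto_of_le_of_le tendsto_const_nhds hl1 (fun _ => zero_le)
      fun n => eLpNorm_mono_measure _ hle,
    tendsto_of_tendsto_of_tendsto_of_le_of_le tendsto_const_nhds hl2 (fun _ => zero_le)
      fun n => ?_⟩
  · have := hxf.2
    rw [hΩ.frontier_eq] at this
    exact this.2 hx
  · rw [normL2_congr_sub (hg.weakGrad_ae_eq hω)]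
    exact eLpNorm_mono_measure _ hle

/-- The residual at `ψ_a e`, where `e` is the error, is controlled by the local dual norm. If `a` is
an interior vertex, Galerkin orthogonality allows to subtract the mean of `e` over `ω_a`. -/
theorem exists_hasWeakGrad_hat_mul_error (hK : IsTriangulation K Ω) (hκ : IsShapeRegular K κ)
    {U : Submodule ℝ (Plane → ℝ)} {f u uT : Plane → ℝ} (hU : IsFESpace K Ω U)
    (hu : IsWeakSolution Ω f u) (huT : IsGalerkinSolution Ω f U uT) (hT0 : MemH10 Ω uT) {a : Plane}
    (ha : a ∈ K.vertices) :
    ∃ P, HasWeakGrad Ω (fun x => hat K a x * (u x - uT x)) P ∧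
      ‖∫ x in Ω, inner ℝ (weakGrad Ω (fun x => u x - uT x) x) (P x)‖ₑ ≤
        dualNorm (starDomain K a) (starSpace K Ω a) (localResidual K Ω f uT a) *
          normL2 (starDomain K a) (weakGrad Ω (fun x => u x - uT x)) := by
  have hω := isOpen_starDomain (K := K) a
  have hsub := starDomain_subset hK a
  have hfin := volume_starDomain_ne_top hK a
  have he10 := MemH10.sub hK.isOpen hu.1 hT0
  set e : Plane → ℝ := fun x => u x - uT x with he
  have heE := he10.1.hasWeakGrad
  set E := weakGrad Ω e with hE
  have hEω : normL2 (starDomain K a) E ≠ ⊤ := (heE.mono hsub).memL2_grad.2.ne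
  have hd : dualNorm (starDomain K a) (starSpace K Ω a) (localResidual K Ω f uT a) ≠ ⊤ :=
    ((dualNorm_localResidual_le hK hκ hu hT0 ha).trans_lt
      (ENNReal.mul_lt_top ENNReal.ofReal_lt_top hEω.lt_top)).ne
  have hkey : ∀ c : ℝ, (fun x => e x - c) ∈ starSpace K Ω a →
      MemH10 Ω (fun x => hat K a x * (e x - c)) ∧
      ‖∫ x in Ω, inner ℝ (E x) (weakGrad Ω (fun x => hat K a x * (e x - c)) x)‖ₑ ≤
        dualNorm (starDomain K a) (starSpace K Ω a) (localResidual K Ω f uT a) *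
          normL2 (starDomain K a) E := by
    intro c hc
    have h10 := (hat_mul_of_mem_starSpace hK hκ ha hc).2.1
    refine ⟨h10, ?_⟩
    have hgr : weakGrad (starDomain K a) (fun x => e x - c) =ᵐ[volume.restrict (starDomain K a)]
        E := by
      have := ((heE.mono hsub).sub (HasWeakGrad.const hfin c)).weakGrad_ae_eq hω
      simpa using this
    have h1 : ‖localResidual K Ω f uT a (fun x => e x - c)‖ₑ / normL2 (starDomain K a) E ≤
        dualNorm (starDomain K a) (starSpace K Ω a) (localResidual K Ω f uT a) := by
      have h2 := le_iSup₂ (f := fun (v : Plane → ℝ) (_ : v ∈ starSpace K Ω a) =>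
        ‖localResidual K Ω f uT a v‖ₑ / normL2 (starDomain K a) (weakGrad (starDomain K a) v))
        (fun x => e x - c) hc
      have h3 : normL2 (starDomain K a) (weakGrad (starDomain K a) fun x => e x - c) =
          normL2 (starDomain K a) E := eLpNorm_congr_ae hgr
      rwa [h3] at h2
    rw [ENNReal.div_le_iff_le_mul (Or.inr hd) (Or.inl hEω)] at h1
    rwa [localResidual, residual_eq hK.isOpen hu hT0 h10] at h1
  rcases mem_or_mem_frontier hK ha with haΩ | haΩ
  · have hμ : IsFiniteMeasure (volume.restrict (starDomain K a)) := ⟨by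
      rw [Measure.restrict_apply_univ]; exact hfin.lt_top⟩
    set c := ⨍ x in starDomain K a, e x with hc
    have hmem : (fun x => e x - c) ∈ starSpace K Ω a := Or.inl ⟨haΩ,
      ((heE.mono hsub).sub (HasWeakGrad.const hfin c)).memH1, integral_sub_average _ _⟩
    obtain ⟨h10, hle⟩ := hkey c hmem
    have hψ := hat_mem_piecewisePoly hK ((starCone_eq_univ_iff hK ha).2 haΩ)
    have hψ0 : MemH10 Ω (hat K a) := hψ.2.2.1
    have horth : ∫ x in Ω, inner ℝ (E x) (weakGrad Ω (hat K a) x) = 0 := by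
      rw [← residual_eq hK.isOpen hu hT0 hψ0]
      exact huT.2 _ (hU.affine_subset hψ)
    have hw1 := h10.1.hasWeakGrad
    have hw2 := hψ0.1.hasWeakGrad
    refine ⟨_, (hw1.add (hw2.const_mul c)).congr (Eventually.of_forall fun x => ?_)
      (ae_eq_refl _), ?_⟩
    · simp only
      ring
    · have heq : ∫ x in Ω, inner ℝ (E x) (weakGrad Ω (fun x => hat K a x * (e x - c)) x +
          c • weakGrad Ω (hat K a) x) =
          ∫ x in Ω, inner ℝ (E x) (weakGrad Ω (fun x => hat K a x * (e x - c)) x) := by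
        simp only [inner_add_right, real_inner_smul_right]
        rw [integral_add (integrable_inner_of_memLp_two heE.memL2_grad hw1.memL2_grad)
          ((integrable_inner_of_memLp_two heE.memL2_grad hw2.memL2_grad).const_mul c),
          integral_const_mul, horth, mul_zero, add_zero]
      rw [heq]
      exact hle
  · have hmem : (fun x => e x - 0) ∈ starSpace K Ω a := by
      simp only [sub_zero]
      exact Or.inr ⟨haΩ, he10.memH1VanishingOn hK.isOpen hω hsub⟩
    obtain ⟨h10, hle⟩ := hkey 0 hmem
    simp only [sub_zero] at h10 hle
    exact ⟨_, h10.1.hasWeakGrad, hle⟩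

/-- Almost every point of `Ω` is in exactly one triangle, and so in three stars. -/
theorem ae_card_starDomain_le (hK : IsTriangulation K Ω) : ∀ᵐ x ∂volume.restrict Ω,
    ∑ a ∈ hK.finite_vertices.toFinset, (starDomain K a).indicator (1 : Plane → ℝ≥0∞) x ≤ 3 := by
  classical
  have hfin := hK.finite_triangles
  have h1 : ∀ᵐ x : Plane, ∀ T ∈ triangles K, ∀ T' ∈ triangles K, T ≠ T' →
      x ∉ convexHull ℝ (T : Set Plane) ∩ convexHull ℝ (T' : Set Plane) := by
    rw [ae_ball_iff hfin.countable]
    intro T hT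
    rw [ae_ball_iff hfin.countable]
    intro T' hT'
    by_cases hne : T = T'
    · exact Eventually.of_forall fun x h => absurd hne h
    · filter_upwards [measure_eq_zero_iff_ae_notMem.1 (volume_convexHull_inter hT hT' hne)]
        with x hx _ using hx
  filter_upwards [ae_restrict_of_ae h1, ae_restrict_mem hK.isOpen.measurableSet] with x hx hxΩ
  obtain ⟨T, hT, hxT⟩ := hK.mem_space_iff.1 (hK.subset_space hxΩ)
  have hstar : ∀ a, x ∈ starDomain K a → a ∈ T := by
    intro a hxa
    obtain ⟨T', hT', hxT'⟩ := mem_closedStar.1 (interior_subset hxa)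
    by_contra haT
    refine hx T hT T' hT'.1 (fun h => haT ?_) ⟨hxT, hxT'⟩
    rw [h]
    exact hT'.2
  calc ∑ a ∈ hK.finite_vertices.toFinset, (starDomain K a).indicator (1 : Plane → ℝ≥0∞) x
      ≤ ∑ a ∈ T, (starDomain K a).indicator (1 : Plane → ℝ≥0∞) x := by
        refine Finset.sum_le_sum_of_ne_zero fun a _ ha => hstar a ?_
        by_contra hn
        exact ha (indicator_of_notMem hn _)
    _ ≤ ∑ a ∈ T, 1 := Finset.sum_le_sum fun a _ => indicator_le_self' (fun _ _ => zero_le) x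
    _ = 3 := by
      rw [Finset.sum_const, hT.2]
      norm_num

theorem sum_normL2_starDomain_le (hK : IsTriangulation K Ω) {E : Plane → Plane}
    (hE : AEStronglyMeasurable E (volume.restrict Ω)) :
    ∑ a ∈ hK.finite_vertices.toFinset, normL2 (starDomain K a) E ^ 2 ≤ 3 * normL2 Ω E ^ 2 := by
  have hm : ∀ a, MeasurableSet (starDomain K a) := fun a => (isOpen_starDomain a).measurableSet
  have h1 : ∀ a, normL2 (starDomain K a) E ^ 2 =
      ∫⁻ x in Ω, (starDomain K a).indicator 1 x * ‖E x‖ₑ ^ 2 := by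
    intro a
    rw [normL2, eLpNorm_two_sq, ← Measure.restrict_restrict_of_subset (starDomain_subset hK a),
      ← lintegral_indicator (hm a)]
    refine lintegral_congr fun x => ?_
    by_cases hx : x ∈ starDomain K a
    · simp [hx]
    · simp [hx]
  have h2 : ∀ a, AEMeasurable (fun x => (starDomain K a).indicator (1 : Plane → ℝ≥0∞) x *
      ‖E x‖ₑ ^ 2) (volume.restrict Ω) := fun a =>
    ((measurable_one.indicator (hm a)).aemeasurable).mul (hE.enorm.pow_const 2)
  simp only [h1]
  rw [← lintegral_finsetSum' _ fun a _ => h2 a, normL2, eLpNorm_two_sq,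
    ← lintegral_const_mul' _ _ (by norm_num)]
  refine lintegral_mono_ae ?_
  filter_upwards [ae_card_starDomain_le hK] with x hx
  rw [← Finset.sum_mul]
  gcongr

/-- Reliability, with the sum over the finite set of vertices. -/
theorem reliability (hK : IsTriangulation K Ω) (hκ : IsShapeRegular K κ)
    {U : Submodule ℝ (Plane → ℝ)} {f u uT : Plane → ℝ} (hU : IsFESpace K Ω U)
    (hu : IsWeakSolution Ω f u) (huT : IsGalerkinSolution Ω f U uT) (hT0 : MemH10 Ω uT) :
    normL2 Ω (weakGrad Ω (fun x => u x - uT x)) ^ 2 ≤ 3 * ∑ a ∈ hK.finite_vertices.toFinset,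
      dualNorm (starDomain K a) (starSpace K Ω a) (localResidual K Ω f uT a) ^ 2 := by
  have heE := (MemH10.sub hK.isOpen hu.1 hT0).1.hasWeakGrad
  have hP : ∀ a, ∃ P, a ∈ K.vertices → HasWeakGrad Ω (fun x => hat K a x * (u x - uT x)) P ∧
      ‖∫ x in Ω, inner ℝ (weakGrad Ω (fun x => u x - uT x) x) (P x)‖ₑ ≤
        dualNorm (starDomain K a) (starSpace K Ω a) (localResidual K Ω f uT a) *
          normL2 (starDomain K a) (weakGrad Ω (fun x => u x - uT x)) := by
    intro a
    by_cases ha : a ∈ K.vertices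
    · obtain ⟨P, hP⟩ := exists_hasWeakGrad_hat_mul_error hK hκ hU hu huT hT0 ha
      exact ⟨P, fun _ => hP⟩
    · exact ⟨0, fun h => absurd h ha⟩
  choose P hP using hP
  set E := weakGrad Ω (fun x => u x - uT x) with hE
  set d : Plane → ℝ≥0∞ := fun a =>
    dualNorm (starDomain K a) (starSpace K Ω a) (localResidual K Ω f uT a) with hd
  set N : Plane → ℝ≥0∞ := fun a => normL2 (starDomain K a) E with hN
  set V := hK.finite_vertices.toFinset with hV
  have hmem : ∀ a ∈ V, a ∈ K.vertices := fun a ha => hK.finite_vertices.mem_toFinset.1 ha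
  -- the partition of unity splits the gradient of the error
  have hsum : E =ᵐ[volume.restrict Ω] fun x => ∑ a ∈ V, P a x := by
    refine HasWeakGrad.ae_eq hK.isOpen heE ((HasWeakGrad.sum V fun a ha =>
      (hP a (hmem a ha)).1).congr ?_ (ae_eq_refl _))
    filter_upwards [ae_restrict_mem hK.isOpen.measurableSet] with x hx
    rw [← Finset.sum_mul, sum_hat hK (hK.subset_space hx), one_mul]
  have h1 : ∫ x in Ω, inner ℝ (E x) (E x) = ∑ a ∈ V, ∫ x in Ω, inner ℝ (E x) (P a x) := by
    rw [← integral_finsetSum _ fun a ha =>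
      integrable_inner_of_memLp_two heE.memL2_grad (hP a (hmem a ha)).1.memL2_grad]
    refine integral_congr_ae ?_
    filter_upwards [hsum] with x hx
    conv_lhs => arg 3; rw [hx]
    rw [inner_sum]
  have h2 : normL2 Ω E ^ 2 ≤ ∑ a ∈ V, d a * N a := by
    rw [normL2_sq_eq_ofReal heE.memL2_grad, h1]
    calc _ ≤ ‖∑ a ∈ V, ∫ x in Ω, inner ℝ (E x) (P a x)‖ₑ := by
          rw [← ofReal_norm]
          exact ENNReal.ofReal_le_ofReal (le_abs_self _)
      _ ≤ ∑ a ∈ V, ‖∫ x in Ω, inner ℝ (E x) (P a x)‖ₑ := enorm_sum_le _ _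
      _ ≤ _ := Finset.sum_le_sum fun a ha => (hP a (hmem a ha)).2
  have h3 : (∑ a ∈ V, d a * N a) ^ 2 ≤ (∑ a ∈ V, d a ^ 2) * ∑ a ∈ V, N a ^ 2 := by
    have h4 := ENNReal.inner_le_Lp_mul_Lq V d N Real.HolderConjugate.two_two
    simp only [ENNReal.rpow_two] at h4
    refine (pow_le_pow_left' h4 2).trans (le_of_eq ?_)
    rw [mul_pow, ← ENNReal.rpow_two, ← ENNReal.rpow_two, ← ENNReal.rpow_mul, ← ENNReal.rpow_mul]
    norm_num
  have h5 := sum_normL2_starDomain_le hK heE.memL2_grad.1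
  rcases eq_or_ne (normL2 Ω E) 0 with h0 | h0
  · rw [h0]
    simp
  have ht : normL2 Ω E ^ 2 ≠ ⊤ := ENNReal.pow_ne_top heE.memL2_grad.2.ne
  refine (ENNReal.mul_le_mul_iff_left (pow_ne_zero 2 h0) ht).1 ?_
  calc normL2 Ω E ^ 2 * normL2 Ω E ^ 2 = (normL2 Ω E ^ 2) ^ 2 := (sq _).symm
    _ ≤ (∑ a ∈ V, d a * N a) ^ 2 := by gcongr
    _ ≤ (∑ a ∈ V, d a ^ 2) * ∑ a ∈ V, N a ^ 2 := h3
    _ ≤ (∑ a ∈ V, d a ^ 2) * (3 * normL2 Ω E ^ 2) := by gcongr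
    _ = _ := by ring

end HatResidual

theorem mainTheorem3 (κ : ℝ) :
    ∃ C₁ : ℝ, 0 < C₁ ∧
      ∀ (Ω : Set Plane) (K : Geometry.SimplicialComplex ℝ Plane)
        (U : Submodule ℝ (Plane → ℝ)) (f u uT : Plane → ℝ),
        IsTriangulation K Ω → IsShapeRegular K κ → IsFESpace K Ω U → MemL2 Ω f →
        IsWeakSolution Ω f u → IsGalerkinSolution Ω f U uT →
        normL2 Ω (weakGrad Ω (fun x => u x - uT x)) ^ 2 ≤
            3 * ∑' a : K.vertices,
              dualNorm (starDomain K a) (starSpace K Ω a) (localResidual K Ω f uT a) ^ 2 ∧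
          ∀ a ∈ K.vertices,
            dualNorm (starDomain K a) (starSpace K Ω a) (localResidual K Ω f uT a) ≤
              ENNReal.ofReal C₁ * normL2 (starDomain K a) (weakGrad Ω (fun x => u x - uT x)) := by
  refine ⟨efficiencyConst κ, efficiencyConst_pos κ, ?_⟩
  intro Ω K U f u uT hK hκ hU _ hu huT
  obtain ⟨p, hp⟩ := hU.piecewise_poly
  have hT0 : MemH10 Ω uT := (hp huT.1).2.2.1
  refine ⟨(reliability hK hκ hU hu huT hT0).trans ?_, fun a ha =>
    dualNorm_localResidual_le hK hκ hu hT0 ha⟩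
  gcongr
  rw [tsum_subtype K.vertices fun a =>
    dualNorm (starDomain K a) (starSpace K Ω a) (localResidual K Ω f uT a) ^ 2]
  refine le_trans (le_of_eq (Finset.sum_congr rfl fun a ha => ?_)) (ENNReal.sum_le_tsum _)
  rw [indicator_of_mem (hK.finite_vertices.mem_toFinset.1 ha)]
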